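/- Let $k$ be a field and let $Q$ be a quiver of type $A_n$ ($n\ge 1$) with vertices $1,\dots,n$ from left to right, exactly one arrow, of arbitrary direction, between $i$ and $i+1$ for each $i<n$, and no other arrows. Let $\mathbf d=(d_x)$ be a dimension vector ($d_x\ge 0$), $N=\sum_x d_x$, and let $\mathrm{rep}_Q(\mathbf d)$ be the space of families $V=(V_\alpha)$ of matrices over $k$ of size $d_{t(\alpha)}\times d_{s(\alpha)}$; for a directed path $P$ let $V_P$ be the composition of the $V_\alpha$ along $P$ (the identity if $P$ has length $0$). *Rank parameters.* For $a<b$ let $r_{[a,b]}(V)$ be the rank of the linear map $\varphi^V_{[a,b]}:\bigoplus_x V_x\to\bigoplus_y V_y$, where $x$ runs over the sources and $y$ over the sinks of the full subquiver on $\{a,\dots,b\}$, whose component $V_x\to V_y$ is $V_P$ if there is a path $P$ from $x$ to $y$ and $0$ otherwise. A vector $\mathbf r=(r_{[a,b]})_{a<b}$ is a rank parameter if $\mathbf r=(r_{[a,b]}(V))_{a<b}$ for some $V\in \mathrm{rep}_Q(\mathbf d)$; then $\mathcal O_{\mathbf r}$ denotes the $\prod_x \mathrm{GL}(d_x)$-orbit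 of such a $V$. *Blocking.* Order the row labels from north to south as the sequence $S_1$: the $x<n$ with arrow $x\to x+1$ in increasing order, then $n$, then the $x<n$ with arrow $x\leftarrow x+1$ in decreasing order. Order the column labels from west to east as the sequence $S_2$: the $y>1$ with arrow $y-1\leftarrow y$ in decreasing order, then $1$, then the $y>1$ with arrow $y-1\to y$ in increasing order. Consider $N\times N$ block matrices with block rows labelled by $S_1$ and block columns labelled by $S_2$, block row and block column $[x]$ having height and width $d_x$. Let $A_{[x]\times[y]}$ be the southwest submatrix of $A$ consisting of block row $[x]$ and all block rows south of it, and of block column $[y]$ and all block columns west of it. Let $S(x)$ be the label immediately south of $x$ in $S_1$ and $W(y)$ the label immediately west of $y$ in $S_2$. Let $\zeta_Q(V)$ be the block matrix whose $([x],[y])$-block is $0$ if $y>x+1$, and otherwise $V_P$ if there is a path $P$ from $y$ to $x$ and $0$ if there is none. *Zelevinsky permutation.* A permutation $w$ of $N$ letters is identified with the $N\times N$ matrix with $(i,j)$-entry $1$ if $i=w(j)$ and $0$ otherwise, blocked as above. It is a Zelevinsky permutation for $\mathbf r$ if (ZP1) $\operatorname{rank} w_{[x]\times[y]}=\operatorname{rank}\zeta_Q(V)_{[x]\times[y]}$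 for all $V\in\mathcal O_{\mathbf r}$ and all $x,y$, and (ZP2) the nonzero entries of each block form an identity matrix (possibly smaller than the block), these identity matrices being arranged from southwest to northeast within each block row and from northwest to southeast within each block column. The multiplicity matrix $M(w)$ is the $n\times n$ matrix $$M(w)_{[x],[y]}=\operatorname{rank} w_{[x]\times[y]}-\operatorname{rank} w_{[S(x)]\times[y]}-\operatorname{rank} w_{[x]\times[W(y)]}+\operatorname{rank} w_{[S(x)]\times[W(y)]},$$ where terms with an undefined label are $0$. For $p\le q$ let $I_{pq}$ be the representation that is $k$ at the vertices $p,\dots,q$ and $0$ elsewhere, with identity maps between the nonzero spaces. **Theorem.** Let $\mathbf r$ be a rank parameter and let $V\in\mathcal O_{\mathbf r}$ with $V\cong\bigoplus_{p\le q} I_{pq}^{\oplus m_{pq}}$. Put $n_{xy}=\sum_{p\le x<y\le q}m_{pq}$. Then there is exactly one Zelevinsky permutation $w_Q(\mathbf r)$ for $\mathbf r$. For all $x,y$, the entry $M(w_Q(\mathbf r))_{[x],[y]}$ is the number of $1$'s in the $([x],[y])$-block of $w_Q(\mathbf r)$, and $$M(w_Q(\mathbf r))_{[x],[y]}=\begin{cases}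 m_{yx} & \text{if } y\le x,\\ n_{xy} & \text{if } y=x+1,\\ 0 & \text{otherwise.}\end{cases}$$ -/

import Mathlib

namespace TypeAQuiver

/-! ### Type A quivers and their representations -/

/-- The direction of an arrow of a type A quiver drawn on a horizontal line. -/
inductive Dir
  | left
  | right
  deriving DecidableEq

/-- The arrows of the type A quiver `Q`. The vertices are `0, …, n` (from left to right), and for
each `i < n` there is exactly one arrow between `i` and `i + 1`, with direction `Q i`. -/
inductive Arrow {n : ℕ} (Q : Fin n → Dir) : Fin (n + 1) → Fin (n + 1) → Type
  | right (i : Fin n) (h : Q i = Dir.right) : Arrow Q i.castSucc i.succ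
  | left (i : Fin n) (h : Q i = Dir.left) : Arrow Q i.succ i.castSucc

/-- Directed paths (of length `≥ 0`) of the type A quiver `Q`. -/
inductive DPath {n : ℕ} (Q : Fin n → Dir) (x : Fin (n + 1)) : Fin (n + 1) → Type
  | nil : DPath Q x x
  | cons {y z : Fin (n + 1)} (P : DPath Q x y) (a : Arrow Q y z) : DPath Q x z

/-- Representations of `Q` over `k` with chosen finite bases `ι x` of the spaces at the vertices,
the map at an arrow being given by its matrix. -/
def MatRep (k : Type*) {n : ℕ} (Q : Fin n → Dir) (ι : Fin (n + 1) → Type) :=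
  ∀ ⦃x y : Fin (n + 1)⦄, Arrow Q x y → Matrix (ι y) (ι x) k

/-- The representation space `rep_Q(d)`. -/
abbrev RepSpace (k : Type*) {n : ℕ} (Q : Fin n → Dir) (d : Fin (n + 1) → ℕ) :=
  MatRep k Q (fun x => Fin (d x))

/-- Two representations are isomorphic: there are invertible matrices `g x` with
`g (t α) * V α = W α * g (s α)` for all arrows `α`. On `rep_Q(d)` this says that `V` and `W` lie in
the same `GL(d)`-orbit. -/
def Isomorphic {k : Type*} [Field k] {n : ℕ} {Q : Fin n → Dir} {ι κ : Fin (n + 1) → Type}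
    [∀ x, Fintype (ι x)] [∀ x, Fintype (κ x)] [∀ x, DecidableEq (ι x)] [∀ x, DecidableEq (κ x)]
    (V : MatRep k Q ι) (W : MatRep k Q κ) : Prop :=
  ∃ (g : ∀ x, Matrix (κ x) (ι x) k) (h : ∀ x, Matrix (ι x) (κ x) k),
    (∀ x, g x * h x = 1 ∧ h x * g x = 1) ∧
    ∀ ⦃x y : Fin (n + 1)⦄ (a : Arrow Q x y), g y * V a = W a * g x

/-- The direct sum of a family of representations. -/
def directSum {k : Type*} [Field k] {n : ℕ} {Q : Fin n → Dir} {J : Type} [DecidableEq J]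
    {ι : J → Fin (n + 1) → Type} (W : ∀ j, MatRep k Q (ι j)) :
    MatRep k Q (fun x => (j : J) × ι j x) :=
  fun _ _ a => Matrix.blockDiagonal' (fun j => W j a)

/-- The indecomposable (interval) representation `I_{pq}`: it is `k` at the vertices `p ≤ x ≤ q`,
zero at the others, and the maps between the nonzero spaces are the identity of `k`. -/
def intervalRep (k : Type*) [Field k] {n : ℕ} (Q : Fin n → Dir) (p q : Fin (n + 1)) :
    MatRep k Q (fun x => PLift (p ≤ x ∧ x ≤ q)) :=
  fun _ _ _ => Matrix.of fun _ _ => 1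

/-- The index set of the direct sum `⊕ m_{pq} I_{pq}`: `m p q` copies of each pair `p ≤ q`. -/
abbrev MultIndex {n : ℕ} (m : Fin (n + 1) → Fin (n + 1) → ℕ) :=
  (e : {e : Fin (n + 1) × Fin (n + 1) // e.1 ≤ e.2}) × Fin (m e.1.1 e.1.2)

/-- The representation `⊕_{p ≤ q} m_{pq} I_{pq}`. -/
def sumIntervals (k : Type*) [Field k] {n : ℕ} (Q : Fin n → Dir)
    (m : Fin (n + 1) → Fin (n + 1) → ℕ) :
    MatRep k Q (fun x => (j : MultIndex m) × PLift (j.1.1.1 ≤ x ∧ x ≤ j.1.1.2)) :=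
  directSum (fun j : MultIndex m => intervalRep k Q j.1.1.1 j.1.1.2)

/-- The number `n_{xy} = ∑_{p ≤ x < y ≤ q} m_{pq}`, for `x < y`. -/
def crossing {n : ℕ} (m : Fin (n + 1) → Fin (n + 1) → ℕ) (x y : Fin (n + 1)) : ℕ :=
  ∑ p ∈ Finset.Iic x, ∑ q ∈ Finset.Ici y, m p q

/-! ### Maps along paths, rank parameters -/

/-- `V_P`, the composition of the maps of `V` along the directed path `P`. -/
def pathMap {k : Type*} [Field k] {n : ℕ} {Q : Fin n → Dir} {d : Fin (n + 1) → ℕ}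
    (V : RepSpace k Q d) {x : Fin (n + 1)} :
    ∀ {y : Fin (n + 1)}, DPath Q x y → Matrix (Fin (d y)) (Fin (d x)) k
  | _, DPath.nil => 1
  | _, DPath.cons P a => V a * pathMap V P

open Classical in
/-- The map `V_y → V_x` along the directed path from `y` to `x` if there is one (it is then unique),
and `0` otherwise. It is the identity for `x = y`. -/
noncomputable def pathBlock {k : Type*} [Field k] {n : ℕ} {Q : Fin n → Dir}
    {d : Fin (n + 1) → ℕ} (V : RepSpace k Q d) (x y : Fin (n + 1)) :
    Matrix (Fin (d x)) (Fin (d y)) k :=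
  if h : Nonempty (DPath Q y x) then pathMap V h.some else 0

/-- Positions of rows (or columns) in a blocked matrix: a block label `x`, and one of the `d x`
positions inside the block. -/
abbrev BlockIdx {n : ℕ} (d : Fin (n + 1) → ℕ) := (x : Fin (n + 1)) × Fin (d x)

/-- `x` is a source of the full subquiver on the interval `[a, b]`. -/
def IsSourceIn {n : ℕ} (Q : Fin n → Dir) (a b x : Fin (n + 1)) : Prop :=
  (a ≤ x ∧ x ≤ b) ∧ ∀ z, a ≤ z → z ≤ b → IsEmpty (Arrow Q z x)

/-- `x` is a sink of the full subquiver on the interval `[a, b]`. -/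
def IsSinkIn {n : ℕ} (Q : Fin n → Dir) (a b x : Fin (n + 1)) : Prop :=
  (a ≤ x ∧ x ≤ b) ∧ ∀ z, a ≤ z → z ≤ b → IsEmpty (Arrow Q x z)

/-- The matrix of `φ^V_{[a,b]}`, from the sum of the `V_x` over the sources `x` of `Q_{[a,b]}` to
the sum of the `V_y` over its sinks `y`; the components are the maps along paths. -/
noncomputable def phi {k : Type*} [Field k] {n : ℕ} {Q : Fin n → Dir} {d : Fin (n + 1) → ℕ}
    (V : RepSpace k Q d) (a b : Fin (n + 1)) :
    Matrix {i : BlockIdx d // IsSinkIn Q a b i.1} {j : BlockIdx d // IsSourceIn Q a b j.1} k :=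
  Matrix.of fun i j => pathBlock V i.1.1 j.1.1 i.1.2 j.1.2

open Classical in
/-- `r_{[a,b]}(V)`, the rank of `φ^V_{[a,b]}`. -/
noncomputable def intervalRank {k : Type*} [Field k] {n : ℕ} {Q : Fin n → Dir}
    {d : Fin (n + 1) → ℕ} (V : RepSpace k Q d) (a b : Fin (n + 1)) : ℕ :=
  (phi V a b).rank

/-- `𝒪_r`: the orbit of the representations in `rep_Q(d)` with
rank parameter `r = (r_{[a,b]})_{a < b}` (only the values `r a b` with `a < b` matter). It is empty
if `r` is not a rank parameter. -/
def rankOrbit (k : Type*) [Field k] {n : ℕ} (Q : Fin n → Dir) (d : Fin (n + 1) → ℕ)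
    (r : Fin (n + 1) → Fin (n + 1) → ℕ) : Set (RepSpace k Q d) :=
  {V | ∃ V₀ : RepSpace k Q d, (∀ a b, a < b → r a b = intervalRank V₀ a b) ∧ Isomorphic V₀ V}

/-! ### The blocking and the Zelevinsky map -/

/-- The sequence `S₁` of row labels, from north to south. The sequence
`(R_1 ∖ t(R_1)) ◁ ⋯ ◁ (R_r ∖ t(R_r))` lists the sources of the right arrows from left to right,
then comes the last vertex, and `(L_l ∖ s(L_l)) ◁ ⋯ ◁ (L_1 ∖ s(L_1))` lists the targets of the
left arrows from right to left. -/
def rowSeq {n : ℕ} (Q : Fin n → Dir) : List (Fin (n + 1)) :=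
  ((List.finRange n).filter (fun i => Q i = Dir.right)).map Fin.castSucc ++
    [Fin.last n] ++
    (((List.finRange n).filter (fun i => Q i = Dir.left)).map Fin.castSucc).reverse

/-- The sequence `S₂` of column labels, from west to east. The sequence
`(L_l ∖ t(L_l)) ◁ ⋯ ◁ (L_1 ∖ t(L_1))` lists the sources of the left arrows from right to left,
then comes the first vertex, and `(R_1 ∖ s(R_1)) ◁ ⋯ ◁ (R_r ∖ s(R_r))` lists the targets of the
right arrows from left to right. -/
def colSeq {n : ℕ} (Q : Fin n → Dir) : List (Fin (n + 1)) :=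
  (((List.finRange n).filter (fun i => Q i = Dir.left)).map Fin.succ).reverse ++
    [0] ++
    ((List.finRange n).filter (fun i => Q i = Dir.right)).map Fin.succ

/-- Position of block row `[x]`, counted from the north. -/
def rowPos {n : ℕ} (Q : Fin n → Dir) (x : Fin (n + 1)) : ℕ := (rowSeq Q).idxOf x

/-- Position of block column `[y]`, counted from the west. -/
def colPos {n : ℕ} (Q : Fin n → Dir) (y : Fin (n + 1)) : ℕ := (colSeq Q).idxOf y

/-- `S(x)`: the row label immediately south of `x`, if there is one. -/
def south {n : ℕ} (Q : Fin n → Dir) (x : Fin (n + 1)) : Option (Fin (n + 1)) :=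
  (rowSeq Q)[rowPos Q x + 1]?

/-- `W(y)`: the column label immediately west of `y`, if there is one. -/
def west {n : ℕ} (Q : Fin n → Dir) (y : Fin (n + 1)) : Option (Fin (n + 1)) :=
  if colPos Q y = 0 then none else (colSeq Q)[colPos Q y - 1]?

/-- The rank of the southwest submatrix `A_{[x]×[y]}` (block row `[x]` and those south of it, block
column `[y]` and those west of it); it is `0` if one of the labels is undefined. -/
noncomputable def swRank {K : Type*} [Field K] {n : ℕ} (Q : Fin n → Dir) {d : Fin (n + 1) → ℕ}
    (A : Matrix (BlockIdx d) (BlockIdx d) K) : Option (Fin (n + 1)) → Option (Fin (n + 1)) → ℕ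
  | some x, some y =>
    (A.submatrix
      (fun i : {i : BlockIdx d // rowPos Q x ≤ rowPos Q i.1} => i.1)
      (fun j : {j : BlockIdx d // colPos Q j.1 ≤ colPos Q y} => j.1)).rank
  | _, _ => 0

/-- The Zelevinsky map `ζ_Q(V)`. Its `([x],[y])`-block is zero if `y > x + 1`; otherwise it is the
map along the path from `y` to `x` (the identity if `x = y`, the map of a single left arrow if
`y = x + 1`, a composition of right arrows if `y < x`), or zero if there is no such path. -/
noncomputable def zeta {k : Type*} [Field k] {n : ℕ} {Q : Fin n → Dir} {d : Fin (n + 1) → ℕ}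
    (V : RepSpace k Q d) : Matrix (BlockIdx d) (BlockIdx d) k :=
  Matrix.of fun i j =>
    if (i.1 : ℕ) + 1 < (j.1 : ℕ) then 0 else pathBlock V i.1 j.1 i.2 j.2

/-! ### Zelevinsky permutations -/

/-- The permutation matrix of `w`, which has a `1` at position `(i, j)` exactly when `i = w j`. Rows
are ordered by `S₁`, columns by `S₂`, and inside each block by the order of `Fin (d x)`. -/
def permMatrix {n : ℕ} {d : Fin (n + 1) → ℕ} (w : Equiv.Perm (BlockIdx d)) :
    Matrix (BlockIdx d) (BlockIdx d) ℚ :=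
  Matrix.of fun i j => if i = w j then 1 else 0

/-- A blocked permutation is of Z-type. -/
structure IsZType {n : ℕ} (Q : Fin n → Dir) {d : Fin (n + 1) → ℕ}
    (w : Equiv.Perm (BlockIdx d)) : Prop where
  /-- The nonzero entries of each block form an identity matrix. -/
  block : ∀ j j' : BlockIdx d, j.1 = j'.1 → (w j).1 = (w j').1 →
    (j.2 : ℕ) < (j'.2 : ℕ) → ((w j).2 : ℕ) < ((w j').2 : ℕ)
  /-- In a block row, these identity matrices are arranged from southwest to northeast. -/
  row : ∀ j j' : BlockIdx d, (w j).1 = (w j').1 → colPos Q j.1 < colPos Q j'.1 →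
    ((w j').2 : ℕ) < ((w j).2 : ℕ)
  /-- In a block column, these identity matrices are arranged from northwest to southeast. -/
  col : ∀ j j' : BlockIdx d, j.1 = j'.1 → rowPos Q (w j).1 < rowPos Q (w j').1 →
    (j.2 : ℕ) < (j'.2 : ℕ)

/-- `w` is the Zelevinsky permutation `w_Q(r)`: its southwest block ranks are those of `ζ_Q(V)` for
all `V ∈ 𝒪_r`, and it is of Z-type. -/
structure IsZelevinskyPerm (k : Type*) [Field k] {n : ℕ} (Q : Fin n → Dir) (d : Fin (n + 1) → ℕ)
    (r : Fin (n + 1) → Fin (n + 1) → ℕ) (w : Equiv.Perm (BlockIdx d)) : Prop where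
  rank_eq : ∀ V ∈ rankOrbit k Q d r, ∀ x y : Fin (n + 1),
    swRank Q (permMatrix w) (some x) (some y) = swRank Q (zeta V) (some x) (some y)
  zType : IsZType Q w

/-- The multiplicity matrix `M(w)`. -/
noncomputable def multMatrix {n : ℕ} (Q : Fin n → Dir) {d : Fin (n + 1) → ℕ}
    (w : Equiv.Perm (BlockIdx d)) : Matrix (Fin (n + 1)) (Fin (n + 1)) ℤ :=
  Matrix.of fun x y =>
    (swRank Q (permMatrix w) (some x) (some y) : ℤ)
      - swRank Q (permMatrix w) (south Q x) (some y)
      - swRank Q (permMatrix w) (some x) (west Q y)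
      + swRank Q (permMatrix w) (south Q x) (west Q y)

/-- The number of entries `1` in the `([x],[y])`-block of the permutation matrix of `w`. -/
def onesInBlock {n : ℕ} {d : Fin (n + 1) → ℕ} (w : Equiv.Perm (BlockIdx d))
    (x y : Fin (n + 1)) : ℕ :=
  (Finset.univ.filter fun e : Fin (d x) × Fin (d y) => permMatrix w ⟨x, e.1⟩ ⟨y, e.2⟩ = 1).card

end TypeAQuiver

/-! Take a southwest submatrix of ζ_Q(V), with block rows R and block columns C. Its rank is Σ_{v ∈
R} d_v minus the dimension of its left kernel, and everything rests on a description of that kernel.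
The unitriangular substitution h_y = Σ_{x ≥ y} g_x V_{y → x} turns it into a space of partial
sections of the dual of V: families of row vectors h_v with h_x = h_y V_α for certain arrows α : x →
y and h_v = 0 at certain vertices (`mem_leftKernel_zetaBlock_iff`). The signs that appear are
removed by rescaling, because the underlying graph is a tree. The dimension of such a space depends
only on the isomorphism class of V and is additive on direct sums.

This is used twice. On the one hand, the left kernel of φ_{[a,b]} is also a space of partial
sections (`finrank_leftKernel_pathBlock`), and the spaces coming from ζ_Q reduce to these
(`finrank_partialSections_eq_of_intervalRank_eq`). Hence the southwest ranks depend only on r, and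
it is not necessary to know that r determines the isomorphism class.

On the other hand, for I_{pq} a scan along the interval gives the dimension #{i : p ≤ i, i+1 ≤ q, i
∈ R, i+1 ∉ C} + [q ∈ R, p ∉ C] (`finrank_partialSections_intervalRep`). Subtracting it from #(R ∩
[p,q]) leaves #{i : p ≤ i, i+1 ≤ q, i ∈ R, i+1 ∈ C} + [q ∈ R, p ∈ C]. Summed with the weights
m_{pq}, this says that the rank is the sum over R × C of the entries of the matrix with entries
m_{yx} for y ≤ x and n_{xy} for y = x+1 (`swRank_zeta_eq_sum`).

The rank of a southwest submatrix of a permutation matrix is the number of its ones. By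
inclusion-exclusion, (ZP1) therefore prescribes the number of ones in every block. Given these
numbers, (ZP2) fixes the order of the ones along each block row and block column, so there is at
most one such permutation (`IsZType.eq_of_onesInBlock_eq`); there is one because the prescribed
matrix has row and column sums d (`exists_isZType`). -/

namespace TypeAQuiver

open Matrix

variable {k : Type*} [Field k] {n : ℕ} {Q : Fin n → Dir}

/-! ### Arrows and paths -/

/-- The position of an arrow in the quiver. -/
def Arrow.edge {x y : Fin (n + 1)} : Arrow Q x y → Fin n
  | Arrow.right i _ => i
  | Arrow.left i _ => i

lemma Arrow.eq_of_edge_eq {x y x' y' : Fin (n + 1)} (a : Arrow Q x y) (b : Arrow Q x' y')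
    (h : a.edge = b.edge) : x = x' ∧ y = y' ∧ HEq a b := by
  cases a with
  | right i hi =>
    cases b with
    | right j hj => obtain rfl : i = j := h; exact ⟨rfl, rfl, HEq.rfl⟩
    | left j hj => obtain rfl : i = j := h; simp [hi] at hj
  | left i hi =>
    cases b with
    | right j hj => obtain rfl : i = j := h; simp [hi] at hj
    | left j hj => obtain rfl : i = j := h; exact ⟨rfl, rfl, HEq.rfl⟩

lemma Dir.eq_left_or_right (e : Dir) : e = Dir.left ∨ e = Dir.right := by
  cases e <;> simp

lemma Arrow.endpoints {x y : Fin (n + 1)} (a : Arrow Q x y) :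
    (x = a.edge.castSucc ∧ y = a.edge.succ ∧ Q a.edge = Dir.right) ∨
      (x = a.edge.succ ∧ y = a.edge.castSucc ∧ Q a.edge = Dir.left) := by
  cases a with
  | right i hi => exact Or.inl ⟨rfl, rfl, hi⟩
  | left i hi => exact Or.inr ⟨rfl, rfl, hi⟩

instance Arrow.instSubsingleton (x y : Fin (n + 1)) : Subsingleton (Arrow Q x y) := by
  refine ⟨fun a b => ?_⟩
  have h : a.edge = b.edge := by
    rcases a.endpoints with ⟨h1, h2, -⟩ | ⟨h1, h2, -⟩ <;>
      rcases b.endpoints with ⟨h3, h4, -⟩ | ⟨h3, h4, -⟩ <;>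
      · simp only [Fin.ext_iff, Fin.val_castSucc, Fin.val_succ] at h1 h2 h3 h4 ⊢
        omega
  exact eq_of_heq (a.eq_of_edge_eq b h).2.2

/-- A path cannot turn around: it would have to run back along the edge just used, against its only
orientation. So all arrows between the end points point the same way. -/
lemma DPath.direction {x y : Fin (n + 1)} (P : DPath Q x y) :
    (x ≤ y ∧ ∀ i : Fin n, x ≤ i.castSucc → i.castSucc < y → Q i = Dir.right) ∨
      (y ≤ x ∧ ∀ i : Fin n, y ≤ i.castSucc → i.castSucc < x → Q i = Dir.left) := by
  induction P with
  | nil => exact Or.inl ⟨le_rfl, fun i h1 h2 => absurd h2 (not_lt.2 h1)⟩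
  | cons P a ih =>
    cases a with
    | right i hi =>
      left
      rcases ih with ⟨h1, h2⟩ | ⟨h1, h2⟩
      · refine ⟨h1.trans (Fin.castSucc_lt_succ).le, fun j hj hj' => ?_⟩
        rcases eq_or_ne j i with rfl | hne
        · exact hi
        · refine h2 j hj ?_
          simp only [Fin.lt_def, Fin.val_castSucc, Fin.val_succ, ne_eq, Fin.ext_iff] at hj' hne ⊢
          omega
      · have hx : x = i.castSucc := by
          by_contra hne
          have := h2 i le_rfl (lt_of_le_of_ne h1 (Ne.symm hne))
          simp [hi] at this
        subst hx
        refine ⟨(Fin.castSucc_lt_succ).le, fun j hj hj' => ?_⟩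
        have : j = i := by
          simp only [Fin.lt_def, Fin.le_def, Fin.val_castSucc, Fin.val_succ, Fin.ext_iff]
            at hj' hj ⊢
          omega
        rw [this, hi]
    | left i hi =>
      right
      rcases ih with ⟨h1, h2⟩ | ⟨h1, h2⟩
      · have hx : x = i.succ := by
          by_contra hne
          have := h2 i (by
            have := lt_of_le_of_ne h1 hne
            simp only [Fin.lt_def, Fin.le_def, Fin.val_castSucc, Fin.val_succ] at this ⊢
            omega) Fin.castSucc_lt_succ
          simp [hi] at this
        subst hx
        refine ⟨(Fin.castSucc_lt_succ).le, fun j hj hj' => ?_⟩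
        have : j = i := by
          simp only [Fin.lt_def, Fin.le_def, Fin.val_castSucc, Fin.val_succ, Fin.ext_iff]
            at hj' hj ⊢
          omega
        rw [this, hi]
      · refine ⟨(Fin.castSucc_lt_succ).le.trans h1, fun j hj hj' => ?_⟩
        rcases eq_or_ne j i with rfl | hne
        · exact hi
        · refine h2 j ?_ hj'
          simp only [Fin.le_def, Fin.val_castSucc, Fin.val_succ, ne_eq, Fin.ext_iff] at hj hne ⊢
          omega

/-- A path that ends with a right arrow starts weakly to the left of it. -/
lemma DPath.le_of_right {x : Fin (n + 1)} {i : Fin n} (P : DPath Q x i.castSucc)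
    (hi : Q i = Dir.right) : x ≤ i.castSucc := by
  rcases P.direction with ⟨h1, -⟩ | ⟨h1, h2⟩
  · exact h1
  · by_contra hne
    have := h2 i le_rfl (not_le.1 hne)
    simp [hi] at this

/-- A path that ends with a left arrow starts weakly to the right of it. -/
lemma DPath.le_of_left {x : Fin (n + 1)} {i : Fin n} (P : DPath Q x i.succ)
    (hi : Q i = Dir.left) : i.succ ≤ x := by
  rcases P.direction with ⟨h1, h2⟩ | ⟨h1, h2⟩
  · by_contra hne
    have := h2 i (by
      simp only [Fin.le_def, Fin.val_castSucc, Fin.val_succ] at hne ⊢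
      omega) Fin.castSucc_lt_succ
    simp [hi] at this
  · exact h1

/-- There are no directed cycles: closing a path by an arrow back to its start would make it turn
around. -/
lemma DPath.cons_ne {x y : Fin (n + 1)} (P : DPath Q x y) (a : Arrow Q y x) : False := by
  rcases a.endpoints with ⟨h1, h2, h3⟩ | ⟨h1, h2, h3⟩
  · have := DPath.le_of_right (h1 ▸ P) h3
    exact absurd (h2.symm.le.trans this) (not_le.2 Fin.castSucc_lt_succ)
  · have := DPath.le_of_left (h1 ▸ P) h3
    exact absurd (this.trans h2.le) (not_le.2 Fin.castSucc_lt_succ)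

instance DPath.instSubsingleton (x y : Fin (n + 1)) : Subsingleton (DPath Q x y) := by
  refine ⟨fun P => ?_⟩
  induction P with
  | nil =>
    intro P'
    generalize hz : (DPath.nil : DPath Q x x) = N
    cases P' with
    | nil => exact hz.symm
    | cons P' a => exact (P'.cons_ne a).elim
  | @cons y z P a ih =>
    intro P'
    cases P' with
    | nil => exact (P.cons_ne a).elim
    | @cons y' _ P' b =>
      -- Both final arrows end at z. If they came from opposite sides, the start x would lie on both
      -- sides of z.
      have h : y = y' := by
        rcases a.endpoints with ⟨h1, h2, h3⟩ | ⟨h1, h2, h3⟩ <;>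
          rcases b.endpoints with ⟨h4, h5, h6⟩ | ⟨h4, h5, h6⟩
        · rw [h1, h4, Fin.succ_injective _ (h2.symm.trans h5)]
        · exfalso
          have i1 := DPath.le_of_right (h1 ▸ P) h3
          have i2 := DPath.le_of_left (h4 ▸ P') h6
          have h7 := h2.symm.trans h5
          simp only [Fin.le_def, Fin.ext_iff, Fin.val_castSucc, Fin.val_succ] at h7 i1 i2
          omega
        · exfalso
          have i1 := DPath.le_of_left (h1 ▸ P) h3
          have i2 := DPath.le_of_right (h4 ▸ P') h6
          have h7 := h2.symm.trans h5
          simp only [Fin.le_def, Fin.ext_iff, Fin.val_castSucc, Fin.val_succ] at h7 i1 i2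
          omega
        · rw [h1, h4, Fin.castSucc_injective _ (h2.symm.trans h5)]
      subst h
      rw [ih P', Subsingleton.elim a b]

/-- Add an arrow at the start of a path. -/
def DPath.prepend {x y : Fin (n + 1)} (a : Arrow Q x y) :
    ∀ {z : Fin (n + 1)}, DPath Q y z → DPath Q x z
  | _, DPath.nil => DPath.cons DPath.nil a
  | _, DPath.cons P b => DPath.cons (P.prepend a) b

lemma DPath.eq_or_prepend {x z : Fin (n + 1)} (P : DPath Q x z) :
    x = z ∨ ∃ (y : Fin (n + 1)) (_ : Arrow Q x y), Nonempty (DPath Q y z) := by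
  induction P with
  | nil => exact Or.inl rfl
  | @cons y z P a ih =>
    right
    rcases ih with rfl | ⟨w, b, ⟨P'⟩⟩
    · exact ⟨z, a, ⟨DPath.nil⟩⟩
    · exact ⟨w, b, ⟨P'.cons a⟩⟩

/-! ### Factoring the maps along paths through their first arrow. -/

section PathBlock

variable {d : Fin (n + 1) → ℕ}

lemma pathMap_prepend (V : RepSpace k Q d) {x y : Fin (n + 1)} (a : Arrow Q x y)
    {z : Fin (n + 1)} (P : DPath Q y z) :
    pathMap V (P.prepend a) = pathMap V P * V a := by
  induction P with
  | nil => simp [DPath.prepend, pathMap]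
  | cons P b ih => simp [DPath.prepend, pathMap, ih, Matrix.mul_assoc]

lemma pathBlock_eq_pathMap (V : RepSpace k Q d) {x y : Fin (n + 1)} (P : DPath Q y x) :
    pathBlock V x y = pathMap V P := by
  have h : Nonempty (DPath Q y x) := ⟨P⟩
  rw [pathBlock, dif_pos h, Subsingleton.elim h.some P]

lemma pathBlock_self (V : RepSpace k Q d) (x : Fin (n + 1)) : pathBlock V x x = 1 := by
  rw [pathBlock_eq_pathMap V DPath.nil, pathMap]

lemma pathBlock_eq_zero (V : RepSpace k Q d) {x y : Fin (n + 1)} (h : IsEmpty (DPath Q y x)) :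
    pathBlock V x y = 0 := by
  rw [pathBlock, dif_neg (not_nonempty_iff.2 h)]

/-- A path from i to some x > i must leave i through the edge i, so without a path from i+1 there is
none from i. The hypothesis on x excludes x = i, where the block is the identity. -/
lemma pathBlock_castSucc_right (V : RepSpace k Q d) {x : Fin (n + 1)} {i : Fin n}
    (hi : Q i = Dir.right) (hx : i.succ ≤ x) :
    pathBlock V x i.castSucc = pathBlock V x i.succ * V (Arrow.right i hi) := by
  rcases isEmpty_or_nonempty (DPath Q i.succ x) with h | ⟨⟨P⟩⟩
  · rw [pathBlock_eq_zero V h, Matrix.zero_mul, pathBlock_eq_zero]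
    refine ⟨fun P => ?_⟩
    rcases P.eq_or_prepend with h1 | ⟨y, a, ⟨P'⟩⟩
    · rw [← h1] at hx
      exact absurd hx (not_le.2 Fin.castSucc_lt_succ)
    · rcases a.endpoints with ⟨h1, h2, h3⟩ | ⟨h1, h2, h3⟩
      · rw [← Fin.castSucc_injective _ h1] at h2
        exact h.false (h2 ▸ P')
      · rcases P.direction with ⟨h4, h5⟩ | ⟨h4, h5⟩
        · have h6 := P'.direction
          rcases h6 with ⟨h6, h7⟩ | ⟨h6, h7⟩
          · have h8 := h7 a.edge h2.le (by
              simp only [Fin.le_def, Fin.lt_def, Fin.ext_iff, Fin.val_castSucc, Fin.val_succ] at *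
              omega)
            simp [h3] at h8
          · simp only [Fin.le_def, Fin.lt_def, Fin.ext_iff, Fin.val_castSucc, Fin.val_succ] at *
            omega
        · simp only [Fin.le_def, Fin.lt_def, Fin.ext_iff, Fin.val_castSucc, Fin.val_succ] at *
          omega
  · rw [pathBlock_eq_pathMap V P, ← pathMap_prepend, pathBlock_eq_pathMap]

lemma pathBlock_castSucc_left (V : RepSpace k Q d) {x : Fin (n + 1)} {i : Fin n}
    (hi : Q i = Dir.left) (hx : i.succ ≤ x) : pathBlock V x i.castSucc = 0 := by
  refine pathBlock_eq_zero V ⟨fun P => ?_⟩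
  have hlt : i.castSucc < x := lt_of_lt_of_le Fin.castSucc_lt_succ hx
  rcases P.direction with ⟨-, h2⟩ | ⟨h1, -⟩
  · simpa [hi] using h2 i le_rfl hlt
  · exact absurd h1 (not_le.2 hlt)

lemma pathBlock_succ_left (V : RepSpace k Q d) {x : Fin (n + 1)} {i : Fin n}
    (hi : Q i = Dir.left) (hx : x ≤ i.castSucc) :
    pathBlock V x i.succ = pathBlock V x i.castSucc * V (Arrow.left i hi) := by
  rcases isEmpty_or_nonempty (DPath Q i.castSucc x) with h | ⟨⟨P⟩⟩
  · rw [pathBlock_eq_zero V h, Matrix.zero_mul, pathBlock_eq_zero]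
    refine ⟨fun P => ?_⟩
    rcases P.eq_or_prepend with h1 | ⟨y, a, ⟨P'⟩⟩
    · rw [← h1] at hx
      exact absurd hx (not_le.2 Fin.castSucc_lt_succ)
    · rcases a.endpoints with ⟨h1, h2, h3⟩ | ⟨h1, h2, h3⟩
      · rcases P'.direction with ⟨h6, h7⟩ | ⟨h6, h7⟩
        · simp only [Fin.le_def, Fin.lt_def, Fin.ext_iff, Fin.val_castSucc, Fin.val_succ] at *
          omega
        · have h8 := h7 a.edge (by
            simp only [Fin.le_def, Fin.lt_def, Fin.ext_iff, Fin.val_castSucc, Fin.val_succ] at *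
            omega) (Fin.castSucc_lt_succ.trans_eq h2.symm)
          simp [h3] at h8
      · rw [← Fin.succ_injective _ h1] at h2
        exact h.false (h2 ▸ P')
  · rw [pathBlock_eq_pathMap V P, ← pathMap_prepend, pathBlock_eq_pathMap]

lemma pathBlock_succ_right (V : RepSpace k Q d) {x : Fin (n + 1)} {i : Fin n}
    (hi : Q i = Dir.right) (hx : x ≤ i.castSucc) : pathBlock V x i.succ = 0 := by
  refine pathBlock_eq_zero V ⟨fun P => ?_⟩
  rcases P.direction with ⟨h1, -⟩ | ⟨-, h2⟩
  · exact absurd (h1.trans hx) (not_le.2 Fin.castSucc_lt_succ)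
  · simpa [hi] using h2 i hx Fin.castSucc_lt_succ

end PathBlock

/-! ### Ranks of blocked matrices and left kernels -/

section LeftKernel

variable {d : Fin (n + 1) → ℕ}

/-- The families of row vectors, supported on the block rows in `p`, whose product with `B`
vanishes on the block columns in `q`. -/
def leftKernel (B : ∀ x y : Fin (n + 1), Matrix (Fin (d x)) (Fin (d y)) k)
    (p q : Fin (n + 1) → Prop) : Submodule k (∀ v, Fin (d v) → k) where
  carrier := {g | (∀ v, ¬ p v → g v = 0) ∧ ∀ y, q y → ∑ x, g x ᵥ* B x y = 0}
  zero_mem' := by simp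
  add_mem' := by
    rintro a b ⟨ha, ha'⟩ ⟨hb, hb'⟩
    refine ⟨fun v hv => by simp [ha v hv, hb v hv], fun y hy => ?_⟩
    simp [Matrix.add_vecMul, Finset.sum_add_distrib, ha' y hy, hb' y hy]
  smul_mem' := by
    rintro c a ⟨ha, ha'⟩
    refine ⟨fun v hv => by simp [ha v hv], fun y hy => ?_⟩
    simp [Matrix.smul_vecMul, ← Finset.smul_sum, ha' y hy]

lemma mem_leftKernel {B : ∀ x y : Fin (n + 1), Matrix (Fin (d x)) (Fin (d y)) k}
    {p q : Fin (n + 1) → Prop} {g : ∀ v, Fin (d v) → k} :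
    g ∈ leftKernel B p q ↔ (∀ v, ¬ p v → g v = 0) ∧ ∀ y, q y → ∑ x, g x ᵥ* B x y = 0 :=
  Iff.rfl

lemma rank_add_finrank_ker_vecMulLinear {α β : Type*} [Fintype α] [Fintype β]
    (A : Matrix α β k) :
    A.rank + Module.finrank k (LinearMap.ker A.vecMulLinear) = Fintype.card α := by
  classical
  have h := LinearMap.finrank_range_add_finrank_ker (A.vecMulLinear)
  rw [Module.finrank_fintype_fun_eq_card] at h
  have hA : Aᵀ.mulVecLin = A.vecMulLinear := by
    ext v : 1
    simp
  rw [← h, ← Matrix.rank_transpose, Matrix.rank, hA]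

/-- Rank-nullity for the rows. The kernel is written as families on all vertices that vanish outside
`p`, rather than vectors on a subtype, so that the later changes of variables act on one fixed
space. -/
lemma rank_add_finrank_leftKernel
    (B : ∀ x y : Fin (n + 1), Matrix (Fin (d x)) (Fin (d y)) k) (p q : Fin (n + 1) → Prop)
    [DecidablePred p] [Fintype {j : BlockIdx d // q j.1}] :
    (Matrix.of fun (i : {i : BlockIdx d // p i.1}) (j : {j : BlockIdx d // q j.1}) =>
      B i.1.1 j.1.1 i.1.2 j.1.2).rank + Module.finrank k (leftKernel B p q) =
      ∑ v, if p v then d v else 0 := by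
  set A := Matrix.of fun (i : {i : BlockIdx d // p i.1}) (j : {j : BlockIdx d // q j.1}) =>
      B i.1.1 j.1.1 i.1.2 j.1.2 with hA
  have key : ∀ (g : ∀ v, Fin (d v) → k), (∀ v, ¬ p v → g v = 0) →
      ∀ j : {j : BlockIdx d // q j.1},
      ((fun i : {i : BlockIdx d // p i.1} => g i.1.1 i.1.2) ᵥ* A) j =
        (∑ x, g x ᵥ* B x j.1.1) j.1.2 := by
    intro g hg j
    rw [Finset.sum_apply]
    simp only [Matrix.vecMul, dotProduct, hA, Matrix.of_apply]
    rw [← Finset.sum_subtype (Finset.univ.filter fun i : BlockIdx d => p i.1) (by simp)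
      (fun i : BlockIdx d => g i.1 i.2 * B i.1 j.1.1 i.2 j.1.2), Finset.sum_filter,
      Fintype.sum_sigma]
    refine Finset.sum_congr rfl fun x _ => Finset.sum_congr rfl fun a _ => ?_
    by_cases h : p x
    · simp [h]
    · simp [h, hg x h]
  have e : leftKernel B p q ≃ₗ[k] LinearMap.ker A.vecMulLinear :=
    { toFun := fun g => ⟨fun i => g.1 i.1.1 i.1.2, by
        rw [LinearMap.mem_ker]
        ext j
        rw [Matrix.vecMulLinear_apply, key g.1 g.2.1, g.2.2 _ j.2]
        simp⟩
      map_add' := fun a b => by ext; simp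
      map_smul' := fun c a => by ext; simp
      invFun := fun u => ⟨fun v a => if h : p v then u.1 ⟨⟨v, a⟩, h⟩ else 0, by
        have h0 : ∀ v, ¬ p v → (fun a => if h : p v then u.1 ⟨⟨v, a⟩, h⟩ else 0) = 0 := by
          intro v hv
          ext a
          simp [hv]
        refine ⟨h0, fun y hy => ?_⟩
        ext b
        rw [← key (fun v a => if h : p v then u.1 ⟨⟨v, a⟩, h⟩ else 0) h0 ⟨⟨y, b⟩, hy⟩]
        have hu := congrFun (LinearMap.mem_ker.1 u.2) ⟨⟨y, b⟩, hy⟩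
        rw [Matrix.vecMulLinear_apply] at hu
        refine Eq.trans ?_ hu
        congr 2
        ext i
        simp [i.2]⟩
      left_inv := fun g => by
        ext v a
        by_cases h : p v
        · simp [h]
        · simp [h, g.2.1 v h]
      right_inv := fun u => by
        ext i
        simp [i.2] }
  have h1 := rank_add_finrank_ker_vecMulLinear A
  rw [← e.finrank_eq] at h1
  rw [h1, Fintype.card_subtype, Finset.card_filter, Fintype.sum_sigma]
  refine Finset.sum_congr rfl fun v _ => ?_
  by_cases h : p v <;> simp [h]

end LeftKernel

/-! ### Partial sections of the dual of a representation -/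

section Sections

variable {ι κ : Fin (n + 1) → Type} [∀ x, Fintype (ι x)] [∀ x, Fintype (κ x)]

/-- The families of row vectors that are compatible with the arrows of `V` at the positions in `E`
and vanish at the vertices in `F`. -/
def partialSections (V : MatRep k Q ι) (E : Finset (Fin n)) (F : Set (Fin (n + 1))) :
    Submodule k (∀ v, ι v → k) where
  carrier := {h | (∀ ⦃x y⦄ (a : Arrow Q x y), a.edge ∈ E → h x = h y ᵥ* V a) ∧ ∀ v ∈ F, h v = 0}
  zero_mem' := by simp
  add_mem' := by
    rintro a b ⟨ha, ha'⟩ ⟨hb, hb'⟩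
    refine ⟨fun x y c hc => ?_, fun v hv => by simp [ha' v hv, hb' v hv]⟩
    simp [Matrix.add_vecMul, ha c hc, hb c hc]
  smul_mem' := by
    rintro c a ⟨ha, ha'⟩
    refine ⟨fun x y e he => ?_, fun v hv => by simp [ha' v hv]⟩
    simp [Matrix.smul_vecMul, ha e he]

lemma mem_partialSections {V : MatRep k Q ι} {E : Finset (Fin n)} {F : Set (Fin (n + 1))}
    {h : ∀ v, ι v → k} : h ∈ partialSections V E F ↔
      (∀ ⦃x y⦄ (a : Arrow Q x y), a.edge ∈ E → h x = h y ᵥ* V a) ∧ ∀ v ∈ F, h v = 0 :=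
  Iff.rfl

variable [∀ x, DecidableEq (ι x)] [∀ x, DecidableEq (κ x)]

lemma Isomorphic.symm {V : MatRep k Q ι} {W : MatRep k Q κ} (h : Isomorphic V W) :
    Isomorphic W V := by
  obtain ⟨g, g', h1, h2⟩ := h
  refine ⟨g', g, fun x => (h1 x).symm, fun x y a => ?_⟩
  calc g' y * W a = g' y * (W a * g x) * g' x := by
        rw [Matrix.mul_assoc, Matrix.mul_assoc (W a), (h1 x).1, Matrix.mul_one]
    _ = V a * g' x := by
        rw [← h2 a, ← Matrix.mul_assoc (g' y), (h1 y).2, Matrix.one_mul]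

lemma Isomorphic.card_eq {V : MatRep k Q ι} {W : MatRep k Q κ} (h : Isomorphic V W)
    (x : Fin (n + 1)) : Fintype.card (ι x) = Fintype.card (κ x) := by
  obtain ⟨g, g', h1, -⟩ := h
  exact Matrix.square_of_invertible (g' x) (g x) (h1 x).2 (h1 x).1

lemma Isomorphic.finrank_partialSections_le {V : MatRep k Q ι} {W : MatRep k Q κ}
    (h : Isomorphic V W) (E : Finset (Fin n)) (F : Set (Fin (n + 1))) :
    Module.finrank k (partialSections W E F) ≤ Module.finrank k (partialSections V E F) := by
  obtain ⟨g, g', h1, h2⟩ := h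
  let f : partialSections W E F →ₗ[k] partialSections V E F :=
    { toFun := fun s => ⟨fun v => s.1 v ᵥ* g v, by
        refine ⟨fun x y a ha => ?_, fun v hv => by simp [s.2.2 v hv]⟩
        change s.1 x ᵥ* g x = (s.1 y ᵥ* g y) ᵥ* V a
        rw [Matrix.vecMul_vecMul, h2 a, s.2.1 a ha, Matrix.vecMul_vecMul]⟩
      map_add' := fun s t => by
        ext v : 2
        simp [Matrix.add_vecMul]
      map_smul' := fun c s => by
        ext v : 2
        simp [Matrix.smul_vecMul] }
  refine LinearMap.finrank_le_finrank_of_injective (f := f) fun s t hst => ?_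
  ext v : 2
  have h3 : s.1 v ᵥ* g v = t.1 v ᵥ* g v := congrFun (congrArg Subtype.val hst) v
  have h4 := congrArg (fun u => u ᵥ* g' v) h3
  simpa [Matrix.vecMul_vecMul, (h1 v).1] using h4

lemma Isomorphic.finrank_partialSections {V : MatRep k Q ι} {W : MatRep k Q κ}
    (h : Isomorphic V W) (E : Finset (Fin n)) (F : Set (Fin (n + 1))) :
    Module.finrank k (partialSections V E F) = Module.finrank k (partialSections W E F) :=
  le_antisymm (h.symm.finrank_partialSections_le E F) (h.finrank_partialSections_le E F)

/-- The representation obtained by rescaling the maps at all arrows. -/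
def rescale (c : Fin n → kˣ) (V : MatRep k Q ι) : MatRep k Q ι :=
  fun _ _ a => (c a.edge : k) • V a

/-- On a line, scalars at the arrows are absorbed by scalars at the vertices, chosen one after
another from the left. This makes all signs below harmless. -/
lemma isomorphic_rescale (c : Fin n → kˣ) (V : MatRep k Q ι) : Isomorphic V (rescale c V) := by
  -- The requirement is s(target) = c · s(source). For a left arrow the new vertex i+1 is the
  -- source, hence the inverse.
  let s : Fin (n + 1) → kˣ := fun v => Fin.induction (motive := fun _ => kˣ) 1
    (fun i a => (if Q i = Dir.right then c i else (c i)⁻¹) * a) v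
  have hs : ∀ i : Fin n, s i.succ = (if Q i = Dir.right then c i else (c i)⁻¹) * s i.castSucc :=
    fun i => Fin.induction_succ ..
  refine ⟨fun v => (s v : k) • 1, fun v => ((s v)⁻¹ : kˣ).1 • 1, fun v => ?_, fun x y a => ?_⟩
  · simp [smul_smul]
  · have key : s y = c a.edge * s x := by
      rcases a.endpoints with ⟨h1, h2, h3⟩ | ⟨h1, h2, h3⟩
      · rw [congrArg s h1, congrArg s h2, hs, if_pos h3]
      · rw [congrArg s h1, congrArg s h2, hs, if_neg (by simp [h3])]
        simp
    simp [rescale, smul_smul, key, mul_comm]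

end Sections

/-! ### The left kernels of the southwest submatrices of the Zelevinsky matrix -/

section Zeta

variable {d : Fin (n + 1) → ℕ}

/-- The transform `g ↦ (∑_{x ≥ y} g_x V_{y → x})_y` by the maps along right paths. -/
noncomputable def rightTransform (V : RepSpace k Q d) :
    (∀ v, Fin (d v) → k) →ₗ[k] (∀ v, Fin (d v) → k) where
  toFun g y := ∑ x ∈ Finset.Ici y, g x ᵥ* pathBlock V x y
  map_add' a b := by
    ext y : 1
    simp [Matrix.add_vecMul, Finset.sum_add_distrib]
  map_smul' c a := by
    ext y : 1
    simp [Matrix.smul_vecMul, Finset.smul_sum]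

lemma rightTransform_apply (V : RepSpace k Q d) (g : ∀ v, Fin (d v) → k) (y : Fin (n + 1)) :
    rightTransform V g y = ∑ x ∈ Finset.Ici y, g x ᵥ* pathBlock V x y := rfl

lemma rightTransform_last (V : RepSpace k Q d) (g : ∀ v, Fin (d v) → k) :
    rightTransform V g (Fin.last n) = g (Fin.last n) := by
  have : Finset.Ici (Fin.last n) = {Fin.last n} := by ext; simp [Fin.last_le_iff]
  rw [rightTransform_apply, this, Finset.sum_singleton, pathBlock_self, Matrix.vecMul_one]

lemma Ici_castSucc (i : Fin n) :
    Finset.Ici i.castSucc = insert i.castSucc (Finset.Ici i.succ) := by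
  ext x
  simp only [Finset.mem_Ici, Finset.mem_insert, Fin.le_def, Fin.ext_iff, Fin.val_castSucc,
    Fin.val_succ]
  omega

lemma Iic_succ (i : Fin n) :
    Finset.Iic i.succ = insert i.succ (Finset.Iic i.castSucc) := by
  ext x
  simp only [Finset.mem_Iic, Finset.mem_insert, Fin.le_def, Fin.ext_iff, Fin.val_castSucc,
    Fin.val_succ]
  omega

lemma rightTransform_castSucc_right (V : RepSpace k Q d) (g : ∀ v, Fin (d v) → k) {i : Fin n}
    (hi : Q i = Dir.right) : rightTransform V g i.castSucc =
      g i.castSucc + rightTransform V g i.succ ᵥ* V (Arrow.right i hi) := by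
  rw [rightTransform_apply, Ici_castSucc, Finset.sum_insert (by simp), pathBlock_self,
    Matrix.vecMul_one, rightTransform_apply, Matrix.sum_vecMul]
  congr 1
  refine Finset.sum_congr rfl fun x hx => ?_
  rw [pathBlock_castSucc_right V hi (Finset.mem_Ici.1 hx), Matrix.vecMul_vecMul]

lemma rightTransform_castSucc_left (V : RepSpace k Q d) (g : ∀ v, Fin (d v) → k) {i : Fin n}
    (hi : Q i = Dir.left) : rightTransform V g i.castSucc = g i.castSucc := by
  rw [rightTransform_apply, Ici_castSucc, Finset.sum_insert (by simp), pathBlock_self,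
    Matrix.vecMul_one, Finset.sum_eq_zero, add_zero]
  intro x hx
  rw [pathBlock_castSucc_left V hi (Finset.mem_Ici.1 hx), Matrix.vecMul_zero]

/-- The transform is unitriangular: the two recursions recover g_i from h_i and h_{i+1}. -/
lemma rightTransform_injective (V : RepSpace k Q d) : Function.Injective (rightTransform V) := by
  rw [← LinearMap.ker_eq_bot, LinearMap.ker_eq_bot']
  intro g hg
  ext v : 1
  rcases Fin.eq_castSucc_or_eq_last v with ⟨i, rfl⟩ | rfl
  · have h1 := congrFun hg i.castSucc
    have h2 := congrFun hg i.succ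
    rcases Dir.eq_left_or_right (Q i) with hi | hi
    · rwa [rightTransform_castSucc_left V g hi] at h1
    · rw [rightTransform_castSucc_right V g hi, h2] at h1
      simpa using h1
  · rw [← rightTransform_last V g, hg]

/-- The blocks of the Zelevinsky matrix. -/
noncomputable def zetaBlock (V : RepSpace k Q d) (x y : Fin (n + 1)) :
    Matrix (Fin (d x)) (Fin (d y)) k :=
  if (x : ℕ) + 1 < (y : ℕ) then 0 else pathBlock V x y

lemma sum_zetaBlock_zero (V : RepSpace k Q d) (g : ∀ v, Fin (d v) → k) :
    ∑ x, g x ᵥ* zetaBlock V x 0 = rightTransform V g 0 := by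
  rw [rightTransform_apply]
  refine (Finset.sum_subset_zero_on_sdiff (Finset.subset_univ _) (by simp) fun x _ => ?_).symm
  simp [zetaBlock]

/-- The cut-off y > x+1 in ζ_Q removes all longer left paths, so besides the right paths collected
in the transform only the row i of the single edge i meets column i+1. -/
lemma sum_zetaBlock_succ (V : RepSpace k Q d) (g : ∀ v, Fin (d v) → k) (i : Fin n) :
    ∑ x, g x ᵥ* zetaBlock V x i.succ =
      g i.castSucc ᵥ* pathBlock V i.castSucc i.succ + rightTransform V g i.succ := by
  have h : rightTransform V g i.succ = ∑ x ∈ Finset.Ici i.succ, g x ᵥ* zetaBlock V x i.succ := by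
    rw [rightTransform_apply]
    refine Finset.sum_congr rfl fun x hx => ?_
    rw [zetaBlock, if_neg]
    have := Finset.mem_Ici.1 hx
    simp only [Fin.le_def, Fin.val_succ] at this ⊢
    omega
  have h' : g i.castSucc ᵥ* pathBlock V i.castSucc i.succ =
      g i.castSucc ᵥ* zetaBlock V i.castSucc i.succ := by
    simp [zetaBlock]
  rw [h, h', ← Finset.sum_insert (f := fun x => g x ᵥ* zetaBlock V x i.succ) (by simp),
    ← Ici_castSucc]
  refine (Finset.sum_subset_zero_on_sdiff (Finset.subset_univ _) (fun x hx => ?_)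
    fun x _ => rfl).symm
  rw [zetaBlock, if_pos, Matrix.vecMul_zero]
  simp only [Finset.mem_sdiff, Finset.mem_univ, true_and, Finset.mem_Ici, Fin.le_def,
    Fin.val_castSucc, Fin.val_succ] at hx ⊢
  omega

lemma sum_zetaBlock_succ_left (V : RepSpace k Q d) (g : ∀ v, Fin (d v) → k) {i : Fin n}
    (hi : Q i = Dir.left) : ∑ x, g x ᵥ* zetaBlock V x i.succ =
      g i.castSucc ᵥ* V (Arrow.left i hi) + rightTransform V g i.succ := by
  rw [sum_zetaBlock_succ, pathBlock_succ_left V hi le_rfl, pathBlock_self, Matrix.one_mul]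

lemma sum_zetaBlock_succ_right (V : RepSpace k Q d) (g : ∀ v, Fin (d v) → k) {i : Fin n}
    (hi : Q i = Dir.right) :
    ∑ x, g x ᵥ* zetaBlock V x i.succ = rightTransform V g i.succ := by
  rw [sum_zetaBlock_succ, pathBlock_succ_right V hi le_rfl, Matrix.vecMul_zero, zero_add]

open Classical in
/-- The arrows linking consecutive coordinates in the left kernel of the submatrix of the
Zelevinsky matrix with block rows `p` and block columns `q`. -/
noncomputable def zetaLinks (Q : Fin n → Dir) (p q : Fin (n + 1) → Prop) : Finset (Fin n) :=
  Finset.univ.filter fun i => (Q i = Dir.right ∧ ¬ p i.castSucc ∧ ¬ q i.succ) ∨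
    (Q i = Dir.left ∧ p i.castSucc ∧ q i.succ)

/-- The vertices whose coordinates vanish in the left kernel of the submatrix of the
Zelevinsky matrix with block rows `p` and block columns `q`. -/
def zetaZeros (Q : Fin n → Dir) (p q : Fin (n + 1) → Prop) : Set (Fin (n + 1)) :=
  {v | (¬ p v ∧ ∀ i : Fin n, v = i.castSucc → Q i = Dir.left ∨ q i.succ) ∨
    (q v ∧ ∀ i : Fin n, v = i.succ → Q i = Dir.right ∨ ¬ p i.castSucc)}

/-- Negate the maps at the left arrows. -/
def leftSign (k : Type*) [Field k] (Q : Fin n → Dir) (i : Fin n) : kˣ :=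
  if Q i = Dir.left then -1 else 1

/-- Write g through h by the recursions. At a right arrow, i ∉ p means h_i = h_{i+1} V and the
column i+1 ∈ q means h_{i+1} = 0. At a left arrow, i ∉ p means h_i = 0 and i+1 ∈ q means h_{i+1} =
-h_i V. If i ∉ p and i+1 ∈ q, both ends vanish for either direction, so a genuine link survives only
in the cases listed in `zetaLinks`. The row of the last vertex and the column of the first give the
boundary zeros. -/
lemma mem_leftKernel_zetaBlock_iff (V : RepSpace k Q d) (p q : Fin (n + 1) → Prop)
    (g : ∀ v, Fin (d v) → k) : g ∈ leftKernel (zetaBlock V) p q ↔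
      rightTransform V g ∈ partialSections (rescale (leftSign k Q) V)
        (zetaLinks Q p q) (zetaZeros Q p q) := by
  rw [mem_leftKernel, mem_partialSections]
  set h := rightTransform V g with hh
  have hlast : h (Fin.last n) = g (Fin.last n) := rightTransform_last V g
  have hr : ∀ (i : Fin n) (hi : Q i = Dir.right),
      h i.castSucc = g i.castSucc + h i.succ ᵥ* V (Arrow.right i hi) :=
    fun i hi => rightTransform_castSucc_right V g hi
  have hl : ∀ (i : Fin n) (hi : Q i = Dir.left), h i.castSucc = g i.castSucc :=
    fun i hi => rightTransform_castSucc_left V g hi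
  constructor
  · rintro ⟨h1, h2⟩
    constructor
    · intro x y a ha
      simp only [zetaLinks, Finset.mem_filter, Finset.mem_univ, true_and] at ha
      cases a with
      | right i hi =>
        simp only [Arrow.edge, hi, true_and, reduceCtorEq, false_and, or_false] at ha
        simp [rescale, leftSign, Arrow.edge, hi, hr i hi, h1 _ ha.1]
      | left i hi =>
        simp only [Arrow.edge, hi, true_and, reduceCtorEq, false_and, false_or] at ha
        have h3 := h2 _ ha.2
        rw [sum_zetaBlock_succ_left V g hi, ← hl i hi, ← hh] at h3
        simp [rescale, leftSign, Arrow.edge, hi, Matrix.vecMul_neg, eq_neg_of_add_eq_zero_right h3]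
    · rintro v (⟨hv, hv'⟩ | ⟨hv, hv'⟩)
      · rcases Fin.eq_castSucc_or_eq_last v with ⟨i, rfl⟩ | rfl
        · rcases Dir.eq_left_or_right (Q i) with hi | hi
          · rw [hl i hi, h1 _ hv]
          · have h3 := (hv' i rfl).resolve_left (by simp [hi])
            have h4 := h2 _ h3
            rw [sum_zetaBlock_succ_right V g hi, ← hh] at h4
            rw [hr i hi, h1 _ hv, h4]
            simp
        · rw [hlast, h1 _ hv]
      · rcases Fin.eq_zero_or_eq_succ v with rfl | ⟨i, rfl⟩
        · rw [hh, ← sum_zetaBlock_zero, h2 _ hv]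
        · rcases Dir.eq_left_or_right (Q i) with hi | hi
          · have h3 := (hv' i rfl).resolve_left (by simp [hi])
            have h4 := h2 _ hv
            rw [sum_zetaBlock_succ_left V g hi, ← hh, h1 _ h3] at h4
            simpa using h4
          · rw [hh, ← sum_zetaBlock_succ_right V g hi, h2 _ hv]
  · rintro ⟨h1, h2⟩
    have h1r : ∀ (i : Fin n) (hi : Q i = Dir.right), ¬ p i.castSucc → ¬ q i.succ →
        h i.castSucc = h i.succ ᵥ* V (Arrow.right i hi) := by
      intro i hi h3 h4
      have := h1 (Arrow.right i hi) (by simp [zetaLinks, Arrow.edge, hi, h3, h4])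
      simpa [rescale, leftSign, Arrow.edge, hi] using this
    have h1l : ∀ (i : Fin n) (hi : Q i = Dir.left), p i.castSucc → q i.succ →
        h i.succ = - h i.castSucc ᵥ* V (Arrow.left i hi) := by
      intro i hi h3 h4
      have := h1 (Arrow.left i hi) (by simp [zetaLinks, Arrow.edge, hi, h3, h4])
      simpa [rescale, leftSign, Arrow.edge, hi, Matrix.vecMul_neg, Matrix.neg_vecMul] using this
    constructor
    · intro v hv
      rcases Fin.eq_castSucc_or_eq_last v with ⟨i, rfl⟩ | rfl
      · rcases Dir.eq_left_or_right (Q i) with hi | hi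
        · rw [← hl i hi]
          refine h2 _ (Or.inl ⟨hv, fun j hj => Or.inl ?_⟩)
          rw [← Fin.castSucc_injective _ hj, hi]
        · have h3 := hr i hi
          by_cases hq : q i.succ
          · have h4 : h i.castSucc = 0 := h2 _ (Or.inl ⟨hv, fun j hj => Or.inr (by
              rwa [← Fin.castSucc_injective _ hj])⟩)
            have h5 : h i.succ = 0 := h2 _ (Or.inr ⟨hq, fun j hj => Or.inl (by
              rwa [← Fin.succ_injective _ hj])⟩)
            rw [h4, h5] at h3
            simpa using h3.symm
          · rw [h1r i hi hv hq] at h3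
            simpa using h3
      · rw [← hlast]
        exact h2 _ (Or.inl ⟨hv, fun j hj => absurd hj.symm (Fin.castSucc_lt_last j).ne⟩)
    · intro y hy
      rcases Fin.eq_zero_or_eq_succ y with rfl | ⟨i, rfl⟩
      · rw [sum_zetaBlock_zero, ← hh]
        exact h2 _ (Or.inr ⟨hy, fun j hj => absurd hj.symm (Fin.succ_ne_zero j)⟩)
      · rcases Dir.eq_left_or_right (Q i) with hi | hi
        · rw [sum_zetaBlock_succ_left V g hi, ← hl i hi, ← hh]
          by_cases hp : p i.castSucc
          · rw [h1l i hi hp hy]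
            simp [Matrix.neg_vecMul]
          · have h4 : h i.castSucc = 0 := h2 _ (Or.inl ⟨hp, fun j hj => Or.inl (by
              rwa [← Fin.castSucc_injective _ hj])⟩)
            have h5 : h i.succ = 0 := h2 _ (Or.inr ⟨hy, fun j hj => Or.inr (by
              rwa [← Fin.succ_injective _ hj])⟩)
            rw [h4, h5]
            simp
        · rw [sum_zetaBlock_succ_right V g hi, ← hh]
          exact h2 _ (Or.inr ⟨hy, fun j hj => Or.inl (by rwa [← Fin.succ_injective _ hj])⟩)

lemma finrank_leftKernel_zetaBlock (V : RepSpace k Q d) (p q : Fin (n + 1) → Prop) :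
    Module.finrank k (leftKernel (zetaBlock V) p q) =
      Module.finrank k (partialSections V (zetaLinks Q p q) (zetaZeros Q p q)) := by
  rw [(isomorphic_rescale (leftSign k Q) V).finrank_partialSections]
  let e := LinearEquiv.ofInjectiveEndo (rightTransform V) (rightTransform_injective V)
  have he : ∀ g, e g = rightTransform V g := fun g => rfl
  rw [← e.finrank_map_eq (leftKernel (zetaBlock V) p q)]
  have : (leftKernel (zetaBlock V) p q).map (e : _ →ₗ[k] _) =
      partialSections (rescale (leftSign k Q) V) (zetaLinks Q p q) (zetaZeros Q p q) := by
    ext h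
    obtain ⟨g, rfl⟩ := e.surjective h
    rw [he, ← mem_leftKernel_zetaBlock_iff, ← he, Submodule.mem_map]
    simp
  rw [this]

/-- This reduces the study of the ranks to that of partial sections, which are compatible with
isomorphisms and direct sums. -/
lemma swRank_zeta_add_finrank (V : RepSpace k Q d) (x y : Fin (n + 1)) :
    swRank Q (zeta V) (some x) (some y) + Module.finrank k (partialSections V
      (zetaLinks Q (fun v => rowPos Q x ≤ rowPos Q v) (fun v => colPos Q v ≤ colPos Q y))
      (zetaZeros Q (fun v => rowPos Q x ≤ rowPos Q v) (fun v => colPos Q v ≤ colPos Q y))) =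
      ∑ v, if rowPos Q x ≤ rowPos Q v then d v else 0 := by
  rw [← finrank_leftKernel_zetaBlock, ← rank_add_finrank_leftKernel (zetaBlock V)
      (fun v => rowPos Q x ≤ rowPos Q v) (fun v => colPos Q v ≤ colPos Q y)]
  congr 1
  rw [swRank]
  congr 1
  ext i j
  simp only [zeta, zetaBlock, Matrix.submatrix_apply, Matrix.of_apply]
  split_ifs <;> rfl

end Zeta

/-! ### The left kernels of the matrices defining the rank parameters -/

section Phi

/-- Within the arrows between `a` and `b`, the vertex `v` is the start of a left arrow. -/
def StartsLeft (Q : Fin n → Dir) (a b : Fin n) (v : Fin (n + 1)) : Prop :=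
  ∃ i, a ≤ i ∧ i ≤ b ∧ v = i.succ ∧ Q i = Dir.left

/-- Within the arrows between `a` and `b`, the vertex `v` is the start of a right arrow. -/
def StartsRight (Q : Fin n → Dir) (a b : Fin n) (v : Fin (n + 1)) : Prop :=
  ∃ i, a ≤ i ∧ i ≤ b ∧ v = i.castSucc ∧ Q i = Dir.right

lemma isSinkIn_iff {a b : Fin n} {v : Fin (n + 1)} :
    IsSinkIn Q a.castSucc b.succ v ↔ (a.castSucc ≤ v ∧ v ≤ b.succ) ∧
      ¬ StartsLeft Q a b v ∧ ¬ StartsRight Q a b v := by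
  refine and_congr_right fun hv => ⟨fun h => ⟨?_, ?_⟩, fun h z hz hz' => ⟨fun e => ?_⟩⟩
  · rintro ⟨i, h1, h2, rfl, h4⟩
    refine (h i.castSucc ?_ ?_).false (Arrow.left i h4) <;>
    · simp only [Fin.le_def, Fin.val_castSucc, Fin.val_succ] at *
      omega
  · rintro ⟨i, h1, h2, rfl, h4⟩
    refine (h i.succ ?_ ?_).false (Arrow.right i h4) <;>
    · simp only [Fin.le_def, Fin.val_castSucc, Fin.val_succ] at *
      omega
  · cases e with
    | right i hi =>
      refine h.2 ⟨i, ?_, ?_, rfl, hi⟩ <;>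
      · simp only [Fin.le_def, Fin.val_castSucc, Fin.val_succ] at *
        omega
    | left i hi =>
      refine h.1 ⟨i, ?_, ?_, rfl, hi⟩ <;>
      · simp only [Fin.le_def, Fin.val_castSucc, Fin.val_succ] at *
        omega

/-- The ways in which a vertex can be a source between the arrows `a` and `b`. -/
lemma isSourceIn_iff {a b : Fin n} (hab : a ≤ b) {v : Fin (n + 1)} :
    IsSourceIn Q a.castSucc b.succ v ↔ (v = a.castSucc ∧ Q a = Dir.right) ∨
      (v = b.succ ∧ Q b = Dir.left) ∨ ∃ i j, a ≤ i ∧ j ≤ b ∧ v = i.succ ∧ v = j.castSucc ∧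
        Q i = Dir.left ∧ Q j = Dir.right := by
  constructor
  · rintro ⟨⟨h1, h2⟩, h⟩
    have hr : ∀ i : Fin n, a ≤ i → i ≤ b → v = i.castSucc → Q i = Dir.right := by
      rintro i hi hi' rfl
      by_contra hne
      refine (h i.succ ?_ ?_).false (Arrow.left i ((Dir.eq_left_or_right _).resolve_right hne)) <;>
      · simp only [Fin.le_def, Fin.val_castSucc, Fin.val_succ] at *
        omega
    have hl : ∀ i : Fin n, a ≤ i → i ≤ b → v = i.succ → Q i = Dir.left := by
      rintro i hi hi' rfl
      by_contra hne
      refine (h i.castSucc ?_ ?_).false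
        (Arrow.right i ((Dir.eq_left_or_right _).resolve_left hne)) <;>
      · simp only [Fin.le_def, Fin.val_castSucc, Fin.val_succ] at *
        omega
    by_cases ha : v = a.castSucc
    · exact Or.inl ⟨ha, hr a le_rfl hab ha⟩
    by_cases hb : v = b.succ
    · exact Or.inr (Or.inl ⟨hb, hl b hab le_rfl hb⟩)
    rcases Fin.eq_zero_or_eq_succ v with rfl | ⟨i, rfl⟩
    · simp only [Fin.le_def, Fin.val_castSucc, Fin.val_succ, Fin.ext_iff, Fin.val_zero] at *
      omega
    rcases Fin.eq_castSucc_or_eq_last i.succ with ⟨j, hj⟩ | hj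
    · have hai : a ≤ i ∧ i ≤ b ∧ a ≤ j ∧ j ≤ b := by
        simp only [Fin.le_def, Fin.val_castSucc, Fin.val_succ, Fin.ext_iff] at *
        omega
      exact Or.inr (Or.inr ⟨i, j, hai.1, hai.2.2.2, rfl, hj, hl i hai.1 hai.2.1 rfl,
        hr j hai.2.2.1 hai.2.2.2 hj⟩)
    · simp only [Fin.le_def, Fin.val_castSucc, Fin.val_succ, Fin.ext_iff, Fin.val_last] at *
      omega
  · intro h
    have hv : a.castSucc ≤ v ∧ v ≤ b.succ := by
      rcases h with ⟨rfl, -⟩ | ⟨rfl, -⟩ | ⟨i, j, h1, h2, h3, h4, -, -⟩ <;>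
      · simp only [Fin.le_def, Fin.val_castSucc, Fin.val_succ, Fin.ext_iff] at *
        omega
    refine ⟨hv, fun z hz hz' => ⟨fun e => ?_⟩⟩
    rcases h with ⟨h1, h2⟩ | ⟨h1, h2⟩ | ⟨i, j, h1, h2, h3, h4, h5, h6⟩
    · rcases e.endpoints with ⟨e1, e2, e3⟩ | ⟨e1, e2, e3⟩
      · have h7 : v.val = _ := congrArg Fin.val e2
        have h8 : z.val = _ := congrArg Fin.val e1
        simp only [Fin.le_def, Fin.val_castSucc, Fin.val_succ, Fin.ext_iff] at *
        omega
      · rw [← Fin.castSucc_injective _ (h1.symm.trans e2), h2] at e3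
        cases e3
    · rcases e.endpoints with ⟨e1, e2, e3⟩ | ⟨e1, e2, e3⟩
      · rw [← Fin.succ_injective _ (h1.symm.trans e2), h2] at e3
        cases e3
      · have h7 : v.val = _ := congrArg Fin.val e2
        have h8 : z.val = _ := congrArg Fin.val e1
        simp only [Fin.le_def, Fin.val_castSucc, Fin.val_succ, Fin.ext_iff] at *
        omega
    · rcases e.endpoints with ⟨e1, e2, e3⟩ | ⟨e1, e2, e3⟩
      · rw [← Fin.succ_injective _ (h3.symm.trans e2), h5] at e3
        cases e3
      · rw [← Fin.castSucc_injective _ (h4.symm.trans e2), h6] at e3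
        cases e3

variable {d : Fin (n + 1) → ℕ}

/-- The transform `g ↦ (∑_{x ≤ y} g_x V_{y → x})_y` by the maps along left paths. -/
noncomputable def leftTransform (V : RepSpace k Q d) :
    (∀ v, Fin (d v) → k) →ₗ[k] (∀ v, Fin (d v) → k) where
  toFun g y := ∑ x ∈ Finset.Iic y, g x ᵥ* pathBlock V x y
  map_add' a b := by
    ext y : 1
    simp [Matrix.add_vecMul, Finset.sum_add_distrib]
  map_smul' c a := by
    ext y : 1
    simp [Matrix.smul_vecMul, Finset.smul_sum]

lemma leftTransform_apply (V : RepSpace k Q d) (g : ∀ v, Fin (d v) → k) (y : Fin (n + 1)) :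
    leftTransform V g y = ∑ x ∈ Finset.Iic y, g x ᵥ* pathBlock V x y := rfl

lemma leftTransform_zero (V : RepSpace k Q d) (g : ∀ v, Fin (d v) → k) :
    leftTransform V g 0 = g 0 := by
  have : Finset.Iic (0 : Fin (n + 1)) = {0} := by ext; simp
  rw [leftTransform_apply, this, Finset.sum_singleton, pathBlock_self, Matrix.vecMul_one]

lemma leftTransform_succ_left (V : RepSpace k Q d) (g : ∀ v, Fin (d v) → k) {i : Fin n}
    (hi : Q i = Dir.left) : leftTransform V g i.succ =
      g i.succ + leftTransform V g i.castSucc ᵥ* V (Arrow.left i hi) := by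
  rw [leftTransform_apply, Iic_succ, Finset.sum_insert (by simp), pathBlock_self,
    Matrix.vecMul_one, leftTransform_apply, Matrix.sum_vecMul]
  congr 1
  refine Finset.sum_congr rfl fun x hx => ?_
  rw [pathBlock_succ_left V hi (Finset.mem_Iic.1 hx), Matrix.vecMul_vecMul]

lemma leftTransform_succ_right (V : RepSpace k Q d) (g : ∀ v, Fin (d v) → k) {i : Fin n}
    (hi : Q i = Dir.right) : leftTransform V g i.succ = g i.succ := by
  rw [leftTransform_apply, Iic_succ, Finset.sum_insert (by simp), pathBlock_self,
    Matrix.vecMul_one, Finset.sum_eq_zero, add_zero]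
  intro x hx
  rw [pathBlock_succ_right V hi (Finset.mem_Iic.1 hx), Matrix.vecMul_zero]

/-- The extra g_y is there because the diagonal term x = y occurs in both transforms. -/
lemma sum_pathBlock (V : RepSpace k Q d) (g : ∀ v, Fin (d v) → k) (y : Fin (n + 1)) :
    ∑ x, g x ᵥ* pathBlock V x y + g y = rightTransform V g y + leftTransform V g y := by
  have h : (Finset.univ : Finset (Fin (n + 1))) = Finset.Ioi y ∪ Finset.Iic y := by
    ext x
    simp [lt_or_ge]
  rw [h, Finset.sum_union, rightTransform_apply, leftTransform_apply, ← Finset.Ioi_insert,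
    Finset.sum_insert (by simp), pathBlock_self, Matrix.vecMul_one]
  · abel
  · rw [Finset.disjoint_left]
    intro x hx hx'
    exact absurd (Finset.mem_Iic.1 hx') (not_le.2 (Finset.mem_Ioi.1 hx))

lemma leftTransform_castSucc_eq (V : RepSpace k Q d) (g : ∀ v, Fin (d v) → k) {a : Fin n}
    (hg : ∀ v < a.castSucc, g v = 0) : leftTransform V g a.castSucc = g a.castSucc := by
  rw [leftTransform_apply, Finset.sum_eq_single_of_mem a.castSucc (by simp), pathBlock_self,
    Matrix.vecMul_one]
  intro x hx hne
  rw [hg x (lt_of_le_of_ne (Finset.mem_Iic.1 hx) hne), Matrix.zero_vecMul]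

lemma rightTransform_succ_eq (V : RepSpace k Q d) (g : ∀ v, Fin (d v) → k) {b : Fin n}
    (hg : ∀ v > b.succ, g v = 0) : rightTransform V g b.succ = g b.succ := by
  rw [rightTransform_apply, Finset.sum_eq_single_of_mem b.succ (by simp), pathBlock_self,
    Matrix.vecMul_one]
  intro x hx hne
  rw [hg x (lt_of_le_of_ne (Finset.mem_Ici.1 hx) hne.symm), Matrix.zero_vecMul]

/-- The vertices outside the interval from `a` to `b`, and the sources at its ends. -/
def intervalZeros (Q : Fin n → Dir) (a b : Fin n) : Set (Fin (n + 1)) :=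
  {v | v < a.castSucc ∨ b.succ < v ∨ (v = a.castSucc ∧ Q a = Dir.right) ∨
    (v = b.succ ∧ Q b = Dir.left)}

open Classical in
/-- Negate the maps at the right arrows that start at an inner source. -/
noncomputable def sourceSign (k : Type*) [Field k] (Q : Fin n → Dir) (i : Fin n) : kˣ :=
  if Q i = Dir.right ∧ ∃ j : Fin n, j.succ = i.castSucc ∧ Q j = Dir.left then -1 else 1

lemma sourceSign_left {i : Fin n} (hi : Q i = Dir.left) : sourceSign k Q i = 1 := by
  simp [sourceSign, hi]

lemma sourceSign_of_left {i j : Fin n} (hi : Q i = Dir.right) (hj : Q j = Dir.left)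
    (hij : j.succ = i.castSucc) : sourceSign k Q i = -1 := by
  rw [sourceSign, if_pos ⟨hi, j, hij, hj⟩]

lemma sourceSign_of_right {i j : Fin n} (hj : Q j = Dir.right)
    (hij : j.succ = i.castSucc) : sourceSign k Q i = 1 := by
  rw [sourceSign, if_neg]
  rintro ⟨-, j', h1, h2⟩
  rw [Fin.succ_injective _ (h1.trans hij.symm), hj] at h2
  cases h2

/-! ### Left kernel of φ_{[a,b]} versus partial sections on the interval. -/

section Interval

variable (V : RepSpace k Q d) {a b : Fin n}

lemma not_startsLeft_of_left {i : Fin n} (ha : a ≤ i) (hb : i ≤ b)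
    (h : ¬ StartsLeft Q a b i.castSucc) : i = a ∨ ∃ j : Fin n, i.castSucc = j.succ ∧
      Q j = Dir.right := by
  rcases Fin.eq_zero_or_eq_succ i.castSucc with h0 | ⟨j, hj⟩
  · left
    simp only [Fin.le_def, Fin.val_castSucc, Fin.ext_iff, Fin.val_zero] at *
    omega
  · rcases Dir.eq_left_or_right (Q j) with hl | hr
    · left
      by_contra hne
      refine h ⟨j, ?_, ?_, hj, hl⟩ <;>
      · simp only [Fin.le_def, Fin.val_castSucc, Fin.val_succ, Fin.ext_iff] at *
        omega
    · exact Or.inr ⟨j, hj, hr⟩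

open Classical in
/-- The section attached to a family of row vectors at the sinks. -/
noncomputable def sinkExtension (a b : Fin n) (f : ∀ v, Fin (d v) → k) :
    ∀ v, Fin (d v) → k := fun v =>
  if StartsLeft Q a b v then leftTransform V f v
  else if a.castSucc ≤ v ∧ v ≤ b.succ then rightTransform V f v else 0

/-- Row vectors at the sinks are pulled back along the paths leading to them: from the sink on the
left at starts of left arrows, from the right elsewhere in the interval. At an inner source both
pull-backs are available and the column condition says that their sum is zero; `sourceSign` on the
outgoing right arrow turns "opposite" into "equal". A source at an end of the interval has only one
side, so its value is forced to be zero, as `intervalZeros` demands. -/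
lemma sinkExtension_mem (hab : a ≤ b) {f : ∀ v, Fin (d v) → k}
    (hf : f ∈ leftKernel (pathBlock V) (IsSinkIn Q a.castSucc b.succ)
      (IsSourceIn Q a.castSucc b.succ)) :
    sinkExtension V a b f ∈ partialSections (rescale (sourceSign k Q) V) (Finset.Icc a b)
      (intervalZeros Q a b) := by
  obtain ⟨hf1, hf2⟩ := mem_leftKernel.1 hf
  have hlt : ∀ v < a.castSucc, f v = 0 := fun v hv => hf1 v fun h => not_le.2 hv h.1.1
  have hgt : ∀ v > b.succ, f v = 0 := fun v hv => hf1 v fun h => not_le.2 hv h.1.2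
  have hL : ∀ v, StartsLeft Q a b v → f v = 0 := fun v hv => hf1 v fun h => (isSinkIn_iff.1 h).2.1 hv
  have hR : ∀ v, StartsRight Q a b v → f v = 0 :=
    fun v hv => hf1 v fun h => (isSinkIn_iff.1 h).2.2 hv
  have hla := leftTransform_castSucc_eq V f hlt
  have hrb := rightTransform_succ_eq V f hgt
  have hsrc : ∀ v, IsSourceIn Q a.castSucc b.succ v → f v = 0 →
      rightTransform V f v + leftTransform V f v = 0 := by
    intro v hv h0
    rw [← sum_pathBlock, hf2 v hv, h0, add_zero]
  have hin : ∀ i : Fin n, a ≤ i → i ≤ b → (a.castSucc ≤ i.castSucc ∧ i.castSucc ≤ b.succ) ∧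
      (a.castSucc ≤ i.succ ∧ i.succ ≤ b.succ) := by
    intro i h1 h2
    simp only [Fin.le_def, Fin.val_castSucc, Fin.val_succ] at *
    omega
  have hnla : ¬ StartsLeft Q a b a.castSucc := by
    rintro ⟨j, h1, h2, h3, h4⟩
    simp only [Fin.le_def, Fin.val_castSucc, Fin.val_succ, Fin.ext_iff] at *
    omega
  have h0a : Q a = Dir.right → rightTransform V f a.castSucc = 0 := by
    intro h
    have h1 : f a.castSucc = 0 := hR _ ⟨a, le_rfl, hab, rfl, h⟩
    have h2 := hsrc a.castSucc ((isSourceIn_iff hab).2 (Or.inl ⟨rfl, h⟩)) h1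
    rwa [hla, h1, add_zero] at h2
  constructor
  · intro x y e he
    cases e with
    | right i hi =>
      obtain ⟨h1, h2⟩ : a ≤ i ∧ i ≤ b := Finset.mem_Icc.1 he
      have hns : ¬ StartsLeft Q a b i.succ := by
        rintro ⟨j, -, -, h3, h4⟩
        rw [← Fin.succ_injective _ h3, hi] at h4
        cases h4
      have hf0 : f i.castSucc = 0 := hR _ ⟨i, h1, h2, rfl, hi⟩
      have hr := rightTransform_castSucc_right V f hi
      rw [hf0, zero_add] at hr
      have hy : sinkExtension V a b f i.succ = rightTransform V f i.succ := by
        rw [sinkExtension, if_neg hns, if_pos (hin i h1 h2).2]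
      rw [hy]
      by_cases hs : StartsLeft Q a b i.castSucc
      · obtain ⟨j, h3, h4, h5, h6⟩ := hs
        have h7 := hsrc i.castSucc ((isSourceIn_iff hab).2
          (Or.inr (Or.inr ⟨j, i, h3, h2, h5, rfl, h6, hi⟩))) hf0
        rw [sinkExtension, if_pos ⟨j, h3, h4, h5, h6⟩, eq_neg_of_add_eq_zero_right h7, hr]
        simp [rescale, Arrow.edge, sourceSign_of_left hi h6 h5.symm, Matrix.vecMul_neg]
      · rw [sinkExtension, if_neg hs, if_pos (hin i h1 h2).1]
        rcases eq_or_ne i a with rfl | hne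
        · rw [rescale, Matrix.vecMul_smul, ← hr, h0a hi, smul_zero]
        · have : sourceSign k Q i = 1 := by
            rw [sourceSign, if_neg]
            rintro ⟨-, j, h3, h4⟩
            refine hs ⟨j, ?_, ?_, h3.symm, h4⟩ <;>
            · simp only [Fin.le_def, Fin.val_castSucc, Fin.val_succ, Fin.ext_iff, ne_eq] at *
              omega
          simp [rescale, Arrow.edge, this, hr]
    | left i hi =>
      obtain ⟨h1, h2⟩ : a ≤ i ∧ i ≤ b := Finset.mem_Icc.1 he
      have hs : StartsLeft Q a b i.succ := ⟨i, h1, h2, rfl, hi⟩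
      rw [sinkExtension, if_pos hs, leftTransform_succ_left V f hi, hL _ hs, zero_add]
      simp only [rescale, Arrow.edge, sourceSign_left hi, Units.val_one, one_smul]
      congr 1
      rw [sinkExtension]
      by_cases hs' : StartsLeft Q a b i.castSucc
      · rw [if_pos hs']
      · rw [if_neg hs', if_pos (hin i h1 h2).1, rightTransform_castSucc_left V f hi]
        rcases not_startsLeft_of_left h1 h2 hs' with rfl | ⟨j, h3, h4⟩
        · exact hla
        · rw [h3, leftTransform_succ_right V f h4]
  · rintro v (h | h | ⟨rfl, h⟩ | ⟨rfl, h⟩)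
    · rw [sinkExtension, if_neg, if_neg]
      · exact fun h' => not_le.2 h h'.1
      · rintro ⟨j, h1, h2, h3, h4⟩
        simp only [Fin.le_def, Fin.lt_def, Fin.val_castSucc, Fin.val_succ, Fin.ext_iff] at *
        omega
    · rw [sinkExtension, if_neg, if_neg]
      · exact fun h' => not_le.2 h h'.2
      · rintro ⟨j, h1, h2, h3, h4⟩
        simp only [Fin.le_def, Fin.lt_def, Fin.val_castSucc, Fin.val_succ, Fin.ext_iff] at *
        omega
    · rw [sinkExtension, if_neg hnla, if_pos (hin a le_rfl hab).1, h0a h]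
    · have hs : StartsLeft Q a b b.succ := ⟨b, hab, le_rfl, rfl, h⟩
      have h2 := hsrc b.succ ((isSourceIn_iff hab).2 (Or.inr (Or.inl ⟨rfl, h⟩))) (hL _ hs)
      rw [hrb, hL _ hs, zero_add] at h2
      rw [sinkExtension, if_pos hs, h2]

lemma sinkExtension_sink {f : ∀ v, Fin (d v) → k}
    (hf : ∀ v, ¬ IsSinkIn Q a.castSucc b.succ v → f v = 0) {v : Fin (n + 1)}
    (hv : IsSinkIn Q a.castSucc b.succ v) : sinkExtension V a b f v = f v := by
  obtain ⟨h1, h2, h3⟩ := isSinkIn_iff.1 hv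
  rw [sinkExtension, if_neg h2, if_pos h1]
  rcases eq_or_ne v b.succ with rfl | hne
  · exact rightTransform_succ_eq V f fun v hv => hf v fun h => not_le.2 hv h.1.2
  · rcases Fin.eq_castSucc_or_eq_last v with ⟨i, rfl⟩ | rfl
    · rcases Dir.eq_left_or_right (Q i) with hi | hi
      · exact rightTransform_castSucc_left V f hi
      · exfalso
        refine h3 ⟨i, ?_, ?_, rfl, hi⟩ <;>
        · simp only [Fin.le_def, Fin.val_castSucc, Fin.val_succ, Fin.ext_iff, ne_eq] at *
          omega
    · exact rightTransform_last V f

open Classical in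
/-- The restriction of a family of row vectors to the sinks. -/
noncomputable def sinkRestriction (Q : Fin n → Dir) (a b : Fin n) (h : ∀ v, Fin (d v) → k) :
    ∀ v, Fin (d v) → k := fun v => if IsSinkIn Q a.castSucc b.succ v then h v else 0

lemma sinkRestriction_of_not {h : ∀ v, Fin (d v) → k} {v : Fin (n + 1)}
    (hv : ¬ IsSinkIn Q a.castSucc b.succ v) : sinkRestriction Q a b h v = 0 := if_neg hv

/-- A section is determined by its values at the sinks. Here these are carried to the right, against
a chain of left arrows, by induction from the left end. -/
lemma leftTransform_sinkRestriction {h : ∀ v, Fin (d v) → k}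
    (hh : h ∈ partialSections (rescale (sourceSign k Q) V) (Finset.Icc a b)
      (intervalZeros Q a b)) (v : Fin (n + 1))
    (hv : StartsLeft Q a b v ∨ IsSinkIn Q a.castSucc b.succ v) :
    leftTransform V (sinkRestriction Q a b h) v = h v := by
  set f := sinkRestriction Q a b h with hf
  have hlt : ∀ v < a.castSucc, f v = 0 :=
    fun v hv => sinkRestriction_of_not fun h => not_le.2 hv h.1.1
  have hla := leftTransform_castSucc_eq V f hlt
  induction v using Fin.induction with
  | zero =>
    rcases hv with ⟨i, -, -, h1, -⟩ | hv
    · exact absurd h1.symm (Fin.succ_ne_zero i)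
    · rw [leftTransform_zero, hf, sinkRestriction, if_pos hv]
  | succ i ih =>
    by_cases hs : StartsLeft Q a b i.succ
    · obtain ⟨j, h1, h2, h3, h4⟩ := hs
      obtain rfl := Fin.succ_injective _ h3
      have h5 : f i.succ = 0 := sinkRestriction_of_not fun h' =>
        (isSinkIn_iff.1 h').2.1 ⟨i, h1, h2, rfl, h4⟩
      have h6 := hh.1 (Arrow.left i h4) (Finset.mem_Icc.2 ⟨h1, h2⟩)
      rw [leftTransform_succ_left V f h4, h5, zero_add, h6, ih]
      · simp [rescale, Arrow.edge, sourceSign_left h4]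
      · by_contra hne
        push Not at hne
        refine hne.2 (isSinkIn_iff.2 ⟨?_, hne.1, ?_⟩)
        · simp only [Fin.le_def, Fin.val_castSucc, Fin.val_succ] at *
          omega
        · rintro ⟨j, -, -, h7, h8⟩
          rw [← Fin.castSucc_injective _ h7, h4] at h8
          cases h8
    · have hv := hv.resolve_left hs
      have hfv : f i.succ = h i.succ := if_pos hv
      by_cases hai : i.succ = a.castSucc
      · rw [hai, hla, ← hai, hfv]
      · rcases Dir.eq_left_or_right (Q i) with hi | hi
        · exfalso
          have := hv.1
          refine hs ⟨i, ?_, ?_, rfl, hi⟩ <;>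
          · simp only [Fin.le_def, Fin.val_castSucc, Fin.val_succ, Fin.ext_iff] at *
            omega
        · rw [leftTransform_succ_right V f hi, hfv]

/-- The mirror image, by induction from the right end. Only the first arrow of a right path can
start at an inner source: every later one is preceded by a right arrow, so `sourceSign` is 1 there.
Hence a single sign remains. -/
lemma rightTransform_sinkRestriction {h : ∀ v, Fin (d v) → k}
    (hh : h ∈ partialSections (rescale (sourceSign k Q) V) (Finset.Icc a b)
      (intervalZeros Q a b)) (v : Fin (n + 1)) :
    (IsSinkIn Q a.castSucc b.succ v → rightTransform V (sinkRestriction Q a b h) v = h v) ∧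
    ∀ i, a ≤ i → i ≤ b → v = i.castSucc → Q i = Dir.right →
      rightTransform V (sinkRestriction Q a b h) v = (sourceSign k Q i : k) • h v := by
  set f := sinkRestriction Q a b h with hf
  have hgt : ∀ v > b.succ, f v = 0 :=
    fun v hv => sinkRestriction_of_not fun h => not_le.2 hv h.1.2
  have hrb := rightTransform_succ_eq V f hgt
  induction v using Fin.reverseInduction with
  | last =>
    refine ⟨fun hv => ?_, fun i _ _ h1 => absurd h1.symm (Fin.castSucc_lt_last i).ne⟩
    rw [rightTransform_last, hf, sinkRestriction, if_pos hv]
  | cast i ih =>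
    constructor
    · intro hv
      have hfv : f i.castSucc = h i.castSucc := if_pos hv
      by_cases hbi : i.castSucc = b.succ
      · rw [hbi, hrb, ← hbi, hfv]
      · rcases Dir.eq_left_or_right (Q i) with hi | hi
        · rw [rightTransform_castSucc_left V f hi, hfv]
        · exfalso
          have := hv.1
          refine (isSinkIn_iff.1 hv).2.2 ⟨i, ?_, ?_, rfl, hi⟩ <;>
          · simp only [Fin.le_def, Fin.val_castSucc, Fin.val_succ, Fin.ext_iff] at *
            omega
    · intro j h1 h2 h3 h4
      obtain rfl := Fin.castSucc_injective _ h3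
      have h5 : f i.castSucc = 0 := sinkRestriction_of_not fun h' =>
        (isSinkIn_iff.1 h').2.2 ⟨i, h1, h2, rfl, h4⟩
      have h6 := hh.1 (Arrow.right i h4) (Finset.mem_Icc.2 ⟨h1, h2⟩)
      have h7 : rightTransform V f i.succ = h i.succ := by
        by_cases hs : IsSinkIn Q a.castSucc b.succ i.succ
        · exact ih.1 hs
        · have h8 : StartsRight Q a b i.succ := by
            by_contra hne
            refine hs (isSinkIn_iff.2 ⟨?_, ?_, hne⟩)
            · simp only [Fin.le_def, Fin.val_castSucc, Fin.val_succ] at *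
              omega
            · rintro ⟨j, -, -, h7, h8⟩
              rw [← Fin.succ_injective _ h7, h4] at h8
              cases h8
          obtain ⟨j, h8, h9, h10, h11⟩ := h8
          rw [ih.2 j h8 h9 h10 h11, sourceSign_of_right h4 h10]
          simp
      rw [rightTransform_castSucc_right V f h4, h5, zero_add, h7, h6]
      simp only [rescale, Arrow.edge, Matrix.vecMul_smul, smul_smul]
      -- The sign occurs twice and squares to 1.
      rw [sourceSign]
      split_ifs <;> simp

lemma sinkRestriction_mem (hab : a ≤ b) {h : ∀ v, Fin (d v) → k}
    (hh : h ∈ partialSections (rescale (sourceSign k Q) V) (Finset.Icc a b)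
      (intervalZeros Q a b)) :
    sinkRestriction Q a b h ∈ leftKernel (pathBlock V) (IsSinkIn Q a.castSucc b.succ)
      (IsSourceIn Q a.castSucc b.succ) := by
  have hl := leftTransform_sinkRestriction V hh
  have hr := rightTransform_sinkRestriction V hh
  set f := sinkRestriction Q a b h with hf
  refine ⟨fun v hv => sinkRestriction_of_not hv, fun y hy => ?_⟩
  have hfL : ∀ v, StartsLeft Q a b v → f v = 0 := fun v hv =>
    sinkRestriction_of_not fun h => (isSinkIn_iff.1 h).2.1 hv
  have hfR : ∀ v, StartsRight Q a b v → f v = 0 := fun v hv =>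
    sinkRestriction_of_not fun h => (isSinkIn_iff.1 h).2.2 hv
  have key := sum_pathBlock V f y
  rcases (isSourceIn_iff hab).1 hy with ⟨h1, h2⟩ | ⟨h1, h2⟩ | ⟨i, j, h1, h2, h3, h4, h5, h6⟩
  · have h3 : f y = 0 := hfR y ⟨a, le_rfl, hab, h1, h2⟩
    have h4 : h y = 0 := hh.2 y (Or.inr (Or.inr (Or.inl ⟨h1, h2⟩)))
    have h5 := (hr y).2 a le_rfl hab h1 h2
    have h6 : leftTransform V f y = f y := by
      rw [h1]
      exact leftTransform_castSucc_eq V f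
        fun v hv => sinkRestriction_of_not fun h => not_le.2 hv h.1.1
    rw [h5, h6, h3, h4] at key
    simpa using key
  · have hs : StartsLeft Q a b y := ⟨b, hab, le_rfl, h1, h2⟩
    have h3 : f y = 0 := hfL y hs
    have h4 : h y = 0 := hh.2 y (Or.inr (Or.inr (Or.inr ⟨h1, h2⟩)))
    have h5 := hl y (Or.inl hs)
    have h6 : rightTransform V f y = f y := by
      rw [h1]
      exact rightTransform_succ_eq V f
        fun v hv => sinkRestriction_of_not fun h => not_le.2 hv h.1.2
    rw [h5, h6, h3, h4] at key
    simpa using key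
  -- At an inner source the left transform gives h_y and the right transform gives -h_y, so the
  -- column condition holds.
  · have hij : i ≤ b ∧ a ≤ j := by
      have := h3.symm.trans h4
      simp only [Fin.le_def, Fin.val_castSucc, Fin.val_succ, Fin.ext_iff] at *
      omega
    have hs : StartsLeft Q a b y := ⟨i, h1, hij.1, h3, h5⟩
    rw [hl y (Or.inl hs), (hr y).2 j hij.2 h2 h4 h6, hfL y hs,
      sourceSign_of_left h6 h5 (h3.symm.trans h4)] at key
    simpa using key

/-- Within the interval every vertex is a sink or starts an arrow, so its value is given, up to
sign, by a transform of the values at the sinks. -/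
lemma eq_zero_of_sinkRestriction_eq_zero {h : ∀ v, Fin (d v) → k}
    (hh : h ∈ partialSections (rescale (sourceSign k Q) V) (Finset.Icc a b)
      (intervalZeros Q a b)) (h0 : sinkRestriction Q a b h = 0) : h = 0 := by
  have hl := leftTransform_sinkRestriction V hh
  have hr := rightTransform_sinkRestriction V hh
  rw [h0, map_zero] at hl hr
  ext v : 1
  by_cases hs : IsSinkIn Q a.castSucc b.succ v
  · exact (hl v (Or.inr hs)).symm
  by_cases hs1 : StartsLeft Q a b v
  · exact (hl v (Or.inl hs1)).symm
  by_cases hs2 : StartsRight Q a b v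
  · obtain ⟨i, h1, h2, h3, h4⟩ := hs2
    have := (hr v).2 i h1 h2 h3 h4
    simpa using this.symm
  · refine hh.2 v ?_
    by_contra hne
    refine hs (isSinkIn_iff.2 ⟨?_, hs1, hs2⟩)
    simp only [intervalZeros, Set.mem_ofPred_eq, not_or, not_lt] at hne
    exact ⟨hne.1, hne.2.1⟩

/-- Extension and restriction are injective maps in opposite directions between finite-dimensional
spaces, so it is not necessary to check that they are inverse to each other. -/
lemma finrank_leftKernel_pathBlock (hab : a ≤ b) :
    Module.finrank k (leftKernel (pathBlock V) (IsSinkIn Q a.castSucc b.succ)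
      (IsSourceIn Q a.castSucc b.succ)) =
    Module.finrank k (partialSections V (Finset.Icc a b) (intervalZeros Q a b)) := by
  rw [(isomorphic_rescale (sourceSign k Q) V).finrank_partialSections]
  apply le_antisymm
  · let F : leftKernel (pathBlock V) (IsSinkIn Q a.castSucc b.succ)
        (IsSourceIn Q a.castSucc b.succ) →ₗ[k]
        partialSections (rescale (sourceSign k Q) V) (Finset.Icc a b) (intervalZeros Q a b) :=
      { toFun := fun f => ⟨sinkExtension V a b f.1, sinkExtension_mem V hab f.2⟩
        map_add' := fun f g => by
          ext v : 2
          simp only [sinkExtension, Submodule.coe_add, map_add, Pi.add_apply]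
          split_ifs <;> simp
        map_smul' := fun c g => by
          ext v : 2
          simp only [sinkExtension, Submodule.coe_smul, map_smul, Pi.smul_apply, RingHom.id_apply]
          split_ifs <;> simp }
    refine LinearMap.finrank_le_finrank_of_injective (f := F) fun f g hfg => ?_
    ext v : 2
    by_cases hs : IsSinkIn Q a.castSucc b.succ v
    · have h1 : sinkExtension V a b f.1 v = sinkExtension V a b g.1 v :=
        congrFun (congrArg Subtype.val hfg) v
      rwa [sinkExtension_sink V f.2.1 hs, sinkExtension_sink V g.2.1 hs] at h1
    · rw [f.2.1 v hs, g.2.1 v hs]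
  · let F : partialSections (rescale (sourceSign k Q) V) (Finset.Icc a b)
        (intervalZeros Q a b) →ₗ[k] leftKernel (pathBlock V) (IsSinkIn Q a.castSucc b.succ)
        (IsSourceIn Q a.castSucc b.succ) :=
      { toFun := fun f => ⟨sinkRestriction Q a b f.1, sinkRestriction_mem V hab f.2⟩
        map_add' := fun f g => by
          ext v : 2
          simp only [sinkRestriction, Submodule.coe_add, Pi.add_apply]
          split_ifs <;> simp
        map_smul' := fun c g => by
          ext v : 2
          simp only [sinkRestriction, Submodule.coe_smul, Pi.smul_apply, RingHom.id_apply]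
          split_ifs <;> simp }
    refine LinearMap.finrank_le_finrank_of_injective (f := F) ?_
    rw [← LinearMap.ker_eq_bot, LinearMap.ker_eq_bot']
    intro h hF
    exact Subtype.ext (eq_zero_of_sinkRestriction_eq_zero V h.2 (congrArg Subtype.val hF))

open Classical in
lemma intervalRank_add_finrank (hab : a ≤ b) :
    intervalRank V a.castSucc b.succ +
      Module.finrank k (partialSections V (Finset.Icc a b) (intervalZeros Q a b)) =
      ∑ v, if IsSinkIn Q a.castSucc b.succ v then d v else 0 := by
  rw [← finrank_leftKernel_pathBlock V hab, ← rank_add_finrank_leftKernel (pathBlock V)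
    (IsSinkIn Q a.castSucc b.succ) (IsSourceIn Q a.castSucc b.succ)]
  rfl

end Interval

end Phi

/-! ### The rank parameters determine the dimensions of the spaces of partial sections -/

section Reduction

lemma Arrow.ne {x y : Fin (n + 1)} (a : Arrow Q x y) : x ≠ y := by
  cases a with
  | right i hi => exact (Fin.castSucc_lt_succ).ne
  | left i hi => exact (Fin.castSucc_lt_succ).ne'

variable {ι : Fin (n + 1) → Type} [∀ x, Fintype (ι x)] (V : MatRep k Q ι)

/-- When the target is forced to vanish, the relation at the arrow only says that the source
vanishes. -/
lemma partialSections_eq_erase {x y : Fin (n + 1)} (a : Arrow Q x y) {E : Finset (Fin n)}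
    (ha : a.edge ∈ E) {F : Set (Fin (n + 1))} (hy : y ∈ F) :
    partialSections V E F = partialSections V (E.erase a.edge) (insert x F) := by
  ext h
  constructor
  · rintro ⟨h1, h2⟩
    refine ⟨fun u v b hb => h1 b (Finset.mem_of_mem_erase hb), ?_⟩
    rintro v (rfl | hv)
    · rw [h1 a ha, h2 y hy, Matrix.zero_vecMul]
    · exact h2 v hv
  · rintro ⟨h1, h2⟩
    refine ⟨fun u v b hb => ?_, fun v hv => h2 v (Or.inr hv)⟩
    by_cases hab : b.edge = a.edge
    · obtain ⟨rfl, rfl, h3⟩ := b.eq_of_edge_eq a hab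
      rw [h2 u (Or.inl rfl), h2 v (Or.inr hy), Matrix.zero_vecMul]
    · exact h1 b (Finset.mem_erase.2 ⟨hab, hb⟩)

/-- The value at x is computed from the one at y and enters no other relation, so replacing it by
zero loses no dimension. -/
lemma finrank_partialSections_erase {x y : Fin (n + 1)} (a : Arrow Q x y) {E : Finset (Fin n)}
    (ha : a.edge ∈ E) {F : Set (Fin (n + 1))} (hx : x ∉ F)
    (hE : ∀ e ∈ E, e ≠ a.edge → e.castSucc ≠ x ∧ e.succ ≠ x) :
    Module.finrank k (partialSections V E F) =
      Module.finrank k (partialSections V (E.erase a.edge) (insert x F)) := by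
  have hne : ∀ ⦃u v⦄ (b : Arrow Q u v), b.edge ∈ E → b.edge ≠ a.edge → u ≠ x ∧ v ≠ x := by
    intro u v b hb hba
    have := hE _ hb hba
    rcases b.endpoints with ⟨h1, h2, -⟩ | ⟨h1, h2, -⟩
    · exact ⟨fun h => this.1 (h1.symm.trans h), fun h => this.2 (h2.symm.trans h)⟩
    · exact ⟨fun h => this.2 (h1.symm.trans h), fun h => this.1 (h2.symm.trans h)⟩
  apply le_antisymm
  · let f : partialSections V E F →ₗ[k] partialSections V (E.erase a.edge) (insert x F) :=
      { toFun := fun h => ⟨Function.update h.1 x 0, by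
          refine ⟨fun u v b hb => ?_, ?_⟩
          · obtain ⟨h1, h2⟩ := Finset.mem_erase.1 hb
            obtain ⟨h3, h4⟩ := hne b h2 h1
            rw [Function.update_of_ne h3, Function.update_of_ne h4, h.2.1 b h2]
          · rintro v (rfl | hv)
            · simp
            · rw [Function.update_of_ne (ne_of_mem_of_not_mem hv hx), h.2.2 v hv]⟩
        map_add' := fun g h => by
          refine Subtype.ext ?_
          simp [← Function.update_add]
        map_smul' := fun c h => by
          refine Subtype.ext ?_
          simp [← Function.update_smul] }
    refine LinearMap.finrank_le_finrank_of_injective (f := f) ?_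
    rw [← LinearMap.ker_eq_bot, LinearMap.ker_eq_bot']
    intro h hf
    have h0 : ∀ v, v ≠ x → h.1 v = 0 := by
      intro v hv
      have h1 : Function.update h.1 x 0 v = 0 := congrFun (congrArg Subtype.val hf) v
      rwa [Function.update_of_ne hv] at h1
    ext v : 2
    by_cases hv : v = x
    · subst hv
      rw [h.2.1 a ha, h0 y a.ne.symm]
      simp
    · exact h0 v hv
  · let f : partialSections V (E.erase a.edge) (insert x F) →ₗ[k] partialSections V E F :=
      { toFun := fun h => ⟨Function.update h.1 x (h.1 y ᵥ* V a), by
          refine ⟨fun u v b hb => ?_, ?_⟩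
          · by_cases hba : b.edge = a.edge
            · obtain ⟨rfl, rfl, h3⟩ := b.eq_of_edge_eq a hba
              obtain rfl := eq_of_heq h3
              rw [Function.update_self, Function.update_of_ne b.ne.symm]
            · obtain ⟨h3, h4⟩ := hne b hb hba
              rw [Function.update_of_ne h3, Function.update_of_ne h4,
                h.2.1 b (Finset.mem_erase.2 ⟨hba, hb⟩)]
          · intro v hv
            rw [Function.update_of_ne (ne_of_mem_of_not_mem hv hx), h.2.2 v (Or.inr hv)]⟩
        map_add' := fun g h => by
          refine Subtype.ext ?_
          simp [← Function.update_add, Matrix.add_vecMul]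
        map_smul' := fun c h => by
          refine Subtype.ext ?_
          simp [← Function.update_smul, Matrix.smul_vecMul] }
    refine LinearMap.finrank_le_finrank_of_injective (f := f) ?_
    rw [← LinearMap.ker_eq_bot, LinearMap.ker_eq_bot']
    intro h hf
    ext v : 2
    by_cases hv : v = x
    · exact h.2.2 v (Or.inl hv)
    · have h1 : Function.update h.1 x (h.1 y ᵥ* V a) v = 0 := congrFun (congrArg Subtype.val hf) v
      rwa [Function.update_of_ne hv] at h1

open Classical in
-- No relation joins W to its complement, so a section is the sum of its restrictions to the two.
lemma finrank_partialSections_split {E E₁ E₂ : Finset (Fin n)} {F W : Set (Fin (n + 1))}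
    (hE : E = E₁ ∪ E₂) (h1 : ∀ e ∈ E₁, e.castSucc ∈ W ∧ e.succ ∈ W)
    (h2 : ∀ e ∈ E₂, e.castSucc ∉ W ∧ e.succ ∉ W) :
    Module.finrank k (partialSections V E F) =
      Module.finrank k (partialSections V E₁ (F ∪ Wᶜ)) +
        Module.finrank k (partialSections V E₂ (F ∪ W)) := by
  have h1' : ∀ ⦃u v⦄ (b : Arrow Q u v), b.edge ∈ E₁ → u ∈ W ∧ v ∈ W := by
    intro u v b hb
    rcases b.endpoints with ⟨h3, h4, -⟩ | ⟨h3, h4, -⟩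
    · exact ⟨h3 ▸ (h1 _ hb).1, h4 ▸ (h1 _ hb).2⟩
    · exact ⟨h3 ▸ (h1 _ hb).2, h4 ▸ (h1 _ hb).1⟩
  have h2' : ∀ ⦃u v⦄ (b : Arrow Q u v), b.edge ∈ E₂ → u ∉ W ∧ v ∉ W := by
    intro u v b hb
    rcases b.endpoints with ⟨h3, h4, -⟩ | ⟨h3, h4, -⟩
    · exact ⟨h3 ▸ (h2 _ hb).1, h4 ▸ (h2 _ hb).2⟩
    · exact ⟨h3 ▸ (h2 _ hb).2, h4 ▸ (h2 _ hb).1⟩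
  rw [← Submodule.finrank_sup_add_finrank_inf_eq]
  have hinf : partialSections V E₁ (F ∪ Wᶜ) ⊓ partialSections V E₂ (F ∪ W) = ⊥ := by
    rw [eq_bot_iff]
    rintro h ⟨h3, h4⟩
    rw [Submodule.mem_bot]
    ext v : 1
    by_cases hv : v ∈ W
    · exact h4.2 v (Or.inr hv)
    · exact h3.2 v (Or.inr hv)
  have hsup : partialSections V E₁ (F ∪ Wᶜ) ⊔ partialSections V E₂ (F ∪ W) =
      partialSections V E F := by
    apply le_antisymm
    · refine sup_le ?_ ?_ <;> rintro h ⟨h3, h4⟩ <;>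
        refine ⟨fun u v b hb => ?_, fun v hv => h4 v (Or.inl hv)⟩ <;>
        rw [hE, Finset.mem_union] at hb <;> rcases hb with hb | hb
      · exact h3 b hb
      · rw [h4 u (Or.inr (h2' b hb).1), h4 v (Or.inr (h2' b hb).2), Matrix.zero_vecMul]
      · rw [h4 u (Or.inr (h1' b hb).1), h4 v (Or.inr (h1' b hb).2), Matrix.zero_vecMul]
      · exact h3 b hb
    · rintro h ⟨h3, h4⟩
      rw [Submodule.mem_sup]
      refine ⟨fun v => if v ∈ W then h v else 0, ⟨?_, ?_⟩,
        fun v => if v ∈ W then 0 else h v, ⟨?_, ?_⟩, ?_⟩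
      · intro u v b hb
        simp only [if_pos (h1' b hb).1, if_pos (h1' b hb).2]
        exact h3 b (by rw [hE]; exact Finset.mem_union_left _ hb)
      · rintro v (hv | hv)
        · simp [h4 v hv]
        · exact if_neg hv
      · intro u v b hb
        simp only [if_neg (h2' b hb).1, if_neg (h2' b hb).2]
        exact h3 b (by rw [hE]; exact Finset.mem_union_right _ hb)
      · rintro v (hv | hv)
        · simp [h4 v hv]
        · exact if_pos hv
      · ext v : 1
        by_cases hv : v ∈ W <;> simp [hv]
  rw [hinf, hsup, finrank_bot, add_zero]

end Reduction

/-- The end of the run of consecutive elements of `E` that starts at `a`. -/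
lemma exists_run_end {E : Finset (Fin n)} {a : Fin n} (ha : a ∈ E) :
    ∃ b, a ≤ b ∧ (∀ i, a ≤ i → i ≤ b → i ∈ E) ∧ ∀ i ∈ E, (i : ℕ) ≠ b + 1 := by
  classical
  let S := Finset.univ.filter fun b : Fin n => a ≤ b ∧ ∀ i, a ≤ i → i ≤ b → i ∈ E
  have hS : S.Nonempty := ⟨a, by
    simp only [S, Finset.mem_filter, Finset.mem_univ, true_and, le_refl]
    intro i h1 h2
    rwa [le_antisymm h2 h1]⟩
  have hmem := S.max'_mem hS
  obtain ⟨h1, h2⟩ : a ≤ S.max' hS ∧ ∀ i, a ≤ i → i ≤ S.max' hS → i ∈ E := by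
    simpa [S] using hmem
  refine ⟨S.max' hS, h1, h2, fun i hi hib => ?_⟩
  have hiS : i ∈ S := by
    simp only [S, Finset.mem_filter, Finset.mem_univ, true_and]
    refine ⟨h1.trans (by rw [Fin.le_def]; omega), fun j hj hj' => ?_⟩
    rcases eq_or_ne j i with rfl | hne
    · exact hi
    · refine h2 j hj ?_
      rw [Fin.le_def] at hj' ⊢
      rw [ne_eq, Fin.ext_iff] at hne
      omega
  have := S.le_max' i hiS
  rw [Fin.le_def] at this
  omega

variable {d : Fin (n + 1) → ℕ}

/-- Two representations with the same rank parameter have equally large spaces of partial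
sections, provided that the prescribed zeros are at the ends of the runs of linked arrows. -/
theorem finrank_partialSections_eq_of_intervalRank_eq {V V' : RepSpace k Q d}
    (hr : ∀ a b, a < b → intervalRank V a b = intervalRank V' a b) (E : Finset (Fin n))
    (F : Set (Fin (n + 1)))
    (hF : ∀ v ∈ F, (∀ i ∈ E, i.castSucc ≠ v) ∨ ∀ i ∈ E, i.succ ≠ v) :
    Module.finrank k (partialSections V E F) = Module.finrank k (partialSections V' E F) := by
  classical
  induction hc : E.card using Nat.strong_induction_on generalizing E F with
  | _ c IH =>
  have ih : ∀ (e : Fin n) (x : Fin (n + 1)), e ∈ E →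
      ((∀ i ∈ E.erase e, i.castSucc ≠ x) ∨ ∀ i ∈ E.erase e, i.succ ≠ x) →
      Module.finrank k (partialSections V (E.erase e) (insert x F)) =
        Module.finrank k (partialSections V' (E.erase e) (insert x F)) := by
    intro e x he hx
    refine IH _ (by rw [← hc]; exact Finset.card_erase_lt_of_mem he) _ _ ?_ rfl
    rintro v (rfl | hv)
    · exact hx
    · rcases hF v hv with h | h
      · exact Or.inl fun i hi => h i (Finset.mem_of_mem_erase hi)
      · exact Or.inr fun i hi => h i (Finset.mem_of_mem_erase hi)
  rcases E.eq_empty_or_nonempty with rfl | hne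
  · have : partialSections V ∅ F = partialSections V' ∅ F := by
      ext h
      simp [mem_partialSections]
    rw [this]
  have haE := E.min'_mem hne
  set a := E.min' hne with ha
  have hmin : ∀ i ∈ E, a ≤ i := fun i hi => E.min'_le i hi
  have hla : ∀ i ∈ E, i.succ ≠ a.castSucc := by
    intro i hi h
    have := hmin i hi
    simp only [Fin.le_def, Fin.ext_iff, Fin.val_succ, Fin.val_castSucc] at *
    omega
  have hca : ∀ i ∈ E, i ≠ a → i.castSucc ≠ a.castSucc :=
    fun i _ h h' => h (Fin.castSucc_injective _ h')
  -- [a, b] is the leftmost maximal run of linked arrows.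
  obtain ⟨b, hab, hrun, hend⟩ := exists_run_end haE
  have hbE : b ∈ E := hrun b hab le_rfl
  have hcb : ∀ i ∈ E, i.castSucc ≠ b.succ := by
    intro i hi h
    have := hend i hi
    simp only [Fin.ext_iff, Fin.val_succ, Fin.val_castSucc] at *
    omega
  have hsb : ∀ i ∈ E, i ≠ b → i.succ ≠ b.succ :=
    fun i _ h h' => h (Fin.succ_injective _ h')
  have red0 : ∀ ⦃x y⦄ (e : Arrow Q x y), e.edge ∈ E → y ∈ F →
      ((∀ i ∈ E.erase e.edge, i.castSucc ≠ x) ∨ ∀ i ∈ E.erase e.edge, i.succ ≠ x) →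
      Module.finrank k (partialSections V E F) = Module.finrank k (partialSections V' E F) := by
    intro x y e he hy hx
    rw [partialSections_eq_erase V e he hy, partialSections_eq_erase V' e he hy, ih _ _ he hx]
  have red1 : ∀ ⦃x y⦄ (e : Arrow Q x y), e.edge ∈ E → x ∉ F →
      (∀ i ∈ E, i ≠ e.edge → i.castSucc ≠ x ∧ i.succ ≠ x) →
      Module.finrank k (partialSections V E F) = Module.finrank k (partialSections V' E F) := by
    intro x y e he hy hx
    rw [finrank_partialSections_erase V e he hy hx, finrank_partialSections_erase V' e he hy hx]
    exact ih _ _ he (Or.inl fun i hi =>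
      (hx i (Finset.mem_of_mem_erase hi) (Finset.ne_of_mem_erase hi)).1)
  -- If F meets the ends of the run exactly at its end sources, the run contributes the left kernel
  -- of a φ. Otherwise an end arrow can be dropped: either its outer end is a target in F (`red0`),
  -- or it is a source outside F touched by no other linked arrow (`red1`).
  by_cases hA : (a.castSucc ∈ F ↔ Q a = Dir.right)
  · by_cases hB : (b.succ ∈ F ↔ Q b = Dir.left)
    · let W : Set (Fin (n + 1)) := {v | a.castSucc ≤ v ∧ v ≤ b.succ}
      have hE : E = Finset.Icc a b ∪ E.filter fun i => b < i := by
        ext i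
        simp only [Finset.mem_union, Finset.mem_Icc, Finset.mem_filter]
        constructor
        · intro hi
          rcases le_or_gt i b with h | h
          · exact Or.inl ⟨hmin i hi, h⟩
          · exact Or.inr ⟨hi, h⟩
        · rintro (⟨h1, h2⟩ | ⟨h1, -⟩)
          · exact hrun i h1 h2
          · exact h1
      have hW1 : ∀ e ∈ Finset.Icc a b, e.castSucc ∈ W ∧ e.succ ∈ W := by
        intro e he
        rw [Finset.mem_Icc] at he
        simp only [W, Set.mem_ofPred_eq, Fin.le_def, Fin.val_castSucc, Fin.val_succ] at *
        omega
      have hW2 : ∀ e ∈ E.filter fun i => b < i, e.castSucc ∉ W ∧ e.succ ∉ W := by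
        intro e he
        rw [Finset.mem_filter] at he
        have := hend e he.1
        simp only [W, Set.mem_ofPred_eq, Fin.le_def, Fin.lt_def, Fin.val_castSucc,
          Fin.val_succ] at *
        omega
      have hZ : F ∪ Wᶜ = intervalZeros Q a b ∪ Wᶜ := by
        ext v
        by_cases hv : v ∈ W
        · simp only [Set.mem_union, Set.mem_compl_iff, hv, not_true_eq_false, or_false]
          simp only [intervalZeros, Set.mem_ofPred_eq]
          constructor
          · intro hvF
            right; right
            by_cases h1 : v = a.castSucc
            · left
              exact ⟨h1, hA.1 (h1 ▸ hvF)⟩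
            by_cases h2 : v = b.succ
            · right
              exact ⟨h2, hB.1 (h2 ▸ hvF)⟩
            -- An inner vertex of the run lies between two linked arrows, which the assumption on F
            -- forbids.
            exfalso
            obtain ⟨hv1, hv2⟩ := hv
            rcases Fin.eq_zero_or_eq_succ v with rfl | ⟨i, rfl⟩
            · simp only [Fin.le_def, Fin.ext_iff, Fin.val_zero, Fin.val_castSucc] at *
              omega
            rcases Fin.eq_castSucc_or_eq_last i.succ with ⟨j, hj⟩ | hj
            · have hij : i ≤ b ∧ a ≤ j ∧ a ≤ i ∧ j ≤ b := by
                simp only [Fin.le_def, Fin.ext_iff, Fin.val_succ, Fin.val_castSucc] at *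
                omega
              rcases hF _ hvF with h | h
              · exact h j (hrun j hij.2.1 hij.2.2.2) hj.symm
              · exact h i (hrun i hij.2.2.1 hij.1) rfl
            · simp only [Fin.le_def, Fin.ext_iff, Fin.val_last, Fin.val_succ] at *
              omega
          · rintro (h | h | ⟨rfl, h⟩ | ⟨rfl, h⟩)
            · exact absurd hv.1 (not_le.2 h)
            · exact absurd hv.2 (not_le.2 h)
            · exact hA.2 h
            · exact hB.2 h
        · simp [hv]
      have hZ' : intervalZeros Q a b ∪ Wᶜ = intervalZeros Q a b := by
        refine Set.union_eq_left.2 fun v hv => ?_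
        simp only [W, Set.mem_compl_iff, Set.mem_ofPred_eq, not_and_or, not_le] at hv
        rcases hv with hv | hv
        · exact Or.inl hv
        · exact Or.inr (Or.inl hv)
      rw [finrank_partialSections_split V hE hW1 hW2, finrank_partialSections_split V' hE hW1 hW2,
        hZ, hZ']
      -- The leftmost run is settled by the rank parameter, the remaining arrows by induction since
      -- they are fewer.
      congr 1
      · have e1 := intervalRank_add_finrank V hab
        have e2 := intervalRank_add_finrank V' hab
        rw [hr a.castSucc b.succ (by
          simp only [Fin.lt_def, Fin.le_def, Fin.val_castSucc, Fin.val_succ] at *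
          omega), ← e2] at e1
        exact Nat.add_left_cancel e1
      · refine IH _ ?_ _ _ ?_ rfl
        · rw [← hc]
          refine Finset.card_lt_card (Finset.filter_ssubset.2 ⟨b, hbE, lt_irrefl b⟩)
        · rintro v (hv | hv)
          · rcases hF v hv with h | h
            · exact Or.inl fun i hi => h i (Finset.mem_filter.1 hi).1
            · exact Or.inr fun i hi => h i (Finset.mem_filter.1 hi).1
          · exact Or.inl fun i hi h => (hW2 i hi).1 (h ▸ hv)
    · rcases Dir.eq_left_or_right (Q b) with hb | hb
      · refine red1 (Arrow.left b hb) hbE (fun h => hB (by simp [h, hb])) ?_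
        exact fun i hi hib => ⟨hcb i hi, hsb i hi hib⟩
      · refine red0 (Arrow.right b hb) hbE ?_ (Or.inl fun i hi h =>
          (Finset.mem_erase.1 hi).1 (Fin.castSucc_injective _ h))
        by_contra h
        exact hB (by simp [h, hb])
  · rcases Dir.eq_left_or_right (Q a) with hQ | hQ
    · refine red0 (Arrow.left a hQ) haE ?_ (Or.inr fun i hi h =>
          (Finset.mem_erase.1 hi).1 (Fin.succ_injective _ h))
      by_contra h
      exact hA (by simp [h, hQ])
    · refine red1 (Arrow.right a hQ) haE (fun h => hA (by simp [h, hQ])) ?_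
      exact fun i hi hib => ⟨hca i hi hib, hla i hi⟩

/-- The southwest block ranks of the Zelevinsky matrix are constant on `𝒪_r`. -/
theorem swRank_zeta_eq_of_mem_rankOrbit {r : Fin (n + 1) → Fin (n + 1) → ℕ}
    {V V' : RepSpace k Q d} (hV : V ∈ rankOrbit k Q d r) (hV' : V' ∈ rankOrbit k Q d r)
    (x y : Fin (n + 1)) :
    swRank Q (zeta V) (some x) (some y) = swRank Q (zeta V') (some x) (some y) := by
  obtain ⟨U, hU, hUV⟩ := hV
  obtain ⟨U', hU', hUV'⟩ := hV'
  have h1 := swRank_zeta_add_finrank V x y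
  have h2 := swRank_zeta_add_finrank V' x y
  rw [← hUV.finrank_partialSections, finrank_partialSections_eq_of_intervalRank_eq
    (V' := U') fun a b hab => (hU a b hab).symm.trans (hU' a b hab),
    hUV'.finrank_partialSections, ← h2] at h1
  · exact Nat.add_right_cancel h1
  -- The zeros coming from ζ_Q sit at ends of runs: a zero caused by a missing row has no link to
  -- its right, one caused by a column has none to its left.
  · rintro v (⟨h1, h2⟩ | ⟨h1, h2⟩)
    · left
      rintro i hi rfl
      simp only [zetaLinks, Finset.mem_filter, Finset.mem_univ, true_and] at hi
      rcases h2 i rfl with h3 | h3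
      · simp only [h3, reduceCtorEq, false_and, true_and, false_or] at hi
        exact h1 hi.1
      · rcases hi with hi | hi
        · exact hi.2.2 h3
        · exact h1 hi.2.1
    · right
      rintro i hi rfl
      simp only [zetaLinks, Finset.mem_filter, Finset.mem_univ, true_and] at hi
      rcases h2 i rfl with h3 | h3
      · simp only [h3, reduceCtorEq, false_and, true_and, or_false] at hi
        exact hi.2 h1
      · rcases hi with hi | hi
        · exact hi.2.2 h1
        · exact h3 hi.2.1

/-! ### Partial sections of direct sums of interval representations -/

section DirectSum

lemma vecMul_blockDiagonal' {J : Type} [Fintype J] [DecidableEq J] {α β : J → Type}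
    [∀ j, Fintype (α j)] (M : ∀ j, Matrix (α j) (β j) k) (v : (Σ j, α j) → k) (j : J) (b : β j) :
    (v ᵥ* Matrix.blockDiagonal' M) ⟨j, b⟩ = ((fun a => v ⟨j, a⟩) ᵥ* M j) b := by
  simp only [Matrix.vecMul, dotProduct, Fintype.sum_sigma]
  rw [Finset.sum_eq_single_of_mem j (Finset.mem_univ _)]
  · simp
  · intro i _ hij
    simp [Matrix.blockDiagonal'_apply_ne _ _ _ hij]

lemma finrank_partialSections_directSum {J : Type} [Fintype J] [DecidableEq J]
    {ι : J → Fin (n + 1) → Type} [∀ j x, Fintype (ι j x)] (W : ∀ j, MatRep k Q (ι j))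
    (E : Finset (Fin n)) (F : Set (Fin (n + 1))) :
    Module.finrank k (partialSections (directSum W) E F) =
      ∑ j, Module.finrank k (partialSections (W j) E F) := by
  rw [← Module.finrank_pi_fintype]
  refine LinearEquiv.finrank_eq
    { toFun := fun h j => ⟨fun v a => h.1 v ⟨j, a⟩, ?_, ?_⟩
      map_add' := fun g h => rfl
      map_smul' := fun c h => rfl
      invFun := fun h => ⟨fun v a => (h a.1).1 v a.2, ?_, ?_⟩
      left_inv := fun h => rfl
      right_inv := fun h => rfl }
  · intro x y a ha
    ext b
    exact (congrFun (h.2.1 a ha) ⟨j, b⟩).trans (vecMul_blockDiagonal' (fun j => W j a) (h.1 y) j b)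
  · intro v hv
    ext b
    exact congrFun (h.2.2 v hv) ⟨j, b⟩
  · intro x y a ha
    ext ⟨j, b⟩
    exact (congrFun ((h j).2.1 a ha) b).trans
      (vecMul_blockDiagonal' (fun j => W j a) (fun c => (h c.1).1 y c.2) j b).symm
  · intro v hv
    ext ⟨j, b⟩
    exact congrFun ((h j).2.2 v hv) b

end DirectSum

/-- Each row outside `p` and each column in `q` becomes a condition on one arrow. Where both
conditions occur on an arrow, both ends vanish, so stating its relation as well costs nothing. In
this form the arrows can be scanned one at a time. -/
lemma mem_partialSections_zeta_iff {ι : Fin (n + 1) → Type} [∀ x, Fintype (ι x)]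
    (V : MatRep k Q ι) (p q : Fin (n + 1) → Prop) (h : ∀ v, ι v → k) :
    h ∈ partialSections V (zetaLinks Q p q) (zetaZeros Q p q) ↔
      (∀ (i : Fin n) (hi : Q i = Dir.right),
        (¬ p i.castSucc → h i.castSucc = h i.succ ᵥ* V (Arrow.right i hi)) ∧
        (q i.succ → h i.succ = 0)) ∧
      (∀ (i : Fin n) (hi : Q i = Dir.left), (¬ p i.castSucc → h i.castSucc = 0) ∧
        (q i.succ → h i.succ = h i.castSucc ᵥ* V (Arrow.left i hi))) ∧
      (¬ p (Fin.last n) → h (Fin.last n) = 0) ∧ (q 0 → h 0 = 0) := by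
  constructor
  · rintro ⟨h1, h2⟩
    have hz1 : ∀ i : Fin n, ¬ p i.castSucc → (Q i = Dir.left ∨ q i.succ) → h i.castSucc = 0 := by
      refine fun i hp hi => h2 _ (Or.inl ⟨hp, fun j hj => ?_⟩)
      rwa [← Fin.castSucc_injective _ hj]
    have hz2 : ∀ i : Fin n, q i.succ → (Q i = Dir.right ∨ ¬ p i.castSucc) → h i.succ = 0 := by
      refine fun i hp hi => h2 _ (Or.inr ⟨hp, fun j hj => ?_⟩)
      rwa [← Fin.succ_injective _ hj]
    refine ⟨fun i hi => ⟨fun hp => ?_, fun hq => hz2 i hq (Or.inl hi)⟩,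
      fun i hi => ⟨fun hp => hz1 i hp (Or.inl hi), fun hq => ?_⟩, fun hp => ?_, fun hq => ?_⟩
    · by_cases hq : q i.succ
      · rw [hz1 i hp (Or.inr hq), hz2 i hq (Or.inl hi), Matrix.zero_vecMul]
      · exact h1 (Arrow.right i hi) (by simp [zetaLinks, Arrow.edge, hi, hp, hq])
    · by_cases hp : p i.castSucc
      · exact h1 (Arrow.left i hi) (by simp [zetaLinks, Arrow.edge, hi, hp, hq])
      · rw [hz1 i hp (Or.inl hi), hz2 i hq (Or.inr hp), Matrix.zero_vecMul]
    · exact h2 _ (Or.inl ⟨hp, fun j hj => absurd hj.symm (Fin.castSucc_lt_last j).ne⟩)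
    · exact h2 _ (Or.inr ⟨hq, fun j hj => absurd hj.symm (Fin.succ_ne_zero j)⟩)
  · rintro ⟨hr, hl, hlast, h0⟩
    constructor
    · intro x y a ha
      simp only [zetaLinks, Finset.mem_filter, Finset.mem_univ, true_and] at ha
      cases a with
      | right i hi =>
        simp only [Arrow.edge, hi, true_and, reduceCtorEq, false_and, or_false] at ha
        exact (hr i hi).1 ha.1
      | left i hi =>
        simp only [Arrow.edge, hi, true_and, reduceCtorEq, false_and, false_or] at ha
        exact (hl i hi).2 ha.2
    · rintro v (⟨hv, hv'⟩ | ⟨hv, hv'⟩)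
      · rcases Fin.eq_castSucc_or_eq_last v with ⟨i, rfl⟩ | rfl
        · rcases Dir.eq_left_or_right (Q i) with hi | hi
          · exact (hl i hi).1 hv
          · rw [(hr i hi).1 hv, (hr i hi).2 ((hv' i rfl).resolve_left (by simp [hi])),
              Matrix.zero_vecMul]
        · exact hlast hv
      · rcases Fin.eq_zero_or_eq_succ v with rfl | ⟨i, rfl⟩
        · exact h0 hv
        · rcases Dir.eq_left_or_right (Q i) with hi | hi
          · rw [(hl i hi).2 hv, (hl i hi).1 ((hv' i rfl).resolve_left (by simp [hi])),
              Matrix.zero_vecMul]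
          · exact (hr i hi).2 hv

/-! ### Dimension count for an interval representation, by scanning from left to right. -/

section Scan

/-- The relation between the coordinates of a section at the two ends of the arrow `i`. -/
def ScanRel (Q : Fin n → Dir) (R C : Fin (n + 1) → Prop) (i : Fin n) (s t : k) : Prop :=
  (Q i = Dir.right → (¬ R i.castSucc → s = t) ∧ (C i.succ → t = 0)) ∧
  (Q i = Dir.left → (¬ R i.castSucc → s = 0) ∧ (C i.succ → t = s))

variable (k) in
/-- The scalar sections between the vertices `p` and `t`. -/
def scanSpace (Q : Fin n → Dir) (R C : Fin (n + 1) → Prop) (p t : Fin (n + 1)) :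
    Submodule k (Fin (n + 1) → k) where
  carrier := {φ | (∀ v, ¬ (p ≤ v ∧ v ≤ t) → φ v = 0) ∧ (C p → φ p = 0) ∧
    ∀ i : Fin n, p ≤ i.castSucc → i.succ ≤ t → ScanRel Q R C i (φ i.castSucc) (φ i.succ)}
  zero_mem' := by
    refine ⟨by simp, by simp, fun i _ _ => ⟨fun _ => by simp, fun _ => by simp⟩⟩
  add_mem' := by
    rintro a b ⟨ha, ha', ha''⟩ ⟨hb, hb', hb''⟩
    refine ⟨fun v hv => by simp [ha v hv, hb v hv], fun h => by simp [ha' h, hb' h],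
      fun i h1 h2 => ⟨fun h3 => ⟨fun h4 => ?_, fun h4 => ?_⟩, fun h3 => ⟨fun h4 => ?_,
      fun h4 => ?_⟩⟩⟩
    · simp [((ha'' i h1 h2).1 h3).1 h4, ((hb'' i h1 h2).1 h3).1 h4]
    · simp [((ha'' i h1 h2).1 h3).2 h4, ((hb'' i h1 h2).1 h3).2 h4]
    · simp [((ha'' i h1 h2).2 h3).1 h4, ((hb'' i h1 h2).2 h3).1 h4]
    · simp [((ha'' i h1 h2).2 h3).2 h4, ((hb'' i h1 h2).2 h3).2 h4]
  smul_mem' := by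
    rintro c a ⟨ha, ha', ha''⟩
    refine ⟨fun v hv => by simp [ha v hv], fun h => by simp [ha' h],
      fun i h1 h2 => ⟨fun h3 => ⟨fun h4 => ?_, fun h4 => ?_⟩, fun h3 => ⟨fun h4 => ?_,
      fun h4 => ?_⟩⟩⟩
    · simp [((ha'' i h1 h2).1 h3).1 h4]
    · simp [((ha'' i h1 h2).1 h3).2 h4]
    · simp [((ha'' i h1 h2).2 h3).1 h4]
    · simp [((ha'' i h1 h2).2 h3).2 h4]

variable (k) in
/-- The scalar sections between the vertices `p` and `t` that vanish at `t`. -/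
def scanSpaceZero (Q : Fin n → Dir) (R C : Fin (n + 1) → Prop) (p t : Fin (n + 1)) :
    Submodule k (Fin (n + 1) → k) :=
  scanSpace k Q R C p t ⊓ LinearMap.ker (LinearMap.proj t : (Fin (n + 1) → k) →ₗ[k] k)

variable (k) in
/-- Some scalar section between the vertices `p` and `t` does not vanish at `t`. -/
def ScanFree (Q : Fin n → Dir) (R C : Fin (n + 1) → Prop) (p t : Fin (n + 1)) : Prop :=
  ∃ φ ∈ scanSpace k Q R C p t, φ t ≠ 0

variable {R C : Fin (n + 1) → Prop} {p : Fin (n + 1)}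

lemma mem_scanSpaceZero {t : Fin (n + 1)} {φ : Fin (n + 1) → k} :
    φ ∈ scanSpaceZero k Q R C p t ↔ φ ∈ scanSpace k Q R C p t ∧ φ t = 0 := Iff.rfl

open Classical in
-- Evaluation at t is a linear form, of rank 1 or 0. The scan thus has to record only the dimension
-- of its kernel and whether the form is nonzero.
lemma finrank_scanSpace (t : Fin (n + 1)) : Module.finrank k (scanSpace k Q R C p t) =
    Module.finrank k (scanSpaceZero k Q R C p t) + if ScanFree k Q R C p t then 1 else 0 := by
  let f : scanSpace k Q R C p t →ₗ[k] k :=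
    (LinearMap.proj t : (Fin (n + 1) → k) →ₗ[k] k) ∘ₗ (scanSpace k Q R C p t).subtype
  have hf : ∀ φ, f φ = φ.1 t := fun φ => rfl
  have h1 := f.finrank_range_add_finrank_ker
  have h2 : Module.finrank k (LinearMap.ker f) =
      Module.finrank k (scanSpaceZero k Q R C p t) := by
    have : (LinearMap.ker f).map (scanSpace k Q R C p t).subtype =
        scanSpaceZero k Q R C p t := by
      ext φ
      simp [mem_scanSpaceZero, hf, and_comm]
    rw [← this, Submodule.finrank_map_subtype_eq]
  rw [← h1, h2, add_comm]
  congr 1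
  split_ifs with h
  · obtain ⟨φ, h3, h4⟩ := h
    have : LinearMap.range f = ⊤ := by
      rw [LinearMap.range_eq_top]
      intro c
      refine ⟨(c / φ t) • ⟨φ, h3⟩, ?_⟩
      rw [map_smul, hf, smul_eq_mul]
      field_simp
    rw [this, finrank_top, Module.finrank_self]
  · have : f = 0 := by
      ext φ
      by_contra hne
      exact h ⟨φ.1, φ.2, hne⟩
    rw [this, LinearMap.range_zero, finrank_bot]

lemma scanFree_self : ScanFree k Q R C p p ↔ ¬ C p := by
  constructor
  · rintro ⟨φ, h1, h2⟩ h3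
    exact h2 (h1.2.1 h3)
  · intro h
    refine ⟨Pi.single p 1, ⟨fun v hv => ?_, fun h' => absurd h' h, fun i h1 h2 => ?_⟩, by simp⟩
    · rw [Pi.single_eq_of_ne]
      rintro rfl
      exact hv ⟨le_rfl, le_rfl⟩
    · exact absurd (h1.trans_lt Fin.castSucc_lt_succ) (not_lt.2 h2)

lemma finrank_scanSpaceZero_self : Module.finrank k (scanSpaceZero k Q R C p p) = 0 := by
  have : scanSpaceZero k Q R C p p = ⊥ := by
    rw [eq_bot_iff]
    rintro φ ⟨h1, h2⟩
    rw [Submodule.mem_bot]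
    ext v
    by_cases hv : v = p
    · rw [hv]
      exact h2
    · exact h1.1 v fun h => hv (le_antisymm h.2 h.1)
  rw [this, finrank_bot]

/-- The update at i+1 is needed because a section up to i vanishes, by convention, beyond i. -/
lemma mem_scanSpace_succ_iff {i : Fin n} (hp : p ≤ i.castSucc) {φ : Fin (n + 1) → k} :
    φ ∈ scanSpace k Q R C p i.succ ↔
      Function.update φ i.succ 0 ∈ scanSpace k Q R C p i.castSucc ∧
        ScanRel Q R C i (φ i.castSucc) (φ i.succ) := by
  have hne : p ≠ i.succ := (hp.trans_lt Fin.castSucc_lt_succ).ne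
  have hup : ∀ j : Fin n, j.succ ≤ i.castSucc → Function.update φ i.succ 0 j.castSucc = φ j.castSucc ∧
      Function.update φ i.succ 0 j.succ = φ j.succ := by
    intro j hj
    constructor
    · rw [Function.update_of_ne]
      exact ((Fin.castSucc_lt_succ.trans_le hj).trans Fin.castSucc_lt_succ).ne
    · rw [Function.update_of_ne]
      exact (hj.trans_lt Fin.castSucc_lt_succ).ne
  constructor
  · rintro ⟨h1, h2, h3⟩
    refine ⟨⟨fun v hv => ?_, fun hc => ?_, fun j hj hj' => ?_⟩, h3 i hp le_rfl⟩
    · by_cases hv' : v = i.succ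
      · rw [hv', Function.update_self]
      · rw [Function.update_of_ne hv', h1 v]
        rintro ⟨h4, h5⟩
        refine hv ⟨h4, ?_⟩
        simp only [Fin.le_def, Fin.val_succ, Fin.val_castSucc, Fin.ext_iff] at *
        omega
    · rw [Function.update_of_ne hne, h2 hc]
    · rw [(hup j hj').1, (hup j hj').2]
      exact h3 j hj (hj'.trans Fin.castSucc_lt_succ.le)
  · rintro ⟨⟨h1, h2, h3⟩, h4⟩
    refine ⟨fun v hv => ?_, fun hc => ?_, fun j hj hj' => ?_⟩
    · have hv' : v ≠ i.succ := by
        rintro rfl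
        exact hv ⟨hp.trans Fin.castSucc_lt_succ.le, le_rfl⟩
      have := h1 v fun h => hv ⟨h.1, h.2.trans Fin.castSucc_lt_succ.le⟩
      rwa [Function.update_of_ne hv'] at this
    · have := h2 hc
      rwa [Function.update_of_ne hne] at this
    · rcases eq_or_ne j i with rfl | hji
      · exact h4
      · have hj'' : j.succ ≤ i.castSucc := by
          simp only [Fin.le_def, Fin.val_succ, Fin.val_castSucc, Fin.ext_iff, ne_eq] at *
          omega
        have := h3 j hj hj''
        rwa [(hup j hj'').1, (hup j hj'').2] at this

lemma mem_scanSpaceZero_succ_iff {i : Fin n} (hp : p ≤ i.castSucc) {φ : Fin (n + 1) → k} :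
    φ ∈ scanSpaceZero k Q R C p i.succ ↔
      φ ∈ scanSpace k Q R C p i.castSucc ∧ ScanRel Q R C i (φ i.castSucc) 0 := by
  rw [mem_scanSpaceZero, mem_scanSpace_succ_iff hp]
  constructor
  · rintro ⟨⟨h1, h2⟩, h3⟩
    rw [h3] at h2
    rw [← h3, Function.update_eq_self] at h1
    exact ⟨h1, h2⟩
  · rintro ⟨h1, h2⟩
    have h3 : φ i.succ = 0 := h1.1 _ fun h => absurd h.2 (not_le.2 Fin.castSucc_lt_succ)
    rw [h3]
    refine ⟨⟨?_, h2⟩, rfl⟩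
    rwa [← h3, Function.update_eq_self]

open Classical in
-- With end value t = 0 the relation at the arrow either leaves s arbitrary or forces s = 0.
lemma finrank_scanSpaceZero_succ {i : Fin n} (hp : p ≤ i.castSucc) :
    Module.finrank k (scanSpaceZero k Q R C p i.succ) =
      if R i.castSucc ∧ (Q i = Dir.right ∨ ¬ C i.succ) then
        Module.finrank k (scanSpace k Q R C p i.castSucc)
      else Module.finrank k (scanSpaceZero k Q R C p i.castSucc) := by
  split_ifs with h
  · have : scanSpaceZero k Q R C p i.succ = scanSpace k Q R C p i.castSucc := by
      ext φ
      rw [mem_scanSpaceZero_succ_iff hp, and_iff_left_iff_imp]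
      intro _
      refine ⟨fun _ => ⟨fun h' => absurd h.1 h', fun _ => rfl⟩,
        fun hl => ⟨fun h' => absurd h.1 h', fun hc => ?_⟩⟩
      rcases h.2 with h' | h'
      · rw [hl] at h'
        cases h'
      · exact absurd hc h'
    rw [this]
  · have : scanSpaceZero k Q R C p i.succ = scanSpaceZero k Q R C p i.castSucc := by
      ext φ
      rw [mem_scanSpaceZero_succ_iff hp, mem_scanSpaceZero]
      refine and_congr_right fun _ => ⟨fun h' => ?_, fun h' => ?_⟩
      · rcases Dir.eq_left_or_right (Q i) with hi | hi
        · by_cases hR : R i.castSucc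
          · refine ((h'.2 hi).2 ?_).symm
            by_contra hC
            exact h ⟨hR, Or.inr hC⟩
          · exact (h'.2 hi).1 hR
        · exact (h'.1 hi).1 fun hR => h ⟨hR, Or.inl hi⟩
      · rw [h']
        exact ⟨fun _ => ⟨fun _ => rfl, fun _ => rfl⟩, fun _ => ⟨fun _ => rfl, fun _ => rfl⟩⟩
    rw [this]

/-- A nonzero value at the far end is either allowed with s = 0 or copied from a nonzero s. -/
lemma scanFree_succ_iff {i : Fin n} (hp : p ≤ i.castSucc) :
    ScanFree k Q R C p i.succ ↔
      (Q i = Dir.right ∧ ¬ C i.succ ∧ (R i.castSucc ∨ ScanFree k Q R C p i.castSucc)) ∨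
      (Q i = Dir.left ∧ (¬ C i.succ ∨ (R i.castSucc ∧ ScanFree k Q R C p i.castSucc))) := by
  have ext0 : ∀ φ ∈ scanSpace k Q R C p i.castSucc, ∀ c : k, c ≠ 0 →
      ScanRel Q R C i (φ i.castSucc) c → ScanFree k Q R C p i.succ := by
    intro φ hφ c hc hrel
    refine ⟨Function.update φ i.succ c, (mem_scanSpace_succ_iff hp).2 ⟨?_, ?_⟩, by simpa⟩
    · have h3 : φ i.succ = 0 := hφ.1 _ fun h => absurd h.2 (not_le.2 Fin.castSucc_lt_succ)
      rw [Function.update_idem, ← h3, Function.update_eq_self]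
      exact hφ
    · rwa [Function.update_self, Function.update_of_ne (Fin.castSucc_lt_succ).ne]
  constructor
  · rintro ⟨φ, hφ, h0⟩
    rw [mem_scanSpace_succ_iff hp] at hφ
    obtain ⟨h1, h2⟩ := hφ
    have hfree : φ i.castSucc = φ i.succ → ScanFree k Q R C p i.castSucc := by
      intro h
      refine ⟨_, h1, ?_⟩
      rwa [Function.update_of_ne (Fin.castSucc_lt_succ).ne, h]
    rcases Dir.eq_left_or_right (Q i) with hi | hi
    · right
      refine ⟨hi, ?_⟩
      by_cases hC : C i.succ
      · right
        have h3 := (h2.2 hi).2 hC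
        refine ⟨?_, hfree h3.symm⟩
        by_contra hR
        exact h0 (h3.trans ((h2.2 hi).1 hR))
      · exact Or.inl hC
    · left
      refine ⟨hi, fun hC => h0 ((h2.1 hi).2 hC), ?_⟩
      by_cases hR : R i.castSucc
      · exact Or.inl hR
      · exact Or.inr (hfree ((h2.1 hi).1 hR))
  · rintro (⟨hi, hC, hR | ⟨φ, h1, h2⟩⟩ | ⟨hi, hC | ⟨hR, φ, h1, h2⟩⟩)
    · refine ext0 0 (Submodule.zero_mem _) 1 one_ne_zero ⟨fun _ => ?_, fun h => ?_⟩
      · exact ⟨fun h => absurd hR h, fun h => absurd h hC⟩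
      · rw [hi] at h
        cases h
    · refine ext0 φ h1 _ h2 ⟨fun _ => ⟨fun _ => rfl, fun h => absurd h hC⟩, fun h => ?_⟩
      rw [hi] at h
      cases h
    · refine ext0 0 (Submodule.zero_mem _) 1 one_ne_zero ⟨fun h => ?_, fun _ => ?_⟩
      · rw [hi] at h
        cases h
      · exact ⟨fun _ => rfl, fun h => absurd h hC⟩
    · refine ext0 φ h1 _ h2 ⟨fun h => ?_, fun _ => ⟨fun h => absurd hR h, fun _ => rfl⟩⟩
      rw [hi] at h
      cases h

open Classical in
/-- The arrows between `p` and `t` that impose no relation on the coordinates at their ends. -/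
noncomputable def freeArrows (R C : Fin (n + 1) → Prop) (p t : Fin (n + 1)) : Finset (Fin n) :=
  Finset.univ.filter fun i => p ≤ i.castSucc ∧ i.succ ≤ t ∧ R i.castSucc ∧ ¬ C i.succ

open Classical in
lemma card_freeArrows_self : (freeArrows R C p p).card = 0 := by
  rw [Finset.card_eq_zero, freeArrows, Finset.filter_eq_empty_iff]
  rintro i - ⟨h1, h2, -⟩
  exact absurd (h1.trans_lt Fin.castSucc_lt_succ) (not_lt.2 h2)

open Classical in
lemma card_freeArrows_succ {i : Fin n} (hp : p ≤ i.castSucc) :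
    (freeArrows R C p i.succ).card =
      (freeArrows R C p i.castSucc).card + if R i.castSucc ∧ ¬ C i.succ then 1 else 0 := by
  have hle : ∀ j : Fin n, j.succ ≤ i.succ ↔ j = i ∨ j.succ ≤ i.castSucc := by
    intro j
    simp only [Fin.le_def, Fin.val_succ, Fin.val_castSucc, Fin.ext_iff]
    omega
  have hni : i ∉ freeArrows R C p i.castSucc := by
    simp [freeArrows]
  split_ifs with h
  · rw [← Finset.card_insert_of_notMem hni]
    congr 1
    ext j
    simp only [freeArrows, Finset.mem_filter, Finset.mem_univ, true_and, Finset.mem_insert, hle]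
    constructor
    · tauto
    · rintro (rfl | h')
      · tauto
      · tauto
  · rw [add_zero]
    congr 1
    ext j
    simp only [freeArrows, Finset.mem_filter, Finset.mem_univ, true_and, hle]
    constructor
    · rintro ⟨h1, rfl | h2, h3⟩
      · exact absurd h3 h
      · exact ⟨h1, h2, h3⟩
    · tauto

/-- The order properties of the block rows `R` and block columns `C` of a southwest submatrix. -/
structure IsSouthwest (Q : Fin n → Dir) (R C : Fin (n + 1) → Prop) : Prop where
  row_left : ∀ i q, R q → i.castSucc ≤ q → Q i = Dir.left → R i.castSucc
  row_right : ∀ i q, ¬ R q → i.castSucc ≤ q → Q i = Dir.right → ¬ R i.castSucc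
  col_left : ∀ i p, C p → p ≤ i.succ → Q i = Dir.left → C i.succ
  col_right : ∀ i p, ¬ C p → p ≤ i.succ → Q i = Dir.right → ¬ C i.succ

open Classical in
-- Since q ∈ R, all left arrows before q have their row in R; the columns of right or left arrows
-- are similarly controlled by whether p ∈ C. The only arrow that could lose a dimension is a right
-- one with i ∉ R and i+1 ∈ C, which kills a nonzero value at i. The last two clauses exclude this:
-- if p ∉ C, then i+1 ∉ C; if p ∈ C, a nonzero value stems from an earlier right arrow with row in
-- R, and this puts i in R.
lemma finrank_scanSpace_of_row (hRC : IsSouthwest Q R C) {q : Fin (n + 1)} (hq : R q)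
    (t : Fin (n + 1)) (hp : p ≤ t) (ht : t ≤ q) :
    Module.finrank k (scanSpace k Q R C p t) =
      (freeArrows R C p t).card + (if C p then 0 else 1) ∧
    (¬ C p → ScanFree k Q R C p t) ∧
    (C p → ScanFree k Q R C p t → ∃ i : Fin n, i.castSucc < t ∧ Q i = Dir.right ∧
      R i.castSucc) := by
  have base : Module.finrank k (scanSpace k Q R C p p) =
      (freeArrows R C p p).card + (if C p then 0 else 1) ∧
    (¬ C p → ScanFree k Q R C p p) ∧
    (C p → ScanFree k Q R C p p → ∃ i : Fin n, i.castSucc < p ∧ Q i = Dir.right ∧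
      R i.castSucc) := by
    rw [finrank_scanSpace, finrank_scanSpaceZero_self, card_freeArrows_self, scanFree_self]
    refine ⟨by simp, fun h => h, fun h h' => absurd h h'⟩
  induction t using Fin.induction with
  | zero =>
    obtain rfl : p = 0 := Fin.le_zero_iff.1 hp
    exact base
  | succ i ih =>
    rcases hp.eq_or_lt with rfl | hlt
    · exact base
    have hp' : p ≤ i.castSucc := by
      simp only [Fin.le_def, Fin.lt_def, Fin.val_succ, Fin.val_castSucc] at *
      omega
    obtain ⟨h1, h2, h3⟩ := ih hp' (Fin.castSucc_lt_succ.le.trans ht)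
    have h4 := finrank_scanSpace (k := k) (Q := Q) (R := R) (C := C) (p := p) i.castSucc
    have hR := hRC.row_left i q hq (Fin.castSucc_lt_succ.le.trans ht)
    have hCl := hRC.col_left i p
    have hCr := hRC.col_right i p
    have hRr : ∀ j : Fin n, j.castSucc < i.castSucc → Q j = Dir.right → R j.castSucc →
        R i.castSucc := by
      intro j hj hj' hRj
      by_contra hne
      exact hRC.row_right j i.castSucc hne hj.le hj' hRj
    have hs := scanFree_succ_iff (k := k) (Q := Q) (R := R) (C := C) hp'
    have hlt' : i.castSucc < i.succ := Fin.castSucc_lt_succ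
    rw [finrank_scanSpace, finrank_scanSpaceZero_succ hp', card_freeArrows_succ hp']
    rw [h4] at h1 ⊢
    generalize Module.finrank k (scanSpaceZero k Q R C p i.castSucc) = b at h1 ⊢
    generalize (freeArrows R C p i.castSucc).card = N at h1 ⊢
    rcases Dir.eq_left_or_right (Q i) with hQ | hQ
    · simp only [hQ, reduceCtorEq, false_and, false_or, true_and] at hs hR hCl ⊢
      grind
    · simp only [hQ, reduceCtorEq, false_and, or_false, true_and, true_or] at hs hCr ⊢
      grind

open Classical in
-- The complementary case, where right arrows have their row outside R and the final value must
-- vanish. The dangerous arrow is now a left one with i ∈ R and i+1 ∉ C reached without a nonzero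
-- value, since it would be counted but add nothing; the last clause traces this back to an earlier
-- left arrow with row outside R, which contradicts i ∈ R.
lemma finrank_scanSpaceZero_of_not_row (hRC : IsSouthwest Q R C) {q : Fin (n + 1)} (hq : ¬ R q)
    (t : Fin (n + 1)) (hp : p ≤ t) (ht : t ≤ q) :
    Module.finrank k (scanSpaceZero k Q R C p t) = (freeArrows R C p t).card ∧
    (C p → ¬ ScanFree k Q R C p t) ∧
    (¬ C p → ¬ ScanFree k Q R C p t → ∃ i : Fin n, i.castSucc < t ∧ Q i = Dir.left ∧
      ¬ R i.castSucc) := by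
  have base : Module.finrank k (scanSpaceZero k Q R C p p) = (freeArrows R C p p).card ∧
    (C p → ¬ ScanFree k Q R C p p) ∧
    (¬ C p → ¬ ScanFree k Q R C p p → ∃ i : Fin n, i.castSucc < p ∧ Q i = Dir.left ∧
      ¬ R i.castSucc) := by
    rw [finrank_scanSpaceZero_self, card_freeArrows_self, scanFree_self]
    exact ⟨rfl, fun h h' => h' h, fun h h' => absurd h h'⟩
  induction t using Fin.induction with
  | zero =>
    obtain rfl : p = 0 := Fin.le_zero_iff.1 hp
    exact base
  | succ i ih =>
    rcases hp.eq_or_lt with rfl | hlt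
    · exact base
    have hp' : p ≤ i.castSucc := by
      simp only [Fin.le_def, Fin.lt_def, Fin.val_succ, Fin.val_castSucc] at *
      omega
    obtain ⟨h1, h2, h3⟩ := ih hp' (Fin.castSucc_lt_succ.le.trans ht)
    have h4 := finrank_scanSpace (k := k) (Q := Q) (R := R) (C := C) (p := p) i.castSucc
    have hR := hRC.row_right i q hq (Fin.castSucc_lt_succ.le.trans ht)
    have hCl := hRC.col_left i p
    have hCr := hRC.col_right i p
    have hRl : ∀ j : Fin n, j.castSucc < i.castSucc → Q j = Dir.left → ¬ R j.castSucc →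
        ¬ R i.castSucc := by
      intro j hj hj' hRj hne
      exact hRj (hRC.row_left j i.castSucc hne hj.le hj')
    have hs := scanFree_succ_iff (k := k) (Q := Q) (R := R) (C := C) hp'
    have hlt' : i.castSucc < i.succ := Fin.castSucc_lt_succ
    rw [finrank_scanSpaceZero_succ hp', card_freeArrows_succ hp', h4]
    generalize Module.finrank k (scanSpaceZero k Q R C p i.castSucc) = b at h1 ⊢
    generalize (freeArrows R C p i.castSucc).card = N at h1 ⊢
    rcases Dir.eq_left_or_right (Q i) with hQ | hQ
    · simp only [hQ, reduceCtorEq, false_and, false_or, true_and] at hs hCl ⊢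
      grind
    · simp only [hQ, reduceCtorEq, false_and, or_false, true_and, true_or] at hs hR hCr ⊢
      grind

open Classical in
-- A section of I_{pq} is a scalar function on [p, q]. The conditions on the arrows just outside, or
-- at the ends of the quiver, become the boundary conditions φ(p) = 0 if p ∈ C and φ(q) = 0 if q ∉
-- R, whichever way these arrows point.
lemma finrank_partialSections_intervalRep (hRC : IsSouthwest Q R C) {q : Fin (n + 1)}
    (hpq : p ≤ q) :
    Module.finrank k (partialSections (intervalRep k Q p q) (zetaLinks Q R C)
      (zetaZeros Q R C)) = (freeArrows R C p q).card + if R q ∧ ¬ C p then 1 else 0 := by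
  let S := scanSpace k Q R C p q ⊓
    LinearMap.ker (if R q then 0 else (LinearMap.proj q : (Fin (n + 1) → k) →ₗ[k] k))
  have hS : ∀ φ, φ ∈ S ↔ φ ∈ scanSpace k Q R C p q ∧ (¬ R q → φ q = 0) := by
    intro φ
    by_cases h : R q <;> simp [S, h]
  have hfin : Module.finrank k S = (freeArrows R C p q).card + if R q ∧ ¬ C p then 1 else 0 := by
    by_cases h : R q
    · have : S = scanSpace k Q R C p q := by simp [S, h]
      rw [this, (finrank_scanSpace_of_row hRC h q hpq le_rfl).1]
      by_cases hC : C p <;> simp [h, hC]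
    · have : S = scanSpaceZero k Q R C p q := by simp [S, h, scanSpaceZero]
      rw [this, (finrank_scanSpaceZero_of_not_row hRC h q hpq le_rfl).1]
      simp [h]
  rw [← hfin]
  let ext : (∀ v, PLift (p ≤ v ∧ v ≤ q) → k) → Fin (n + 1) → k :=
    fun h v => if hv : p ≤ v ∧ v ≤ q then h v ⟨hv⟩ else 0
  have hext : ∀ h v (a : PLift (p ≤ v ∧ v ≤ q)), ext h v = h v a := by
    rintro h v ⟨hv⟩
    simp [ext, hv]
  have hext0 : ∀ h v, ¬ (p ≤ v ∧ v ≤ q) → ext h v = 0 := by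
    intro h v hv
    simp [ext, hv]
  have hvec : ∀ h {x y} (a : Arrow Q x y) (b : PLift (p ≤ x ∧ x ≤ q)),
      (h y ᵥ* intervalRep k Q p q a) b = ext h y := by
    intro h x y a b
    by_cases hy : p ≤ y ∧ y ≤ q
    · simp only [Matrix.vecMul, dotProduct, intervalRep, Matrix.of_apply, mul_one]
      rw [Fintype.sum_eq_single (⟨hy⟩ : PLift (p ≤ y ∧ y ≤ q)), hext]
      exact fun c hc => absurd (Subsingleton.elim _ _) hc
    · rw [hext0 h y hy]
      simp only [Matrix.vecMul, dotProduct]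
      exact Finset.sum_eq_zero fun c _ => absurd c.down hy
  have hmem : ∀ h : ∀ v, PLift (p ≤ v ∧ v ≤ q) → k,
      h ∈ partialSections (intervalRep k Q p q) (zetaLinks Q R C) (zetaZeros Q R C) ↔
        ext h ∈ S := by
    intro h
    have hzero : ∀ v, h v = 0 ↔ ext h v = 0 := by
      intro v
      constructor
      · intro h0
        by_cases hv : p ≤ v ∧ v ≤ q
        · rw [hext h v ⟨hv⟩, h0]
          rfl
        · exact hext0 h v hv
      · intro h0
        funext a
        rw [← hext h v a, h0]
        rfl
    have harr : ∀ {x y} (a : Arrow Q x y), h x = h y ᵥ* intervalRep k Q p q a ↔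
        ((p ≤ x ∧ x ≤ q) → ext h x = ext h y) := by
      intro x y a
      constructor
      · intro h1 hx
        rw [hext h x ⟨hx⟩, ← hvec h a ⟨hx⟩, ← h1]
      · intro h1
        funext b
        rw [hvec, ← h1 b.down, hext h x b]
    rw [hS, mem_partialSections_zeta_iff]
    simp only [harr, hzero]
    generalize hφ : ext h = φ
    have hφ0 : ∀ v, ¬ (p ≤ v ∧ v ≤ q) → φ v = 0 := fun v hv => hφ ▸ hext0 h v hv
    constructor
    · rintro ⟨h1, h2, h3, h4⟩
      refine ⟨⟨hφ0, fun hC => ?_, fun i hi hi' => ⟨fun hQ => ⟨fun hR => ?_, (h1 i hQ).2⟩,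
        fun hQ => ⟨(h2 i hQ).1, fun hC => ?_⟩⟩⟩, fun hR => ?_⟩
      · rcases Fin.eq_zero_or_eq_succ p with rfl | ⟨i, rfl⟩
        · exact h4 hC
        · rcases Dir.eq_left_or_right (Q i) with hQ | hQ
          · rw [(h2 i hQ).2 hC ⟨le_rfl, hpq⟩]
            exact hφ0 _ fun h => absurd h.1 (not_le.2 Fin.castSucc_lt_succ)
          · exact (h1 i hQ).2 hC
      · exact (h1 i hQ).1 hR ⟨hi, Fin.castSucc_lt_succ.le.trans hi'⟩
      · exact (h2 i hQ).2 hC ⟨hi.trans Fin.castSucc_lt_succ.le, hi'⟩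
      · rcases Fin.eq_castSucc_or_eq_last q with ⟨i, rfl⟩ | rfl
        · rcases Dir.eq_left_or_right (Q i) with hQ | hQ
          · exact (h2 i hQ).1 hR
          · rw [(h1 i hQ).1 hR ⟨hpq, le_rfl⟩]
            exact hφ0 _ fun h => absurd h.2 (not_le.2 Fin.castSucc_lt_succ)
        · exact h3 hR
    · rintro ⟨⟨-, h1, h2⟩, h3⟩
      have hcase : ∀ i : Fin n, (p ≤ i.castSucc ∧ i.succ ≤ q) ∨ i.castSucc < p ∨
          q ≤ i.castSucc := by
        intro i
        simp only [Fin.le_def, Fin.lt_def, Fin.val_succ, Fin.val_castSucc]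
        omega
      have hcs : ∀ i : Fin n, i.castSucc < p → φ i.castSucc = 0 :=
        fun i hi => hφ0 _ fun h => absurd h.1 (not_le.2 hi)
      have hsc : ∀ i : Fin n, q ≤ i.castSucc → φ i.succ = 0 :=
        fun i hi => hφ0 _ fun h => absurd h.2 (not_le.2 (hi.trans_lt Fin.castSucc_lt_succ))
      have hcs' : ∀ i : Fin n, q ≤ i.castSucc → ¬ R i.castSucc → φ i.castSucc = 0 := by
        intro i hi hR
        rcases hi.eq_or_lt with h | h
        · rw [← h]
          exact h3 (h ▸ hR)
        · exact hφ0 _ fun h' => absurd h'.2 (not_le.2 h)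
      have hsc' : ∀ i : Fin n, i.castSucc < p → C i.succ → φ i.succ = 0 := by
        intro i hi hC
        by_cases h : i.succ = p
        · rw [h]
          exact h1 (h ▸ hC)
        · refine hφ0 _ fun h' => ?_
          have := h'.1
          simp only [Fin.le_def, Fin.lt_def, Fin.ext_iff, Fin.val_succ, Fin.val_castSucc] at *
          omega
      refine ⟨fun i hQ => ⟨fun hR hv => ?_, fun hC => ?_⟩,
        fun i hQ => ⟨fun hR => ?_, fun hC hv => ?_⟩, fun hR => ?_, fun hC => ?_⟩
      · rcases hcase i with h | h | h
        · exact ((h2 i h.1 h.2).1 hQ).1 hR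
        · exact absurd hv.1 (not_le.2 h)
        · rw [hsc i h, hcs' i h hR]
      · rcases hcase i with h | h | h
        · exact ((h2 i h.1 h.2).1 hQ).2 hC
        · exact hsc' i h hC
        · exact hsc i h
      · rcases hcase i with h | h | h
        · exact ((h2 i h.1 h.2).2 hQ).1 hR
        · exact hcs i h
        · exact hcs' i h hR
      · rcases hcase i with h | h | h
        · exact ((h2 i h.1 h.2).2 hQ).2 hC
        · rw [hcs i h, hsc' i h hC]
        · exact absurd hv.2 (not_le.2 (h.trans_lt Fin.castSucc_lt_succ))
      · rcases (Fin.le_last q).eq_or_lt with h | h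
        · rw [← h]
          exact h3 (h ▸ hR)
        · exact hφ0 _ fun h' => absurd h'.2 (not_le.2 h)
      · rcases (Fin.zero_le p).eq_or_lt with h | h
        · rw [h]
          exact h1 (h ▸ hC)
        · exact hφ0 _ fun h' => absurd h'.1 (not_le.2 h)
  refine LinearEquiv.finrank_eq
    { toFun := fun h => ⟨ext h.1, (hmem h.1).1 h.2⟩
      map_add' := fun g h => ?_
      map_smul' := fun c h => ?_
      invFun := fun φ => ⟨fun v _ => φ.1 v, (hmem _).2 ?_⟩
      left_inv := fun h => ?_
      right_inv := fun φ => ?_ }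
  · refine Subtype.ext (funext fun v => ?_)
    by_cases hv : p ≤ v ∧ v ≤ q <;> simp [ext, hv]
  · refine Subtype.ext (funext fun v => ?_)
    by_cases hv : p ≤ v ∧ v ≤ q <;> simp [ext, hv]
  · convert φ.2 using 1
    funext v
    by_cases hv : p ≤ v ∧ v ≤ q
    · simp [ext, hv]
    · exact (hext0 (fun v _ => φ.1 v) v hv).trans (((hS _).1 φ.2).1.1 v hv).symm
  · refine Subtype.ext (funext fun v => funext fun a => ?_)
    exact hext h.1 v a
  · refine Subtype.ext (funext fun v => ?_)
    by_cases hv : p ≤ v ∧ v ≤ q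
    · simp [ext, hv]
    · exact (hext0 _ v hv).trans (((hS _).1 φ.2).1.1 v hv).symm

end Scan

/-! ### The order of the block rows and block columns -/

section Order

lemma idxOf_le_idxOf_iff {α : Type*} [DecidableEq α] {l : List α} {f : α → ℕ}
    (hl : l.Pairwise fun u v => f u < f v) {u v : α} (hu : u ∈ l) (hv : v ∈ l) :
    l.idxOf u ≤ l.idxOf v ↔ f u ≤ f v := by
  have hlt : ∀ {u v : α}, u ∈ l → v ∈ l → l.idxOf u < l.idxOf v → f u < f v := by
    intro u v hu hv h
    have := List.pairwise_iff_getElem.1 hl _ _ (List.idxOf_lt_length_of_mem hu)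
      (List.idxOf_lt_length_of_mem hv) h
    simpa using this
  constructor
  · intro h
    rcases h.lt_or_eq with h | h
    · exact (hlt hu hv h).le
    · rw [List.idxOf_inj hu] at h
      rw [h]
  · intro h
    by_contra hne
    exact absurd (hlt hv hu (not_le.1 hne)) (not_lt.2 h)

/-- A key for the order of the block rows. -/
def rowKey (Q : Fin n → Dir) : Fin (n + 1) → ℕ :=
  -- Right arrows use the values below n, the last vertex n, and left arrows the values from n+2 to
  -- 2n+1 in reversed order.
  Fin.lastCases n fun i => if Q i = Dir.right then (i : ℕ) else 2 * n + 1 - i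

/-- A key for the order of the block columns. -/
def colKey (Q : Fin n → Dir) : Fin (n + 1) → ℕ :=
  -- Left arrows use the values below n in reversed order, the first vertex n, and right arrows the
  -- values above n. The subtraction is exact because i < n.
  Fin.cases n fun i => if Q i = Dir.right then n + 1 + (i : ℕ) else n - 1 - i

lemma rowKey_last : rowKey Q (Fin.last n) = n := by simp [rowKey]

lemma rowKey_castSucc (i : Fin n) :
    rowKey Q i.castSucc = if Q i = Dir.right then (i : ℕ) else 2 * n + 1 - i := by simp [rowKey]

lemma colKey_zero : colKey Q 0 = n := by simp [colKey]

lemma colKey_succ (i : Fin n) :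
    colKey Q i.succ = if Q i = Dir.right then n + 1 + (i : ℕ) else n - 1 - i := by simp [colKey]

lemma pairwise_rowSeq (Q : Fin n → Dir) :
    (rowSeq Q).Pairwise fun u v => rowKey Q u < rowKey Q v := by
  have hlt := List.pairwise_lt_finRange n
  rw [rowSeq, List.pairwise_append, List.pairwise_append]
  refine ⟨⟨?_, by simp, ?_⟩, ?_, ?_⟩
  · rw [List.pairwise_map]
    refine List.Pairwise.imp_of_mem ?_ (hlt.filter _)
    intro i j hi hj hij
    simp only [List.mem_filter, decide_eq_true_eq] at hi hj
    simpa [rowKey_castSucc, hi.2, hj.2] using hij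
  · intro u hu v hv
    simp only [List.mem_map, List.mem_filter, decide_eq_true_eq, List.mem_singleton] at hu hv
    obtain ⟨i, hi, rfl⟩ := hu
    rw [hv, rowKey_castSucc, if_pos hi.2, rowKey_last]
    exact i.2
  · rw [List.pairwise_reverse, List.pairwise_map]
    refine List.Pairwise.imp_of_mem ?_ (hlt.filter _)
    intro i j hi hj hij
    simp only [List.mem_filter, decide_eq_true_eq] at hi hj
    rw [Fin.lt_def] at hij
    simp [rowKey_castSucc, hi.2, hj.2]
    omega
  · intro u hu v hv
    simp only [List.mem_append, List.mem_reverse, List.mem_map, List.mem_filter,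
      decide_eq_true_eq, List.mem_singleton] at hu hv
    obtain ⟨j, hj, rfl⟩ := hv
    rw [rowKey_castSucc, if_neg (by simp [hj.2])]
    rcases hu with ⟨i, hi, rfl⟩ | rfl
    · rw [rowKey_castSucc, if_pos hi.2]
      omega
    · rw [rowKey_last]
      omega

lemma mem_rowSeq (Q : Fin n → Dir) (v : Fin (n + 1)) : v ∈ rowSeq Q := by
  rcases Fin.eq_castSucc_or_eq_last v with ⟨i, rfl⟩ | rfl
  · rcases Dir.eq_left_or_right (Q i) with hi | hi <;> simp [rowSeq, hi]
  · simp [rowSeq]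

lemma pairwise_colSeq (Q : Fin n → Dir) :
    (colSeq Q).Pairwise fun u v => colKey Q u < colKey Q v := by
  have hlt := List.pairwise_lt_finRange n
  rw [colSeq, List.pairwise_append, List.pairwise_append]
  refine ⟨⟨?_, by simp, ?_⟩, ?_, ?_⟩
  · rw [List.pairwise_reverse, List.pairwise_map]
    refine List.Pairwise.imp_of_mem ?_ (hlt.filter _)
    intro i j hi hj hij
    simp only [List.mem_filter, decide_eq_true_eq] at hi hj
    rw [Fin.lt_def] at hij
    simp [colKey_succ, hi.2, hj.2]
    omega
  · intro u hu v hv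
    simp only [List.mem_reverse, List.mem_map, List.mem_filter, decide_eq_true_eq,
      List.mem_singleton] at hu hv
    obtain ⟨i, hi, rfl⟩ := hu
    rw [hv, colKey_succ, if_neg (by simp [hi.2]), colKey_zero]
    omega
  · rw [List.pairwise_map]
    refine List.Pairwise.imp_of_mem ?_ (hlt.filter _)
    intro i j hi hj hij
    simp only [List.mem_filter, decide_eq_true_eq] at hi hj
    simpa [colKey_succ, hi.2, hj.2] using hij
  · intro u hu v hv
    simp only [List.mem_append, List.mem_reverse, List.mem_map, List.mem_filter,
      decide_eq_true_eq, List.mem_singleton] at hu hv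
    obtain ⟨j, hj, rfl⟩ := hv
    rw [colKey_succ, if_pos hj.2]
    rcases hu with ⟨i, hi, rfl⟩ | rfl
    · rw [colKey_succ, if_neg (by simp [hi.2])]
      omega
    · rw [colKey_zero]
      omega

lemma mem_colSeq (Q : Fin n → Dir) (v : Fin (n + 1)) : v ∈ colSeq Q := by
  rcases Fin.eq_zero_or_eq_succ v with rfl | ⟨i, rfl⟩
  · simp [colSeq]
  · rcases Dir.eq_left_or_right (Q i) with hi | hi <;> simp [colSeq, hi]

lemma rowPos_le_iff {u v : Fin (n + 1)} : rowPos Q u ≤ rowPos Q v ↔ rowKey Q u ≤ rowKey Q v :=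
  idxOf_le_idxOf_iff (pairwise_rowSeq Q) (mem_rowSeq Q u) (mem_rowSeq Q v)

lemma colPos_le_iff {u v : Fin (n + 1)} : colPos Q u ≤ colPos Q v ↔ colKey Q u ≤ colKey Q v :=
  idxOf_le_idxOf_iff (pairwise_colSeq Q) (mem_colSeq Q u) (mem_colSeq Q v)

lemma rowPos_injective (Q : Fin n → Dir) : Function.Injective (rowPos Q) :=
  fun u _ h => (List.idxOf_inj (mem_rowSeq Q u)).1 h

lemma colPos_injective (Q : Fin n → Dir) : Function.Injective (colPos Q) :=
  fun u _ h => (List.idxOf_inj (mem_colSeq Q u)).1 h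

lemma nodup_rowSeq (Q : Fin n → Dir) : (rowSeq Q).Nodup :=
  (pairwise_rowSeq Q).imp fun {_ _} h h' => h.ne (congrArg _ h')

lemma nodup_colSeq (Q : Fin n → Dir) : (colSeq Q).Nodup :=
  (pairwise_colSeq Q).imp fun {_ _} h h' => h.ne (congrArg _ h')

lemma rowPos_of_south_eq_some {x x' : Fin (n + 1)} (h : south Q x = some x') :
    rowPos Q x' = rowPos Q x + 1 := by
  rw [south, List.getElem?_eq_some_iff] at h
  obtain ⟨h1, rfl⟩ := h
  exact (nodup_rowSeq Q).idxOf_getElem _ h1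

lemma rowPos_lt_of_south_eq_none {x : Fin (n + 1)} (h : south Q x = none) (v : Fin (n + 1)) :
    rowPos Q v < rowPos Q x + 1 := by
  rw [south, List.getElem?_eq_none_iff] at h
  exact (List.idxOf_lt_length_of_mem (mem_rowSeq Q v)).trans_le h

lemma colPos_of_west_eq_some {y y' : Fin (n + 1)} (h : west Q y = some y') :
    colPos Q y' + 1 = colPos Q y := by
  rw [west] at h
  split_ifs at h with h0
  rw [List.getElem?_eq_some_iff] at h
  obtain ⟨h1, rfl⟩ := h
  have : colPos Q (colSeq Q)[colPos Q y - 1] = _ := (nodup_colSeq Q).idxOf_getElem _ h1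
  omega

lemma colPos_of_west_eq_none {y : Fin (n + 1)} (h : west Q y = none) : colPos Q y = 0 := by
  rw [west] at h
  split_ifs at h with h0
  · exact h0
  · rw [List.getElem?_eq_none_iff] at h
    have : colPos Q y < (colSeq Q).length := List.idxOf_lt_length_of_mem (mem_colSeq Q y)
    omega

/-- This is what the blocking is made for: the row label of a left arrow is south, and that of a
right arrow north, of all vertices to its right; the column label of a left arrow is west, and that
of a right arrow east, of all vertices to its left. -/
lemma isSouthwest_pos (Q : Fin n → Dir) (x y : Fin (n + 1)) :
    IsSouthwest Q (fun v => rowPos Q x ≤ rowPos Q v) (fun v => colPos Q v ≤ colPos Q y) := by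
  refine ⟨fun i q h1 h2 h3 => h1.trans ?_, fun i q h1 h2 h3 h4 => h1 (h4.trans ?_),
    fun i p h1 h2 h3 => le_trans ?_ h1, fun i p h1 h2 h3 h4 => h1 (le_trans ?_ h4)⟩
  · rw [rowPos_le_iff, rowKey_castSucc, if_neg (by simp [h3])]
    rcases Fin.eq_castSucc_or_eq_last q with ⟨j, rfl⟩ | rfl
    · rw [rowKey_castSucc]
      simp only [Fin.le_def, Fin.val_castSucc] at h2
      split_ifs <;> omega
    · rw [rowKey_last]
      omega
  · rw [rowPos_le_iff, rowKey_castSucc, if_pos h3]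
    rcases Fin.eq_castSucc_or_eq_last q with ⟨j, rfl⟩ | rfl
    · rw [rowKey_castSucc]
      simp only [Fin.le_def, Fin.val_castSucc] at h2
      split_ifs <;> omega
    · rw [rowKey_last]
      omega
  · rw [colPos_le_iff, colKey_succ, if_neg (by simp [h3])]
    rcases Fin.eq_zero_or_eq_succ p with rfl | ⟨j, rfl⟩
    · rw [colKey_zero]
      omega
    · rw [colKey_succ]
      simp only [Fin.le_def, Fin.val_succ] at h2
      split_ifs <;> omega
  · rw [colPos_le_iff, colKey_succ, if_pos h3]
    rcases Fin.eq_zero_or_eq_succ p with rfl | ⟨j, rfl⟩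
    · rw [colKey_zero]
      omega
    · rw [colKey_succ]
      simp only [Fin.le_def, Fin.val_succ] at h2
      split_ifs <;> omega

end Order

/-! ### The southwest block ranks of the Zelevinsky matrix -/

section Multiplicity

/-- The multiplicity matrix of the Zelevinsky permutation. -/
def zelevinskyMult (m : Fin (n + 1) → Fin (n + 1) → ℕ) (x y : Fin (n + 1)) : ℕ :=
  if y ≤ x then m y x else if (y : ℕ) = (x : ℕ) + 1 then crossing m x y else 0

lemma sum_multIndex (m : Fin (n + 1) → Fin (n + 1) → ℕ) (f : Fin (n + 1) → Fin (n + 1) → ℕ) :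
    ∑ j : MultIndex m, f j.1.1.1 j.1.1.2 = ∑ p, ∑ q, if p ≤ q then m p q * f p q else 0 := by
  rw [Fintype.sum_sigma]
  simp only [Finset.sum_const, Finset.card_univ, Fintype.card_fin, smul_eq_mul]
  rw [← Finset.sum_subtype (Finset.univ.filter fun e : Fin (n + 1) × Fin (n + 1) => e.1 ≤ e.2)
    (by simp) (fun e => m e.1 e.2 * f e.1 e.2), Finset.sum_filter, Fintype.sum_prod_type]

/-- A vertex of [p, q] is either q or the left end of an edge inside the interval. -/
lemma card_interval_filter (R : Fin (n + 1) → Prop) [DecidablePred R] {p q : Fin (n + 1)}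
    (hpq : p ≤ q) : (∑ v, if R v ∧ p ≤ v ∧ v ≤ q then 1 else 0) =
      (∑ i : Fin n, if R i.castSucc ∧ p ≤ i.castSucc ∧ i.succ ≤ q then 1 else 0) +
        if R q then 1 else 0 := by
  rw [← Finset.card_filter, ← Finset.card_filter]
  have key : (Finset.univ.filter fun v => R v ∧ p ≤ v ∧ v ≤ q) =
      ((Finset.univ.filter fun i : Fin n => R i.castSucc ∧ p ≤ i.castSucc ∧ i.succ ≤ q).map
        Fin.castSuccEmb) ∪ if R q then {q} else ∅ := by
    ext v
    simp only [Finset.mem_filter, Finset.mem_univ, true_and, Finset.mem_union, Finset.mem_map,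
      Fin.coe_castSuccEmb]
    constructor
    · rintro ⟨h1, h2, h3⟩
      rcases h3.eq_or_lt with rfl | h3
      · right
        simp [h1]
      · left
        obtain ⟨i, rfl⟩ := Fin.exists_castSucc_eq.2 (h3.trans_le (Fin.le_last q)).ne
        exact ⟨i, ⟨h1, h2, Fin.castSucc_lt_iff_succ_le.1 h3⟩, rfl⟩
    · rintro (⟨i, ⟨h1, h2, h3⟩, rfl⟩ | h)
      · exact ⟨h1, h2, Fin.castSucc_lt_succ.le.trans h3⟩
      · split_ifs at h with hq
        · rw [Finset.mem_singleton] at h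
          subst h
          exact ⟨hq, hpq, le_rfl⟩
        · simp at h
  rw [key, Finset.card_union_of_disjoint, Finset.card_map]
  · split_ifs <;> simp
  · rw [Finset.disjoint_left]
    intro v hv hv'
    simp only [Finset.mem_filter, Finset.mem_univ, true_and, Finset.mem_map,
      Fin.coe_castSuccEmb] at hv
    obtain ⟨i, ⟨-, -, h3⟩, rfl⟩ := hv
    split_ifs at hv' with hq
    · rw [Finset.mem_singleton] at hv'
      rw [← hv'] at h3
      exact absurd h3 (not_le.2 Fin.castSucc_lt_succ)
    · simp at hv'

lemma sum_succ_eq (g : Fin (n + 1) → Fin (n + 1) → ℕ) :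
    (∑ x : Fin (n + 1), ∑ y : Fin (n + 1), if (y : ℕ) = (x : ℕ) + 1 then g x y else 0) =
      ∑ i : Fin n, g i.castSucc i.succ := by
  rw [Fin.sum_univ_castSucc]
  have h0 : (∑ y : Fin (n + 1), if (y : ℕ) = (Fin.last n : ℕ) + 1 then g (Fin.last n) y else 0) = 0 := by
    refine Finset.sum_eq_zero fun y _ => if_neg ?_
    rw [Fin.val_last]
    omega
  rw [h0, add_zero]
  refine Finset.sum_congr rfl fun i _ => ?_
  rw [Finset.sum_eq_single_of_mem i.succ (Finset.mem_univ _)]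
  · simp
  · intro y _ hy
    refine if_neg fun h => hy (Fin.ext ?_)
    simpa using h

/-- Weighted sums of the entries of the multiplicity matrix. -/
lemma sum_zelevinskyMult (m : Fin (n + 1) → Fin (n + 1) → ℕ) (R C : Fin (n + 1) → Prop)
    [DecidablePred R] [DecidablePred C] :
    (∑ x, ∑ y, if R x ∧ C y then zelevinskyMult m x y else 0) =
      ∑ p, ∑ q, if p ≤ q then m p q * ((∑ i : Fin n,
        if (R i.castSucc ∧ C i.succ) ∧ p ≤ i.castSucc ∧ i.succ ≤ q then 1 else 0) +
        if R q ∧ C p then 1 else 0) else 0 := by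
  have h1 : ∀ x y, (if R x ∧ C y then zelevinskyMult m x y else 0) =
      (if y ≤ x then m y x * (if R x ∧ C y then 1 else 0) else 0) +
        if (y : ℕ) = (x : ℕ) + 1 then (if R x ∧ C y then crossing m x y else 0) else 0 := by
    intro x y
    rw [zelevinskyMult]
    by_cases hyx : y ≤ x
    · have : ¬ (y : ℕ) = (x : ℕ) + 1 := by
        rw [Fin.le_def] at hyx
        omega
      simp [hyx, this]
    · simp only [hyx, if_false, zero_add]
      split_ifs <;> rfl
  have h2 : ∀ p q : Fin (n + 1), (if p ≤ q then m p q * ((∑ i : Fin n,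
        if (R i.castSucc ∧ C i.succ) ∧ p ≤ i.castSucc ∧ i.succ ≤ q then 1 else 0) +
        if R q ∧ C p then 1 else 0) else 0) =
      (if p ≤ q then m p q * (if R q ∧ C p then 1 else 0) else 0) +
      ∑ i : Fin n, if (R i.castSucc ∧ C i.succ) ∧ p ≤ i.castSucc ∧ i.succ ≤ q
        then m p q else 0 := by
    intro p q
    by_cases hpq : p ≤ q
    · simp only [hpq, if_true, mul_add, Finset.mul_sum]
      rw [add_comm]
      congr 1
      exact Finset.sum_congr rfl fun i _ => by split_ifs <;> simp
    · simp only [hpq, if_false, zero_add]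
      refine (Finset.sum_eq_zero fun i _ => if_neg fun h => hpq ?_).symm
      exact h.2.1.trans (Fin.castSucc_lt_succ.le.trans h.2.2)
  simp only [h1, h2, Finset.sum_add_distrib]
  congr 1
  · exact Finset.sum_comm
  · rw [sum_succ_eq fun x y => if R x ∧ C y then crossing m x y else 0]
    have h3 : ∀ p : Fin (n + 1), (∑ q, ∑ i : Fin n,
        if (R i.castSucc ∧ C i.succ) ∧ p ≤ i.castSucc ∧ i.succ ≤ q then m p q else 0) =
        ∑ i : Fin n, ∑ q,
        if (R i.castSucc ∧ C i.succ) ∧ p ≤ i.castSucc ∧ i.succ ≤ q then m p q else 0 :=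
      fun p => Finset.sum_comm
    simp only [h3]
    -- For a fixed edge i, the intervals that contain it are those with p ≤ i and i+1 ≤ q, and their
    -- multiplicities add up to `crossing`.
    rw [Finset.sum_comm]
    refine Finset.sum_congr rfl fun i _ => ?_
    rw [crossing]
    by_cases hi : R i.castSucc ∧ C i.succ
    · simp only [hi, if_true, and_self, true_and]
      rw [show Finset.Iic i.castSucc = Finset.univ.filter (· ≤ i.castSucc) by ext; simp,
        Finset.sum_filter]
      refine Finset.sum_congr rfl fun p _ => ?_
      by_cases hp : p ≤ i.castSucc
      · simp only [hp, if_true, true_and]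
        rw [show Finset.Ici i.succ = Finset.univ.filter (i.succ ≤ ·) by ext; simp,
          Finset.sum_filter]
      · simp [hp]
    · simp [hi]

variable {d : Fin (n + 1) → ℕ} {V : RepSpace k Q d} {m : Fin (n + 1) → Fin (n + 1) → ℕ}

lemma dim_eq_sum (hm : Isomorphic V (sumIntervals k Q m)) (v : Fin (n + 1)) :
    d v = ∑ p, ∑ q, if p ≤ q then m p q * (if p ≤ v ∧ v ≤ q then 1 else 0) else 0 := by
  have h := hm.card_eq v
  rw [Fintype.card_fin] at h
  rw [h, Fintype.card_sigma, ← sum_multIndex m fun p q => if p ≤ v ∧ v ≤ q then 1 else 0]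
  refine Finset.sum_congr rfl fun j _ => ?_
  split_ifs with hv
  · exact Fintype.card_eq_one_iff.2 ⟨⟨hv⟩, fun _ => rfl⟩
  · exact Fintype.card_eq_zero_iff.2 ⟨fun h => hv h.down⟩

/-- The southwest block ranks of the Zelevinsky matrix in terms of the multiplicities. -/
theorem swRank_zeta_eq_sum (hm : Isomorphic V (sumIntervals k Q m)) (x y : Fin (n + 1)) :
    swRank Q (zeta V) (some x) (some y) = ∑ x', ∑ y',
      if rowPos Q x ≤ rowPos Q x' ∧ colPos Q y' ≤ colPos Q y then zelevinskyMult m x' y' else 0 := by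
  classical
  have h := swRank_zeta_add_finrank V x y
  have hsw := isSouthwest_pos Q x y
  have h1 := sum_zelevinskyMult m (fun v => rowPos Q x ≤ rowPos Q v)
    (fun v => colPos Q v ≤ colPos Q y)
  set R : Fin (n + 1) → Prop := fun v => rowPos Q x ≤ rowPos Q v with hR
  set C : Fin (n + 1) → Prop := fun v => colPos Q v ≤ colPos Q y with hC
  rw [hm.finrank_partialSections, sumIntervals, finrank_partialSections_directSum,
    sum_multIndex m fun p q => Module.finrank k
      (partialSections (intervalRep k Q p q) (zetaLinks Q R C) (zetaZeros Q R C))] at h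
  -- The balance for one interval: every edge with its row in R has its column in C or is free, and
  -- likewise for the pair (q, p).
  have hcount : ∀ p q : Fin (n + 1), p ≤ q → (∑ v, if R v ∧ p ≤ v ∧ v ≤ q then 1 else 0) =
      ((∑ i : Fin n, if (R i.castSucc ∧ C i.succ) ∧ p ≤ i.castSucc ∧ i.succ ≤ q then 1 else 0) +
        if R q ∧ C p then 1 else 0) + Module.finrank k
      (partialSections (intervalRep k Q p q) (zetaLinks Q R C) (zetaZeros Q R C)) := by
    intro p q hpq
    rw [finrank_partialSections_intervalRep hsw hpq, card_interval_filter R hpq, freeArrows,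
      Finset.card_filter, add_add_add_comm, ← Finset.sum_add_distrib]
    congr 1
    · refine Finset.sum_congr rfl fun i _ => ?_
      by_cases hRi : R i.castSucc <;> by_cases hCi : C i.succ <;> simp [hRi, hCi]
    · by_cases hRi : R q <;> by_cases hCi : C p <;> simp [hRi, hCi]
  have hsum : (∑ v, if R v then d v else 0) =
      ∑ p, ∑ q, if p ≤ q then m p q * (∑ v, if R v ∧ p ≤ v ∧ v ≤ q then 1 else 0) else 0 := by
    have e1 : ∀ v, (if R v then d v else 0) = ∑ p, ∑ q,
        if p ≤ q then m p q * (if R v ∧ p ≤ v ∧ v ≤ q then 1 else 0) else 0 := by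
      intro v
      by_cases hv : R v
      · simp only [hv, if_true, true_and]
        exact dim_eq_sum hm v
      · simp [hv]
    simp only [e1]
    rw [Finset.sum_comm]
    refine Finset.sum_congr rfl fun p _ => ?_
    rw [Finset.sum_comm]
    refine Finset.sum_congr rfl fun q _ => ?_
    split_ifs with hpq
    · rw [Finset.mul_sum]
    · simp
  have hfin : (∑ v, if R v then d v else 0) = (∑ p, ∑ q, if p ≤ q then m p q * ((∑ i : Fin n,
        if (R i.castSucc ∧ C i.succ) ∧ p ≤ i.castSucc ∧ i.succ ≤ q then 1 else 0) +
        if R q ∧ C p then 1 else 0) else 0) + ∑ p, ∑ q, if p ≤ q then m p q * Module.finrank k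
      (partialSections (intervalRep k Q p q) (zetaLinks Q R C) (zetaZeros Q R C)) else 0 := by
    rw [hsum, ← Finset.sum_add_distrib]
    refine Finset.sum_congr rfl fun p _ => ?_
    rw [← Finset.sum_add_distrib]
    refine Finset.sum_congr rfl fun q _ => ?_
    by_cases hpq : p ≤ q
    · rw [if_pos hpq, if_pos hpq, if_pos hpq, hcount p q hpq, mul_add]
    · rw [if_neg hpq, if_neg hpq, if_neg hpq]
  rw [h1]
  exact Nat.add_right_cancel (h.trans hfin)

/-- Taking R = {x} and C everything, each interval through x is counted once: at its right end q = x
or at the edge leaving x to the right. -/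
lemma sum_zelevinskyMult_row (hm : Isomorphic V (sumIntervals k Q m)) (x : Fin (n + 1)) :
    ∑ y, zelevinskyMult m x y = d x := by
  have h := sum_zelevinskyMult m (fun v => v = x) (fun _ => True)
  rw [Finset.sum_eq_single_of_mem x (Finset.mem_univ x)] at h
  · simp only [and_self, if_true, and_true] at h
    rw [h, dim_eq_sum hm x]
    refine Finset.sum_congr rfl fun p _ => Finset.sum_congr rfl fun q _ => ?_
    by_cases h1 : p ≤ q
    · rw [if_pos h1, if_pos h1]
      have h2 := card_interval_filter (fun v => v = x) h1
      rw [← h2, Finset.sum_eq_single_of_mem x (Finset.mem_univ x)]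
      · simp
      · intro v _ hv
        simp [hv]
    · rw [if_neg h1, if_neg h1]
  · intro v _ hv
    simp [hv]

/-- Likewise, each interval through y is counted at its left end p = y or at the edge arriving at y
from the left. -/
lemma sum_zelevinskyMult_col (hm : Isomorphic V (sumIntervals k Q m)) (y : Fin (n + 1)) :
    ∑ x, zelevinskyMult m x y = d y := by
  have h := sum_zelevinskyMult m (fun _ => True) (fun v => v = y)
  rw [Finset.sum_comm, Finset.sum_eq_single_of_mem y (Finset.mem_univ y)] at h
  · simp only [and_self, if_true, true_and] at h
    rw [h, dim_eq_sum hm y]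
    refine Finset.sum_congr rfl fun p _ => Finset.sum_congr rfl fun q _ => ?_
    by_cases h1 : p ≤ q
    · rw [if_pos h1, if_pos h1]
      congr 1
      rcases Fin.eq_zero_or_eq_succ y with rfl | ⟨j, rfl⟩
      · rw [Finset.sum_eq_zero]
        · simp
        · exact fun i _ => if_neg fun h => Fin.succ_ne_zero i h.1
      · rw [Finset.sum_eq_single_of_mem j (Finset.mem_univ j)]
        · rcases lt_trichotomy p j.succ with hp | rfl | hp
          · have : p ≤ j.castSucc := by
              simp only [Fin.le_def, Fin.lt_def, Fin.val_succ, Fin.val_castSucc] at *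
              omega
            simp [this, hp.le, hp.ne]
          · simp [h1]
          · have : ¬ p ≤ j.castSucc := by
              simp only [Fin.le_def, Fin.lt_def, Fin.val_succ, Fin.val_castSucc] at *
              omega
            simp [this, not_le.2 hp, hp.ne']
        · exact fun i _ hi => if_neg fun h => hi (Fin.succ_injective _ h.1)
    · rw [if_neg h1, if_neg h1]
  · intro v _ hv
    simp [hv]

end Multiplicity

/-! ### Block counts and southwest ranks of permutation matrices -/

section Counts

variable {d : Fin (n + 1) → ℕ}

/-- The sum of the entries of `f` in the block rows from position `a` on and in the block columns
before position `b`. -/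
def southwestSum (Q : Fin n → Dir) (f : Fin (n + 1) → Fin (n + 1) → ℕ) (a b : ℕ) : ℕ :=
  ∑ x, ∑ y, if a ≤ rowPos Q x ∧ colPos Q y < b then f x y else 0

/-- Inclusion-exclusion for four corners. Working with positions instead of labels makes an
undefined neighbour S(x) or W(y) an empty region. -/
lemma southwestSum_difference (f : Fin (n + 1) → Fin (n + 1) → ℕ) (x y : Fin (n + 1)) :
    (southwestSum Q f (rowPos Q x) (colPos Q y + 1) : ℤ)
      - southwestSum Q f (rowPos Q x + 1) (colPos Q y + 1)
      - southwestSum Q f (rowPos Q x) (colPos Q y)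
      + southwestSum Q f (rowPos Q x + 1) (colPos Q y) = f x y := by
  have key : ∀ x' y' : Fin (n + 1),
      ((if rowPos Q x ≤ rowPos Q x' ∧ colPos Q y' < colPos Q y + 1 then f x' y' else 0 : ℕ) : ℤ)
      - ((if rowPos Q x + 1 ≤ rowPos Q x' ∧ colPos Q y' < colPos Q y + 1 then f x' y' else 0 :
          ℕ) : ℤ)
      - ((if rowPos Q x ≤ rowPos Q x' ∧ colPos Q y' < colPos Q y then f x' y' else 0 : ℕ) : ℤ)
      + ((if rowPos Q x + 1 ≤ rowPos Q x' ∧ colPos Q y' < colPos Q y then f x' y' else 0 :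
          ℕ) : ℤ) = if x' = x ∧ y' = y then (f x' y' : ℤ) else 0 := by
    intro x' y'
    have h1 : x' = x ↔ rowPos Q x' = rowPos Q x := (rowPos_injective Q).eq_iff.symm
    have h2 : y' = y ↔ colPos Q y' = colPos Q y := (colPos_injective Q).eq_iff.symm
    simp only [h1, h2]
    split_ifs <;> omega
  simp only [southwestSum, Nat.cast_sum]
  rw [← Finset.sum_sub_distrib, ← Finset.sum_sub_distrib, ← Finset.sum_add_distrib,
    Finset.sum_eq_single_of_mem x (Finset.mem_univ x)]
  · rw [← Finset.sum_sub_distrib, ← Finset.sum_sub_distrib, ← Finset.sum_add_distrib,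
      Finset.sum_eq_single_of_mem y (Finset.mem_univ y), key]
    · simp
    · intro y' _ hy
      rw [key, if_neg fun h => hy h.2]
  · intro x' _ hx
    rw [← Finset.sum_sub_distrib, ← Finset.sum_sub_distrib, ← Finset.sum_add_distrib]
    refine Finset.sum_eq_zero fun y' _ => ?_
    rw [key, if_neg fun h => hx h.1]

lemma southwestSum_of_row_lt (f : Fin (n + 1) → Fin (n + 1) → ℕ) {a : ℕ} (b : ℕ)
    (ha : ∀ v, rowPos Q v < a) : southwestSum Q f a b = 0 :=
  Finset.sum_eq_zero fun x _ => Finset.sum_eq_zero fun _ _ =>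
    if_neg fun h => absurd h.1 (not_le.2 (ha x))

lemma southwestSum_zero (f : Fin (n + 1) → Fin (n + 1) → ℕ) (a : ℕ) :
    southwestSum Q f a 0 = 0 :=
  Finset.sum_eq_zero fun _ _ => Finset.sum_eq_zero fun _ _ =>
    if_neg fun h => absurd h.2 (Nat.not_lt_zero _)

/-- A function of two labels is determined by its sums over southwest regions. -/
lemma eq_of_southwestSum_eq {f g : Fin (n + 1) → Fin (n + 1) → ℕ}
    (h : ∀ x y, southwestSum Q f (rowPos Q x) (colPos Q y + 1) =
      southwestSum Q g (rowPos Q x) (colPos Q y + 1)) (x y : Fin (n + 1)) : f x y = g x y := by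
  have hs : ∀ y, southwestSum Q f (rowPos Q x + 1) (colPos Q y + 1) =
      southwestSum Q g (rowPos Q x + 1) (colPos Q y + 1) := by
    intro y
    rcases hx : south Q x with _ | x'
    · rw [southwestSum_of_row_lt f _ (rowPos_lt_of_south_eq_none hx),
        southwestSum_of_row_lt g _ (rowPos_lt_of_south_eq_none hx)]
    · rw [← rowPos_of_south_eq_some hx, h]
  have hw : southwestSum Q f (rowPos Q x) (colPos Q y) =
      southwestSum Q g (rowPos Q x) (colPos Q y) ∧
      southwestSum Q f (rowPos Q x + 1) (colPos Q y) =
      southwestSum Q g (rowPos Q x + 1) (colPos Q y) := by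
    rcases hy : west Q y with _ | y'
    · rw [colPos_of_west_eq_none hy]
      simp [southwestSum_zero]
    · rw [← colPos_of_west_eq_some hy]
      exact ⟨h x y', hs y'⟩
  have h1 := southwestSum_difference (Q := Q) f x y
  have h2 := southwestSum_difference (Q := Q) g x y
  rw [h, hs, hw.1, hw.2, h2] at h1
  exact_mod_cast h1.symm

lemma onesInBlock_eq_card (w : Equiv.Perm (BlockIdx d)) (x y : Fin (n + 1)) :
    onesInBlock w x y =
      (Finset.univ.filter fun j : BlockIdx d => (w j).1 = x ∧ j.1 = y).card := by
  refine Finset.card_bij (fun e _ => ⟨y, e.2⟩) ?_ ?_ ?_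
  · intro e he
    simp only [Finset.mem_filter, Finset.mem_univ, true_and, permMatrix, Matrix.of_apply,
      ite_eq_left_iff, zero_ne_one, imp_false, not_not] at he ⊢
    rw [← he]
    exact ⟨rfl, trivial⟩
  · intro e he e' he' h
    simp only [Finset.mem_filter, Finset.mem_univ, true_and, permMatrix, Matrix.of_apply,
      ite_eq_left_iff, zero_ne_one, imp_false, not_not] at he he'
    have h2 : e.2 = e'.2 := by simpa using h
    rw [← h2, ← he] at he'
    have h1 : e'.1 = e.1 := by simpa using he'
    exact Prod.ext h1.symm h2
  · rintro ⟨y', t⟩ hj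
    simp only [Finset.mem_filter, Finset.mem_univ, true_and] at hj
    obtain ⟨h1, rfl⟩ := hj
    subst h1
    refine ⟨((w ⟨y', t⟩).2, t), ?_, rfl⟩
    simp [permMatrix]

/-- The columns are zero or distinct unit vectors, so the rank is the number of ones. -/
lemma rank_partialPerm {α : Type*} [Fintype α] [DecidableEq α] (w : Equiv.Perm α)
    (P C : α → Prop) [DecidablePred P] [DecidablePred C] :
    (Matrix.of fun (i : {i // P i}) (j : {j // C j}) =>
      if i.1 = w j.1 then (1 : ℚ) else 0).rank =
      (Finset.univ.filter fun j => P (w j) ∧ C j).card := by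
  let g : {j // P (w j) ∧ C j} → {i // P i} := fun j => ⟨w j.1, j.2.1⟩
  have hg : Function.Injective g := by
    intro j j' h
    exact Subtype.ext (w.injective (congrArg Subtype.val h))
  have hli : LinearIndependent ℚ (fun j => (Pi.single (g j) 1 : {i // P i} → ℚ)) := by
    have := (Pi.basisFun ℚ {i // P i}).linearIndependent.comp g hg
    convert this using 2 with j
    simp
  set A := Matrix.of fun (i : {i // P i}) (j : {j // C j}) =>
      if i.1 = w j.1 then (1 : ℚ) else 0 with hA
  have hcol : ∀ (j : {j // C j}) (hj : P (w j.1)),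
      A.col j = Pi.single (g ⟨j.1, hj, j.2⟩) 1 := by
    intro j hj
    ext i
    simp [hA, g, Matrix.col, Pi.single_apply, Subtype.ext_iff]
  have hspan : Submodule.span ℚ (Set.range A.col) =
      Submodule.span ℚ (Set.range fun j => (Pi.single (g j) 1 : {i // P i} → ℚ)) := by
    apply le_antisymm <;> rw [Submodule.span_le]
    · rintro _ ⟨j, rfl⟩
      by_cases hj : P (w j.1)
      · rw [hcol j hj]
        exact Submodule.subset_span ⟨_, rfl⟩
      · have : A.col j = 0 := by
          ext i
          simp only [hA, Matrix.col, Matrix.transpose_apply, Matrix.of_apply, Pi.zero_apply,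
            ite_eq_right_iff, one_ne_zero, imp_false]
          exact fun h => hj (h ▸ i.2)
        rw [this]
        exact Submodule.zero_mem _
    · rintro _ ⟨j, rfl⟩
      exact Submodule.subset_span ⟨⟨j.1, j.2.2⟩, hcol _ j.2.1⟩
  rw [Matrix.rank_eq_finrank_span_cols, ← Fintype.card_subtype, ← finrank_span_eq_card hli, hspan]

lemma swRank_permMatrix (w : Equiv.Perm (BlockIdx d)) (x y : Fin (n + 1)) :
    swRank Q (permMatrix w) (some x) (some y) =
      southwestSum Q (onesInBlock w) (rowPos Q x) (colPos Q y + 1) := by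
  have h := rank_partialPerm w (fun i => rowPos Q x ≤ rowPos Q i.1)
    (fun j => colPos Q j.1 ≤ colPos Q y)
  refine Eq.trans (?_ : _ = _) (h.trans ?_)
  · rfl
  · simp only [southwestSum, onesInBlock_eq_card, Finset.card_filter]
    have h1 : ∀ x' y' : Fin (n + 1), (if rowPos Q x ≤ rowPos Q x' ∧ colPos Q y' < colPos Q y + 1
        then ∑ j : BlockIdx d, (if (w j).1 = x' ∧ j.1 = y' then 1 else 0) else 0) =
        ∑ j : BlockIdx d, if x' = (w j).1 then (if y' = j.1 then
          (if rowPos Q x ≤ rowPos Q (w j).1 ∧ colPos Q j.1 ≤ colPos Q y then 1 else 0) else 0)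
          else 0 := by
      intro x' y'
      split_ifs with h
      · refine Finset.sum_congr rfl fun j _ => ?_
        by_cases hx : x' = (w j).1
        · by_cases hy : y' = j.1
          · subst hx hy
            simp [h.1, Nat.lt_succ_iff.1 h.2]
          · simp [hx, hy, Ne.symm hy]
        · simp [hx, Ne.symm hx]
      · refine (Finset.sum_eq_zero fun j _ => ?_).symm
        split_ifs with hx hy h'
        · subst hx hy
          exact absurd ⟨h'.1, Nat.lt_succ_of_le h'.2⟩ h
        all_goals rfl
    simp only [h1]
    have h2 : ∀ x' : Fin (n + 1), (∑ y' : Fin (n + 1), ∑ j : BlockIdx d,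
        if x' = (w j).1 then (if y' = j.1 then
          (if rowPos Q x ≤ rowPos Q (w j).1 ∧ colPos Q j.1 ≤ colPos Q y then 1 else 0) else 0)
          else 0) = ∑ j : BlockIdx d, ∑ y' : Fin (n + 1),
        if x' = (w j).1 then (if y' = j.1 then
          (if rowPos Q x ≤ rowPos Q (w j).1 ∧ colPos Q j.1 ≤ colPos Q y then 1 else 0) else 0)
          else 0 := fun x' => Finset.sum_comm
    simp only [h2]
    rw [Finset.sum_comm]
    refine Finset.sum_congr rfl fun j _ => ?_
    simp

lemma multMatrix_eq_onesInBlock (w : Equiv.Perm (BlockIdx d)) (x y : Fin (n + 1)) :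
    multMatrix Q w x y = (onesInBlock w x y : ℤ) := by
  have hs : ∀ y, swRank Q (permMatrix w) (south Q x) (some y) =
      southwestSum Q (onesInBlock w) (rowPos Q x + 1) (colPos Q y + 1) := by
    intro y
    rcases hx : south Q x with _ | x'
    · rw [southwestSum_of_row_lt _ _ (rowPos_lt_of_south_eq_none hx)]
      rfl
    · rw [← rowPos_of_south_eq_some hx, swRank_permMatrix]
  have hw : swRank Q (permMatrix w) (some x) (west Q y) =
      southwestSum Q (onesInBlock w) (rowPos Q x) (colPos Q y) ∧
      swRank Q (permMatrix w) (south Q x) (west Q y) =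
      southwestSum Q (onesInBlock w) (rowPos Q x + 1) (colPos Q y) := by
    rcases hy : west Q y with _ | y'
    · rw [colPos_of_west_eq_none hy, southwestSum_zero, southwestSum_zero]
      refine ⟨rfl, ?_⟩
      cases south Q x <;> rfl
    · rw [← colPos_of_west_eq_some hy]
      exact ⟨swRank_permMatrix w x y', hs y'⟩
  rw [multMatrix, Matrix.of_apply, swRank_permMatrix, hs, hw.1, hw.2, southwestSum_difference]

end Counts

/-! ### Permutations of Z-type with prescribed block counts -/

section ZType

variable {d : Fin (n + 1) → ℕ}

/-- Equal fibre sizes mean equal multisets of values, and a weakly increasing sequence is the sorted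
list of its values. -/
lemma eq_of_monotone_of_card_fiber_eq {m : ℕ} {f g : Fin m → ℕ} (hf : Monotone f)
    (hg : Monotone g) (h : ∀ c, (Finset.univ.filter fun t => f t = c).card =
      (Finset.univ.filter fun t => g t = c).card) : f = g := by
  have hm : Finset.univ.val.map f = Finset.univ.val.map g := by
    ext c
    have := h c
    rw [Multiset.count_map, Multiset.count_map]
    simpa only [Finset.card_def, Finset.filter_val, eq_comm] using this
  rw [Fin.univ_val_map, Fin.univ_val_map, Multiset.coe_eq_coe] at hm
  exact List.ofFn_injective (hm.eq_of_sortedLE hf.sortedLE_ofFn hg.sortedLE_ofFn)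

/-- Along a block column the block rows hit by the ones move weakly south, so the number of ones per
block determines the block row of each. -/
lemma IsZType.label_eq {w w' : Equiv.Perm (BlockIdx d)} (hw : IsZType Q w) (hw' : IsZType Q w')
    (h : ∀ x y, onesInBlock w x y = onesInBlock w' x y) (j : BlockIdx d) :
    (w j).1 = (w' j).1 := by
  obtain ⟨y, t⟩ := j
  have mono : ∀ w : Equiv.Perm (BlockIdx d), IsZType Q w →
      Monotone fun t : Fin (d y) => rowPos Q (w ⟨y, t⟩).1 := by
    intro w hw t t' htt
    by_contra hne
    exact absurd (hw.col ⟨y, t'⟩ ⟨y, t⟩ rfl (not_le.1 hne)) (not_lt.2 htt)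
  have count : ∀ (w : Equiv.Perm (BlockIdx d)) (x : Fin (n + 1)),
      (Finset.univ.filter fun t : Fin (d y) => rowPos Q (w ⟨y, t⟩).1 = rowPos Q x).card =
        onesInBlock w x y := by
    intro w x
    rw [onesInBlock_eq_card]
    refine Finset.card_bij (fun t _ => ⟨y, t⟩) ?_ ?_ ?_
    · intro t ht
      simp only [Finset.mem_filter, Finset.mem_univ, true_and] at ht ⊢
      exact ⟨rowPos_injective Q ht, trivial⟩
    · intro t _ t' _ h
      simpa using h
    · rintro ⟨y', s⟩ hj
      simp only [Finset.mem_filter, Finset.mem_univ, true_and] at hj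
      obtain ⟨h1, rfl⟩ := hj
      exact ⟨s, by rw [Finset.mem_filter]; exact ⟨Finset.mem_univ _, congrArg _ h1⟩, rfl⟩
  have := eq_of_monotone_of_card_fiber_eq (mono w hw) (mono w' hw') (by
    intro c
    by_cases hc : ∃ x, rowPos Q x = c
    · obtain ⟨x, rfl⟩ := hc
      rw [count, count, h]
    · rw [Finset.filter_false_of_mem, Finset.filter_false_of_mem]
      · exact fun t _ ht => hc ⟨_, ht⟩
      · exact fun t _ ht => hc ⟨_, ht⟩)
  exact rowPos_injective Q (congrFun this t)

/-- The position of `w j` in its block row, in terms of the labels of the block rows. -/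
lemma IsZType.val_eq_card {w : Equiv.Perm (BlockIdx d)} (hw : IsZType Q w) (j : BlockIdx d) :
    ((w j).2 : ℕ) = (Finset.univ.filter fun j' : BlockIdx d => (w j').1 = (w j).1 ∧
      (colPos Q j.1 < colPos Q j'.1 ∨ (j'.1 = j.1 ∧ (j'.2 : ℕ) < (j.2 : ℕ)))).card := by
  have hlt : ∀ j' : BlockIdx d, (w j').1 = (w j).1 → (((w j').2 : ℕ) < ((w j).2 : ℕ) ↔
      (colPos Q j.1 < colPos Q j'.1 ∨ (j'.1 = j.1 ∧ (j'.2 : ℕ) < (j.2 : ℕ)))) := by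
    intro j' h
    rcases lt_trichotomy (colPos Q j.1) (colPos Q j'.1) with hc | hc | hc
    · exact iff_of_true (hw.row j j' h.symm hc) (Or.inl hc)
    · have hjj : j.1 = j'.1 := colPos_injective Q hc
      rw [or_iff_right hc.not_lt, and_iff_right hjj.symm]
      rcases lt_trichotomy (j'.2 : ℕ) (j.2 : ℕ) with ht | ht | ht
      · exact iff_of_true (hw.block j' j hjj.symm h ht) ht
      · have : j' = j := by
          obtain ⟨y, t⟩ := j
          obtain ⟨y', t'⟩ := j'
          obtain rfl : y = y' := hjj
          obtain rfl : t' = t := Fin.ext ht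
          rfl
        rw [this]
        exact iff_of_false (lt_irrefl _) (lt_irrefl _)
      · have := hw.block j j' hjj h.symm ht
        omega
    · have h1 := hw.row j' j h hc
      have h2 : j'.1 ≠ j.1 := fun h' => hc.ne (by rw [h'])
      exact iff_of_false (not_lt.2 (le_of_lt h1)) (by
        rintro (h' | h')
        · exact not_lt.2 hc.le h'
        · exact h2 h'.1)
  rw [← Fin.card_Iio (w j).2]
  refine Finset.card_bij (fun i _ => w.symm ⟨(w j).1, i⟩) ?_ ?_ ?_
  · intro i hi
    rw [Finset.mem_Iio] at hi
    have h1 : (w (w.symm ⟨(w j).1, i⟩)).1 = (w j).1 := by rw [w.apply_symm_apply]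
    rw [Finset.mem_filter]
    refine ⟨Finset.mem_univ _, h1, (hlt _ h1).1 ?_⟩
    rw [w.apply_symm_apply]
    exact hi
  · intro i _ i' _ h
    simpa using h
  · intro j' hj'
    simp only [Finset.mem_filter, Finset.mem_univ, true_and] at hj'
    obtain ⟨h1, h2⟩ := hj'
    have h3 := (hlt j' h1).2 h2
    obtain ⟨b, hb⟩ : ∃ b, w j' = b := ⟨_, rfl⟩
    rw [hb] at h1 h3
    obtain ⟨x, i⟩ := b
    subst h1
    exact ⟨i, Finset.mem_Iio.2 h3, by rw [← hb, w.symm_apply_apply]⟩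

/-- A permutation of Z-type is determined by the numbers of ones in its blocks. -/
theorem IsZType.eq_of_onesInBlock_eq {w w' : Equiv.Perm (BlockIdx d)} (hw : IsZType Q w)
    (hw' : IsZType Q w') (h : ∀ x y, onesInBlock w x y = onesInBlock w' x y) : w = w' := by
  have hl := hw.label_eq hw' h
  ext1 j
  have h1 := hw.val_eq_card j
  have h2 := hw'.val_eq_card j
  simp only [hl] at h1
  rw [← h2] at h1
  have h3 := hl j
  generalize w j = b at h1 h3
  generalize w' j = b' at h1 h3
  obtain ⟨x, i⟩ := b
  obtain ⟨x', i'⟩ := b'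
  obtain rfl : x = x' := h3
  obtain rfl : i = i' := Fin.ext h1
  rfl

lemma exists_equiv_fin_of_injective {S α : Type*} [Fintype S] [LinearOrder α] {f : S → α}
    (hf : Function.Injective f) {m : ℕ} (hm : Fintype.card S = m) :
    ∃ e : S ≃ Fin m, ∀ s s', f s < f s' → e s < e s' := by
  let _ : LinearOrder S := LinearOrder.lift' f hf
  exact ⟨(Fintype.orderIsoFinOfCardEq S hm).symm.toEquiv, fun s s' h =>
    (Fintype.orderIsoFinOfCardEq S hm).symm.lt_iff_lt.2 h⟩

/-- There is a permutation of Z-type with prescribed numbers of ones in its blocks. -/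
theorem exists_isZType (Q : Fin n → Dir) {M : Fin (n + 1) → Fin (n + 1) → ℕ}
    (hrow : ∀ x, ∑ y, M x y = d x) (hcol : ∀ y, ∑ x, M x y = d y) :
    ∃ w : Equiv.Perm (BlockIdx d), IsZType Q w ∧ ∀ x y, onesInBlock w x y = M x y := by
  -- The M x y ones of block (x, y) are labelled by `Fin (M x y)`. Inside block column y they take
  -- the positions given by sorting first by block row from the north, then by label.
  have hc : ∀ y, ∃ e : (Σ x, Fin (M x y)) ≃ Fin (d y), ∀ s s',
      toLex (rowPos Q s.1, (s.2 : ℕ)) < toLex (rowPos Q s'.1, (s'.2 : ℕ)) → e s < e s' := by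
    intro y
    refine exists_equiv_fin_of_injective
      (f := fun s : Σ x, Fin (M x y) => toLex (rowPos Q s.1, (s.2 : ℕ))) ?_ (by simp [hcol])
    rintro ⟨x, t⟩ ⟨x', t'⟩ h
    obtain ⟨h1, h2⟩ := Prod.ext_iff.1 (toLex.injective h)
    obtain rfl := rowPos_injective Q h1
    obtain rfl := Fin.ext h2
    rfl
  -- Inside block row x the sorting is by block column from the east, hence the order dual, so that
  -- the blocks ascend from southwest to northeast.
  have hr : ∀ x, ∃ e : (Σ y, Fin (M x y)) ≃ Fin (d x), ∀ s s',
      toLex (OrderDual.toDual (colPos Q s.1), (s.2 : ℕ)) <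
        toLex (OrderDual.toDual (colPos Q s'.1), (s'.2 : ℕ)) → e s < e s' := by
    intro x
    refine exists_equiv_fin_of_injective (f := fun s : Σ y, Fin (M x y) =>
      toLex (OrderDual.toDual (colPos Q s.1), (s.2 : ℕ))) ?_ (by simp [hrow])
    rintro ⟨x, t⟩ ⟨x', t'⟩ h
    obtain ⟨h1, h2⟩ := Prod.ext_iff.1 (toLex.injective h)
    obtain rfl := colPos_injective Q h1
    obtain rfl := Fin.ext h2
    rfl
  choose e he using hc
  choose e' he' using hr
  -- Each one keeps its label when passing from its column position to its row position, so each
  -- block carries an identity matrix.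
  let σ : (Σ y, Σ x, Fin (M x y)) ≃ Σ x, Σ y, Fin (M x y) :=
    { toFun := fun s => ⟨s.2.1, s.1, s.2.2⟩
      invFun := fun s => ⟨s.2.1, s.1, s.2.2⟩
      left_inv := fun _ => rfl
      right_inv := fun _ => rfl }
  let w : Equiv.Perm (BlockIdx d) :=
    (Equiv.sigmaCongrRight e).symm.trans (σ.trans (Equiv.sigmaCongrRight e'))
  have hw : ∀ y x (t : Fin (M x y)), w ⟨y, e y ⟨x, t⟩⟩ = ⟨x, e' x ⟨y, t⟩⟩ := by
    intro y x t
    have : (⟨y, e y ⟨x, t⟩⟩ : BlockIdx d) = Equiv.sigmaCongrRight e ⟨y, x, t⟩ := rfl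
    simp only [w, Equiv.trans_apply, this, Equiv.symm_apply_apply]
    rfl
  have hsurj : ∀ j : BlockIdx d, ∃ y x, ∃ t : Fin (M x y), j = ⟨y, e y ⟨x, t⟩⟩ := by
    rintro ⟨y, t⟩
    obtain ⟨⟨x, s⟩, rfl⟩ := (e y).surjective t
    exact ⟨y, x, s, rfl⟩
  refine ⟨w, ⟨?_, ?_, ?_⟩, fun x y => ?_⟩
  · intro j j' h1 h2 h3
    obtain ⟨y, x, t, rfl⟩ := hsurj j
    obtain ⟨y', x', t', rfl⟩ := hsurj j'
    obtain rfl : y = y' := h1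
    rw [hw, hw] at h2 ⊢
    obtain rfl : x = x' := h2
    refine he' x _ _ (Prod.Lex.toLex_lt_toLex.2 (Or.inr ⟨rfl, ?_⟩))
    by_contra hne
    rcases (not_lt.1 hne).lt_or_eq with h | h
    · exact absurd (he y ⟨x, t'⟩ ⟨x, t⟩ (Prod.Lex.toLex_lt_toLex.2 (Or.inr ⟨rfl, h⟩)))
        (not_lt.2 (Fin.lt_def.2 h3).le)
    · obtain rfl := Fin.ext h
      exact lt_irrefl _ h3
  · intro j j' h1 h2
    obtain ⟨y, x, t, rfl⟩ := hsurj j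
    obtain ⟨y', x', t', rfl⟩ := hsurj j'
    rw [hw, hw] at h1 ⊢
    obtain rfl : x = x' := h1
    exact he' x _ _ (Prod.Lex.toLex_lt_toLex.2 (Or.inl (OrderDual.toDual_lt_toDual.2 h2)))
  · intro j j' h1 h2
    obtain ⟨y, x, t, rfl⟩ := hsurj j
    obtain ⟨y', x', t', rfl⟩ := hsurj j'
    obtain rfl : y = y' := h1
    rw [hw, hw] at h2
    exact he y _ _ (Prod.Lex.toLex_lt_toLex.2 (Or.inl h2))
  · rw [onesInBlock_eq_card, ← Fintype.card_fin (M x y), ← Finset.card_univ]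
    refine (Finset.card_bij (fun t _ => ⟨y, e y ⟨x, t⟩⟩) ?_ ?_ ?_).symm
    · intro t _
      simp [hw]
    · intro t _ t' _ h
      simpa using h
    · intro j hj
      obtain ⟨y', x', t, rfl⟩ := hsurj j
      rw [Finset.mem_filter, hw] at hj
      obtain ⟨-, h1, h2⟩ := hj
      obtain rfl : x' = x := h1
      obtain rfl : y' = y := h2
      exact ⟨t, Finset.mem_univ t, rfl⟩

end ZType

end TypeAQuiver

/-! ### Assembly of the theorem. -/

theorem mainTheorem5 {k : Type*} [Field k] {n : ℕ} (Q : Fin n → TypeAQuiver.Dir)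
    (d : Fin (n + 1) → ℕ) (r : Fin (n + 1) → Fin (n + 1) → ℕ)
    (V : TypeAQuiver.RepSpace k Q d) (hV : V ∈ TypeAQuiver.rankOrbit k Q d r)
    (m : Fin (n + 1) → Fin (n + 1) → ℕ)
    (hm : TypeAQuiver.Isomorphic V (TypeAQuiver.sumIntervals k Q m)) :
    (∃! w : Equiv.Perm (TypeAQuiver.BlockIdx d), TypeAQuiver.IsZelevinskyPerm k Q d r w) ∧
    ∀ w : Equiv.Perm (TypeAQuiver.BlockIdx d), TypeAQuiver.IsZelevinskyPerm k Q d r w →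
      (∀ x y : Fin (n + 1),
        TypeAQuiver.multMatrix Q w x y = (TypeAQuiver.onesInBlock w x y : ℤ)) ∧
      (∀ x y : Fin (n + 1),
        TypeAQuiver.multMatrix Q w x y =
          if y ≤ x then (m y x : ℤ)
          else if (y : ℕ) = (x : ℕ) + 1 then (TypeAQuiver.crossing m x y : ℤ)
          else 0) := by
  have hzeta : ∀ x y, TypeAQuiver.swRank Q (TypeAQuiver.zeta V) (some x) (some y) =
      TypeAQuiver.southwestSum Q (TypeAQuiver.zelevinskyMult m) (TypeAQuiver.rowPos Q x)
        (TypeAQuiver.colPos Q y + 1) := by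
    intro x y
    rw [TypeAQuiver.swRank_zeta_eq_sum hm, TypeAQuiver.southwestSum]
    simp only [Nat.lt_succ_iff]
  have hones : ∀ w : Equiv.Perm (TypeAQuiver.BlockIdx d),
      TypeAQuiver.IsZelevinskyPerm k Q d r w →
      ∀ x y, TypeAQuiver.onesInBlock w x y = TypeAQuiver.zelevinskyMult m x y := by
    intro w hw
    -- (ZP1) for the given V alone already fixes all block counts.
    refine TypeAQuiver.eq_of_southwestSum_eq (Q := Q) fun x y => ?_
    rw [← TypeAQuiver.swRank_permMatrix, hw.rank_eq V hV, hzeta]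
  refine ⟨?_, fun w hw => ⟨TypeAQuiver.multMatrix_eq_onesInBlock w, fun x y => ?_⟩⟩
  · obtain ⟨w, hw, hwM⟩ := TypeAQuiver.exists_isZType Q
      (TypeAQuiver.sum_zelevinskyMult_row hm) (TypeAQuiver.sum_zelevinskyMult_col hm)
    refine ⟨w, ⟨fun V' hV' x y => ?_, hw⟩, fun w' hw' =>
      hw'.zType.eq_of_onesInBlock_eq hw fun x y => by rw [hones w' hw', hwM]⟩
    -- (ZP1) concerns all V' with the same rank parameter, whose decomposition is not given; their
    -- ranks agree with those of V.
    rw [TypeAQuiver.swRank_zeta_eq_of_mem_rankOrbit hV' hV, hzeta,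
      TypeAQuiver.swRank_permMatrix, TypeAQuiver.southwestSum, TypeAQuiver.southwestSum]
    simp only [hwM]
  · rw [TypeAQuiver.multMatrix_eq_onesInBlock, hones w hw, TypeAQuiver.zelevinskyMult]
    split_ifs <;> simp
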